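/- **Setting.** Let $n\ge 1$ and let $\Omega\subset\mathbb R^n$ be open, bounded, connected and with smooth boundary. Let $m\ge1$ and let $\Omega_{0,1},\dots,\Omega_{0,m}$ be open sets with smooth boundary such that $\overline{\Omega}_{0,i}\subset\Omega$ and the closures $\overline{\Omega}_{0,i}$ are pairwise disjoint; put $\Omega_0=\bigcup_i\Omega_{0,i}$ and $\Omega_1=\Omega\setminus\overline{\Omega}_0$. Let $p:\Omega\to\mathbb R$ be continuous with $2<p^-\le p(x)\le p^+<\infty$ for all $x\in\Omega$, and let $\eta>0$. For $\lambda\in(0,1]$ let $d_\lambda:\Omega\to(0,\infty)$ be smooth, and let $d_0:\Omega_1\to(0,\infty)$ be smooth, with $0<m_0\le d_\lambda\le M_\lambda$ on $\Omega$ for $\lambda\in(0,1]$ and $m_0\le d_0\le M_0$ on $\Omega_1$, such that, as $\lambda\to0^+$, $d_\lambda\to d_0$ uniformly on $\Omega_1$ and $d_\lambda\to\infty$ uniformly on compact subsets of $\Omega_0$. Let $L^{p(x)}(\Omega)$ carry the Luxemburg norm $\|v\|_{p(x)}=\inf\{k>0:\int_\Omega|v/k|^{p(x)}dx\le1\}$,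 let $W^{1,p(x)}(\Omega)$ be the space of $u\in L^{p(x)}(\Omega)$ with weak gradient in $L^{p(x)}(\Omega)$, with the norm $\|u\|_V=\|u\|_{p(x)}+\|\nabla u\|_{p(x)}$, and let $V=W^{1,p(x)}_0(\Omega)$ be the closure of $C_c^\infty(\Omega)$ in it. Let $V_0$ be the subspace of those $u\in V$ that are constant on each $\Omega_{0,i}$, with the same norm. Let $H=L^2(\Omega)$ and let $H_0$ be the subspace of those $u\in L^2(\Omega)$ that are constant on each $\Omega_{0,i}$. **Theorem.** For $\lambda\in(0,1]$, the formula $$\langle A_\lambda u,v\rangle=\int_\Omega d_\lambda(x)\,(|\nabla u|^{p(x)-2}+\eta)\,\nabla u\cdot\nabla v\,dx+\int_\Omega|u|^{p(x)-2}u\,v\,dx,\qquad u,v\in V,$$ has absolutely convergent integrals and defines an operator $A_\lambda:V\to V'$; likewise $$\langle A_0 u,v\rangle=\int_{\Omega_1} d_0(x)\,(|\nabla u|^{p(x)-2}+\eta)\,\nabla u\cdot\nabla v\,dx+\int_\Omega|u|^{p(x)-2}u\,v\,dx,\qquad u,v\in V_0,$$ defines an operator $A_0:V_0\to V_0'$.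 Write $(V_\lambda,H_\lambda)=(V,H)$ for $\lambda\in(0,1]$. For every $\lambda\in[0,1]$: 1. $A_\lambda$ is monotone ($\langle A_\lambda u-A_\lambda v,u-v\rangle\ge0$ for all $u,v\in V_\lambda$), hemicontinuous ($t\mapsto\langle A_\lambda(u+tv),w\rangle$ is continuous on $\mathbb R$ for all $u,v,w\in V_\lambda$) and coercive ($\langle A_\lambda u,u\rangle/\|u\|_V\to\infty$ as $\|u\|_V\to\infty$). 2. The $H_\lambda$-realization $A^H_\lambda$ of $A_\lambda$, with domain $D(A^H_\lambda)=\{u\in V_\lambda:\ \exists f\in H_\lambda\ \forall v\in V_\lambda\ \langle A_\lambda u,v\rangle=(f,v)_{L^2}\}$ and $A^H_\lambda u=f$, is a well-defined (single-valued) maximal monotone operator in $H_\lambda$. 3. The Cauchy problem $u_t+A^H_\lambda u=B(u)$, $u(0)=u_0$, is globally well posed in $H_\lambda$ for every $B:H_\lambda\to H_\lambda$ that is Lipschitz with some constant $L$: for every $u_0\in H_\lambda$ there is a function $u:[0,\infty)\to H_\lambda$ that is a weak solution on $[0,T]$ for every $T>0$; if $u_0\in D(A^H_\lambda)$, there is a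 $u$ that for every $T>0$ is a strong solution on $[0,T]$ and Lipschitz continuous on $[0,T]$; and any two weak solutions $u,v$ on $[0,T]$ with initial values $u_0,v_0$ satisfy $\|u(t)-v(t)\|_{L^2}\le e^{Lt}\|u_0-v_0\|_{L^2}$ for $t\in[0,T]$ (in particular, weak solutions are unique). Here a strong solution on $[0,T]$ is a $u\in C([0,T];H_\lambda)$ with $u(0)=u_0$ that is absolutely continuous on compact subintervals of $(0,T)$ and for a.e. $t\in(0,T)$ is differentiable at $t$ with $u(t)\in D(A^H_\lambda)$ and $u'(t)+A^H_\lambda u(t)=B(u(t))$; a weak solution on $[0,T]$ is a $u\in C([0,T];H_\lambda)$ with $u(0)=u_0$ that is the limit in $C([0,T];H_\lambda)$ of strong solutions of the equation (with arbitrary initial values). -/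

import Mathlib

open MeasureTheory Set Filter Topology
open scoped NNReal ContDiff

/-! ## Variable exponent Lebesgue spaces -/

section VariableLebesgue

variable {α : Type*} [MeasurableSpace α]

/-- A bounded measurable exponent `p(·) ≥ 1` on a measure space. -/
structure VarExponent (μ : Measure α) where
  toFun : α → ℝ
  aemeasurable : AEMeasurable toFun μ
  one_le : ∀ᵐ x ∂μ, 1 ≤ toFun x
  bounded : ∃ b : ℝ, ∀ᵐ x ∂μ, toFun x ≤ b

variable {μ : Measure α}

/-- The modular `ρ(f) = ∫ ‖f(x)‖^{p(x)} dμ(x)`, with values in `[0, ∞]`. -/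
noncomputable def VarExponent.modular (p : VarExponent μ) {F : Type*} [NormedAddCommGroup F]
    (f : α → F) : ENNReal :=
  ∫⁻ x, ‖f x‖ₑ ^ p.toFun x ∂μ

theorem VarExponent.modular_congr (p : VarExponent μ) {F : Type*} [NormedAddCommGroup F]
    {f g : α → F} (h : f =ᵐ[μ] g) : p.modular f = p.modular g := by
  refine lintegral_congr_ae ?_
  filter_upwards [h] with x hx
  rw [hx]

theorem VarExponent.aemeasurable_integrand (p : VarExponent μ) {F : Type*} [NormedAddCommGroup F]
    {f : α → F} (hf : AEStronglyMeasurable f μ) :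
    AEMeasurable (fun x => ‖f x‖ₑ ^ p.toFun x) μ :=
  hf.enorm.pow p.aemeasurable

/-- Convexity of the modular. -/
theorem VarExponent.modular_convex (p : VarExponent μ) {F : Type*} [NormedAddCommGroup F]
    [NormedSpace ℝ F] {f g : α → F} (hf : AEStronglyMeasurable f μ) {a b : ℝ}
    (ha : 0 ≤ a) (hb : 0 ≤ b) (hab : a + b = 1) :
    p.modular (fun x => a • f x + b • g x) ≤
      ENNReal.ofReal a * p.modular f + ENNReal.ofReal b * p.modular g := by
  unfold VarExponent.modular
  rw [← lintegral_const_mul' _ _ ENNReal.ofReal_ne_top,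
    ← lintegral_const_mul' _ _ ENNReal.ofReal_ne_top,
    ← lintegral_add_left' ((p.aemeasurable_integrand hf).const_mul _)]
  refine lintegral_mono_ae ?_
  filter_upwards [p.one_le] with x hx
  refine le_trans (ENNReal.rpow_le_rpow (enorm_add_le _ _) (by linarith)) ?_
  rw [enorm_smul, enorm_smul, Real.enorm_of_nonneg ha, Real.enorm_of_nonneg hb]
  refine ENNReal.rpow_arith_mean_le_arith_mean2_rpow _ _ _ _ ?_ hx
  rw [← ENNReal.ofReal_add ha hb, hab, ENNReal.ofReal_one]

/-- For `0 ≤ a ≤ 1` one has `ρ(a f) ≤ a ρ(f)`. -/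
theorem VarExponent.modular_smul_le (p : VarExponent μ) {F : Type*} [NormedAddCommGroup F]
    [NormedSpace ℝ F] (f : α → F) {a : ℝ} (ha : 0 ≤ a) (ha1 : a ≤ 1) :
    p.modular (fun x => a • f x) ≤ ENNReal.ofReal a * p.modular f := by
  unfold VarExponent.modular
  rw [← lintegral_const_mul' _ _ ENNReal.ofReal_ne_top]
  refine lintegral_mono_ae ?_
  filter_upwards [p.one_le] with x hx
  rw [enorm_smul, Real.enorm_of_nonneg ha, ENNReal.mul_rpow_of_nonneg _ _ (by linarith)]
  gcongr
  calc ENNReal.ofReal a ^ p.toFun x ≤ ENNReal.ofReal a ^ (1 : ℝ) :=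
        ENNReal.rpow_le_rpow_of_exponent_ge (by simpa using ha1) hx
    _ = ENNReal.ofReal a := ENNReal.rpow_one _

/-- A bounded exponent: finiteness of the modular is stable under scaling. -/
theorem VarExponent.modular_smul_lt_top (p : VarExponent μ) {F : Type*} [NormedAddCommGroup F]
    [NormedSpace ℝ F] {f : α → F} (c : ℝ) (hf : p.modular f < ⊤) :
    p.modular (fun x => c • f x) < ⊤ := by
  obtain ⟨b, hb⟩ := p.bounded
  have key : p.modular (fun x => c • f x) ≤
      (max 1 ‖c‖ₑ) ^ (max b 0) * p.modular f := by
    unfold VarExponent.modular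
    rw [← lintegral_const_mul' _ _ (by
      refine ENNReal.rpow_ne_top_of_nonneg (le_max_right _ _) ?_
      simp)]
    refine lintegral_mono_ae ?_
    filter_upwards [p.one_le, hb] with x hx hxb
    rw [enorm_smul, ENNReal.mul_rpow_of_nonneg _ _ (by linarith)]
    gcongr
    calc ‖c‖ₑ ^ p.toFun x ≤ (max 1 ‖c‖ₑ) ^ p.toFun x :=
          ENNReal.rpow_le_rpow (le_max_right _ _) (by linarith)
      _ ≤ (max 1 ‖c‖ₑ) ^ (max b 0) :=
          ENNReal.rpow_le_rpow_of_exponent_le (le_max_left _ _) (le_max_of_le_left hxb)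
  refine lt_of_le_of_lt key (ENNReal.mul_lt_top ?_ hf)
  refine lt_top_iff_ne_top.2 (ENNReal.rpow_ne_top_of_nonneg (le_max_right _ _) ?_)
  simp

/-- The space `L^{p(·)}(μ; F)` of (classes of) measurable functions with finite modular. -/
def varLpSubmodule (p : VarExponent μ) (F : Type*) [NormedAddCommGroup F] [NormedSpace ℝ F] :
    Submodule ℝ (α →ₘ[μ] F) where
  carrier := {f | p.modular f < ⊤}
  zero_mem' := by
    have h : p.modular ((0 : α →ₘ[μ] F) : α → F) = 0 := by
      rw [p.modular_congr AEEqFun.coeFn_zero]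
      unfold VarExponent.modular
      rw [lintegral_eq_zero_iff' (p.aemeasurable_integrand aestronglyMeasurable_zero)]
      filter_upwards [p.one_le] with x hx
      simp only [Pi.zero_apply, enorm_zero]
      exact ENNReal.zero_rpow_of_pos (by linarith)
    simp only [mem_ofPred_eq, h, ENNReal.zero_lt_top]
  add_mem' := by
    intro f g hf hg
    have h2 := p.modular_convex (f := fun x => (2 : ℝ) • f x) (g := fun x => (2 : ℝ) • g x)
      (a := 1 / 2) (b := 1 / 2) (f.aestronglyMeasurable.const_smul 2)
      (by norm_num) (by norm_num) (by norm_num)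
    have h3 : p.modular ((f + g : α →ₘ[μ] F) : α → F) =
        p.modular (fun x => (1 / 2 : ℝ) • (2 : ℝ) • f x + (1 / 2 : ℝ) • (2 : ℝ) • g x) := by
      refine p.modular_congr ?_
      filter_upwards [AEEqFun.coeFn_add f g] with x hx
      rw [hx]
      simp [smul_smul]
    simp only [mem_ofPred_eq]
    rw [h3]
    refine lt_of_le_of_lt h2 (ENNReal.add_lt_top.2 ⟨?_, ?_⟩)
    · exact ENNReal.mul_lt_top ENNReal.ofReal_lt_top (p.modular_smul_lt_top 2 hf)
    · exact ENNReal.mul_lt_top ENNReal.ofReal_lt_top (p.modular_smul_lt_top 2 hg)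
  smul_mem' := by
    intro c f hf
    simp only [mem_ofPred_eq]
    rw [p.modular_congr (AEEqFun.coeFn_smul c f)]
    exact p.modular_smul_lt_top c hf

/-- The space `L^{p(·)}(μ; F)` as a type. -/
def VarLp (p : VarExponent μ) (F : Type*) [NormedAddCommGroup F] [NormedSpace ℝ F] : Type _ :=
  varLpSubmodule p F

namespace VarLp

variable {p : VarExponent μ} {F : Type*} [NormedAddCommGroup F] [NormedSpace ℝ F]

instance instAddCommGroup : AddCommGroup (VarLp p F) :=
  inferInstanceAs (AddCommGroup (varLpSubmodule p F))

instance instModule : Module ℝ (VarLp p F) :=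
  inferInstanceAs (Module ℝ (varLpSubmodule p F))

/-- The underlying class of functions. -/
def toAE (f : VarLp p F) : α →ₘ[μ] F := Subtype.val f

theorem toAE_zero : (0 : VarLp p F).toAE = 0 := rfl

theorem toAE_add (f g : VarLp p F) : (f + g).toAE = f.toAE + g.toAE := rfl

theorem toAE_smul (c : ℝ) (f : VarLp p F) : (c • f).toAE = c • f.toAE := rfl

theorem modular_lt_top (f : VarLp p F) : p.modular f.toAE < ⊤ := Subtype.property f

/-- The admissible scalings in the definition of the Luxemburg norm. -/
def scalings (f : VarLp p F) : Set ℝ :=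
  {k : ℝ | 0 < k ∧ p.modular (fun x => k⁻¹ • f.toAE x) ≤ 1}

/-- The Luxemburg norm `‖f‖ = inf {k > 0 : ρ(f / k) ≤ 1}`. -/
noncomputable instance instNorm : Norm (VarLp p F) where
  norm f := sInf (scalings f)

theorem norm_def (f : VarLp p F) : ‖f‖ = sInf (scalings f) := rfl

theorem scalings_bddBelow (f : VarLp p F) : BddBelow (scalings f) :=
  ⟨0, fun _ hk => hk.1.le⟩

theorem scalings_nonempty (f : VarLp p F) : (scalings f).Nonempty := by
  have hf : p.modular f.toAE < ⊤ := f.modular_lt_top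
  set R := (p.modular f.toAE).toReal with hR
  have hR0 : 0 ≤ R := ENNReal.toReal_nonneg
  have hk : 0 < R + 1 := by linarith
  refine ⟨R + 1, hk, ?_⟩
  refine le_trans (p.modular_smul_le _ (inv_nonneg.2 hk.le)
    (inv_le_one_of_one_le₀ (by linarith))) ?_
  rw [← ENNReal.ofReal_toReal (a := p.modular f.toAE) hf.ne, ← ENNReal.ofReal_mul (inv_nonneg.2 hk.le)]
  rw [ENNReal.ofReal_le_one, ← hR, inv_mul_le_iff₀ hk]
  linarith

theorem norm_nonneg' (f : VarLp p F) : 0 ≤ ‖f‖ :=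
  Real.sInf_nonneg fun _ hk => hk.1.le

theorem scalings_smul_subset (c : ℝ) (hc : c ≠ 0) (f : VarLp p F) {k : ℝ}
    (hk : k ∈ scalings f) : |c| * k ∈ scalings (c • f) := by
  have hc' : 0 < |c| := abs_pos.2 hc
  refine ⟨mul_pos hc' hk.1, ?_⟩
  refine le_trans (le_of_eq ?_) hk.2
  refine lintegral_congr_ae ?_
  filter_upwards [AEEqFun.coeFn_smul c f.toAE] with x hx
  have h1 : (c • f).toAE x = c • f.toAE x := by
    rw [toAE_smul, hx]; rfl
  have h2 : ‖(|c| * k)⁻¹ • (c • f).toAE x‖ₑ =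
      ‖k⁻¹ • f.toAE x‖ₑ := by
    rw [h1, smul_smul, enorm_smul, enorm_smul]
    congr 1
    rw [← ofReal_norm, ← ofReal_norm]
    congr 1
    rw [norm_mul, norm_inv, norm_mul, Real.norm_eq_abs, Real.norm_eq_abs, abs_abs, norm_inv,
      Real.norm_eq_abs, Real.norm_eq_abs]
    field_simp
  rw [h2]

theorem norm_smul_le' (c : ℝ) (hc : c ≠ 0) (f : VarLp p F) : ‖c • f‖ ≤ |c| * ‖f‖ := by
  have hc' : 0 < |c| := abs_pos.2 hc
  rw [← div_le_iff₀' hc', norm_def f]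
  refine le_csInf (scalings_nonempty f) fun k hk => ?_
  rw [div_le_iff₀' hc']
  exact csInf_le (scalings_bddBelow _) (scalings_smul_subset c hc f hk)

theorem norm_add_le' (f g : VarLp p F) : ‖f + g‖ ≤ ‖f‖ + ‖g‖ := by
  refine le_of_forall_pos_le_add fun ε hε => ?_
  obtain ⟨a, ha, haf⟩ := exists_lt_of_csInf_lt (scalings_nonempty f)
    (show sInf (scalings f) < ‖f‖ + ε / 2 by rw [← norm_def]; linarith)
  obtain ⟨b, hb, hbg⟩ := exists_lt_of_csInf_lt (scalings_nonempty g)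
    (show sInf (scalings g) < ‖g‖ + ε / 2 by rw [← norm_def]; linarith)
  have ha0 := ha.1
  have hb0 := hb.1
  have hab : 0 < a + b := add_pos ha0 hb0
  have hmem : a + b ∈ scalings (f + g) := by
    refine ⟨hab, ?_⟩
    have h := p.modular_convex (f := fun x => a⁻¹ • f.toAE x)
      (g := fun x => b⁻¹ • g.toAE x) (a := a / (a + b)) (b := b / (a + b))
      (f.toAE.aestronglyMeasurable.const_smul _)
      (by positivity) (by positivity) (by field_simp)
    refine le_trans (le_of_eq ?_) (le_trans h ?_)
    · refine p.modular_congr ?_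
      filter_upwards [AEEqFun.coeFn_add f.toAE g.toAE] with x hx
      have h1 : (f + g).toAE x =
          f.toAE x + g.toAE x := by
        rw [toAE_add, hx]; rfl
      rw [h1, smul_smul, smul_smul, smul_add]
      congr 2 <;> field_simp
    · calc ENNReal.ofReal (a / (a + b)) * p.modular (fun x => a⁻¹ • f.toAE x) +
            ENNReal.ofReal (b / (a + b)) * p.modular (fun x => b⁻¹ • g.toAE x)
          ≤ ENNReal.ofReal (a / (a + b)) * 1 + ENNReal.ofReal (b / (a + b)) * 1 := by
            gcongr
            · exact ha.2
            · exact hb.2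
        _ = 1 := by
            rw [mul_one, mul_one, ← ENNReal.ofReal_add (by positivity) (by positivity),
              ← add_div, div_self hab.ne', ENNReal.ofReal_one]
  have := csInf_le (scalings_bddBelow (f + g)) hmem
  rw [← norm_def] at this
  linarith

theorem eq_zero_of_norm_eq_zero' (f : VarLp p F) (h : ‖f‖ = 0) : f = 0 := by
  have hsmall : ∀ ε : ℝ, 0 < ε → p.modular f.toAE ≤ ENNReal.ofReal ε := by
    intro ε hε
    obtain ⟨k, hk, hkε⟩ := exists_lt_of_csInf_lt (scalings_nonempty f)
      (show sInf (scalings f) < min ε 1 by rw [← norm_def, h]; positivity)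
    have hk0 := hk.1
    have h1 := p.modular_smul_le (fun x => k⁻¹ • f.toAE x) hk0.le
      (hkε.le.trans (min_le_right _ _))
    have h2 : (fun x => k • k⁻¹ • f.toAE x) = f.toAE := by
      funext x
      rw [smul_smul, mul_inv_cancel₀ hk0.ne', one_smul]
    rw [h2] at h1
    calc p.modular f.toAE ≤ ENNReal.ofReal k * 1 :=
          h1.trans (by gcongr; exact hk.2)
      _ ≤ ENNReal.ofReal ε := by
          rw [mul_one]
          exact ENNReal.ofReal_le_ofReal (hkε.le.trans (min_le_left _ _))
  have hzero : p.modular f.toAE = 0 := by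
    refine le_antisymm (ENNReal.le_of_forall_pos_le_add fun ε hε _ => ?_) bot_le
    simpa using hsmall ε (by exact_mod_cast hε)
  unfold VarExponent.modular at hzero
  rw [lintegral_eq_zero_iff'
    (p.aemeasurable_integrand f.toAE.aestronglyMeasurable)] at hzero
  refine Subtype.ext (AEEqFun.ext ?_)
  filter_upwards [hzero, p.one_le, AEEqFun.coeFn_zero (β := F) (μ := μ)] with x hx hp h0
  change f.toAE x = (0 : α →ₘ[μ] F) x
  rw [h0]
  simp only [Pi.zero_apply] at hx ⊢
  rw [ENNReal.rpow_eq_zero_iff_of_pos (by linarith)] at hx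
  exact enorm_eq_zero.1 hx

theorem norm_zero' : ‖(0 : VarLp p F)‖ = 0 := by
  refine le_antisymm (le_of_forall_pos_le_add fun ε hε => ?_) (norm_nonneg' _)
  rw [zero_add]
  refine csInf_le (scalings_bddBelow _) ⟨hε, ?_⟩
  refine le_trans (le_of_eq ?_) (zero_le_one)
  have hm := p.aemeasurable_integrand
    ((0 : VarLp p F).toAE.aestronglyMeasurable.const_smul ε⁻¹)
  refine (lintegral_eq_zero_iff' hm).2 ?_
  filter_upwards [p.one_le, AEEqFun.coeFn_zero (β := F) (μ := μ)] with x hx h0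
  have h1 : (0 : VarLp p F).toAE x = 0 := h0
  simp only [Pi.smul_apply, Pi.zero_apply, h1, smul_zero, enorm_zero]
  exact ENNReal.zero_rpow_of_pos (by linarith)

theorem normedSpaceCore : NormedSpace.Core ℝ (VarLp p F) where
  norm_nonneg := norm_nonneg'
  norm_smul c f := by
    rw [Real.norm_eq_abs]
    by_cases hc : c = 0
    · subst hc
      rw [zero_smul, abs_zero, zero_mul, norm_zero']
    · refine le_antisymm (norm_smul_le' c hc f) ?_
      have h := norm_smul_le' c⁻¹ (inv_ne_zero hc) (c • f)
      rw [smul_smul, inv_mul_cancel₀ hc, one_smul, abs_inv, inv_mul_eq_div,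
        le_div_iff₀' (abs_pos.2 hc)] at h
      exact h
  norm_triangle := norm_add_le'
  norm_eq_zero_iff f := ⟨eq_zero_of_norm_eq_zero' f, fun h => by rw [h, norm_zero']⟩

noncomputable instance instNormedAddCommGroup : NormedAddCommGroup (VarLp p F) :=
  NormedAddCommGroup.ofCore normedSpaceCore

noncomputable instance instNormedSpace : NormedSpace ℝ (VarLp p F) :=
  NormedSpace.ofCore normedSpaceCore

/-- Functions in `L^{p(·)}` are locally integrable. -/
theorem locallyIntegrable [TopologicalSpace α] [IsLocallyFiniteMeasure μ] (f : VarLp p F) :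
    LocallyIntegrable f.toAE μ := by
  intro x
  obtain ⟨s, hs, hμ⟩ := μ.finiteAt_nhds x
  refine ⟨s, hs, f.toAE.aestronglyMeasurable.restrict, ?_⟩
  have hf : p.modular f.toAE < ⊤ := f.modular_lt_top
  refine lt_of_le_of_lt (b := ∫⁻ y in s, (1 + ‖f.toAE y‖ₑ ^ p.toFun y) ∂μ) ?_ ?_
  · refine lintegral_mono_ae ?_
    filter_upwards [ae_restrict_of_ae p.one_le] with y hy
    rcases le_total ‖f.toAE y‖ₑ 1 with h | h
    · exact h.trans le_self_add
    · refine le_trans ?_ le_add_self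
      calc ‖f.toAE y‖ₑ = ‖f.toAE y‖ₑ ^ (1 : ℝ) := (ENNReal.rpow_one _).symm
        _ ≤ _ := ENNReal.rpow_le_rpow_of_exponent_le h hy
  · rw [lintegral_add_left measurable_const]
    refine ENNReal.add_lt_top.2 ⟨by simpa using hμ, ?_⟩
    exact lt_of_le_of_lt (lintegral_mono' Measure.restrict_le_self le_rfl) hf

/-- On a finite measure space, `L^{p(·)} ⊆ L²` if `p ≥ 2`. -/
theorem memLp_two [IsFiniteMeasure μ] (h2 : ∀ᵐ x ∂μ, 2 ≤ p.toFun x) (f : VarLp p F) :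
    MemLp f.toAE 2 μ := by
  refine ⟨f.toAE.aestronglyMeasurable, ?_⟩
  have hf : p.modular f.toAE < ⊤ := f.modular_lt_top
  rw [eLpNorm_lt_top_iff_lintegral_rpow_enorm_lt_top (by norm_num) (by norm_num)]
  simp only [ENNReal.toReal_ofNat]
  refine lt_of_le_of_lt (b := ∫⁻ y, (1 + ‖f.toAE y‖ₑ ^ p.toFun y) ∂μ) ?_ ?_
  · refine lintegral_mono_ae ?_
    filter_upwards [h2] with y hy
    rcases le_total ‖f.toAE y‖ₑ 1 with h | h
    · refine le_trans ?_ le_self_add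
      exact ENNReal.rpow_le_one h (by norm_num)
    · exact le_trans (ENNReal.rpow_le_rpow_of_exponent_le h hy) le_add_self
  · rw [lintegral_add_left measurable_const]
    exact ENNReal.add_lt_top.2 ⟨by simp, hf⟩

/-- The inclusion `L^{p(·)} → L²` (each function is sent to itself). -/
noncomputable def toL2 [IsFiniteMeasure μ] (h2 : ∀ᵐ x ∂μ, 2 ≤ p.toFun x) :
    VarLp p F →ₗ[ℝ] Lp F 2 μ where
  toFun f := (memLp_two h2 f).toLp _
  map_add' f g := by
    rw [← MemLp.toLp_add (memLp_two h2 f) (memLp_two h2 g), MemLp.toLp_eq_toLp_iff]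
    rw [toAE_add]
    exact AEEqFun.coeFn_add _ _
  map_smul' c f := by
    rw [RingHom.id_apply, ← MemLp.toLp_const_smul c (memLp_two h2 f), MemLp.toLp_eq_toLp_iff]
    rw [toAE_smul]
    exact AEEqFun.coeFn_smul _ _

end VarLp

end VariableLebesgue

/-! ## Variable exponent Sobolev spaces -/

section VariableSobolev

variable {n : ℕ}

/-- `φ ∈ C_c^∞(Ω)`. -/
def IsTestFunction (Ω : Set (EuclideanSpace ℝ (Fin n))) (φ : EuclideanSpace ℝ (Fin n) → ℝ) :
    Prop :=
  ContDiff ℝ ∞ φ ∧ HasCompactSupport φ ∧ tsupport φ ⊆ Ω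

/-- `g` is the weak gradient of `u` in `Ω`: for all test functions `φ` and directions `e`,
`∫_Ω u ∂_e φ = - ∫_Ω φ g·e`. -/
def IsWeakGradient (Ω : Set (EuclideanSpace ℝ (Fin n))) (u : EuclideanSpace ℝ (Fin n) → ℝ)
    (g : EuclideanSpace ℝ (Fin n) → EuclideanSpace ℝ (Fin n)) : Prop :=
  ∀ φ, IsTestFunction Ω φ → ∀ e : EuclideanSpace ℝ (Fin n),
    ∫ x in Ω, fderiv ℝ φ x e * u x = -∫ x in Ω, φ x * inner ℝ e (g x)

/-- `W^{1,p(·)}(Ω)`: the pairs `(u, ∇u)` with `u ∈ L^{p(·)}(Ω)` and weak gradient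
`∇u ∈ L^{p(·)}(Ω; ℝⁿ)`. `WithLp 1` gives it the norm `‖u‖_{p(·)} + ‖∇u‖_{p(·)}`. -/
def varSobolevSubmodule {Ω : Set (EuclideanSpace ℝ (Fin n))} (p : VarExponent (volume.restrict Ω)) :
    Submodule ℝ (WithLp 1 (VarLp p ℝ × VarLp p (EuclideanSpace ℝ (Fin n)))) where
  carrier := {w | IsWeakGradient Ω w.fst.toAE
    w.snd.toAE}
  zero_mem' := by
    intro φ _ e
    have h1 : ∫ x in Ω, fderiv ℝ φ x e * (0 : _ →ₘ[volume.restrict Ω] ℝ) x = 0 := by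
      refine integral_eq_zero_of_ae ?_
      filter_upwards [AEEqFun.coeFn_zero (β := ℝ) (μ := volume.restrict Ω)] with x hx
      rw [hx]; simp
    have h2 : ∫ x in Ω, φ x *
        inner ℝ e ((0 : _ →ₘ[volume.restrict Ω] EuclideanSpace ℝ (Fin n)) x) = 0 := by
      refine integral_eq_zero_of_ae ?_
      filter_upwards [AEEqFun.coeFn_zero (β := EuclideanSpace ℝ (Fin n))
        (μ := volume.restrict Ω)] with x hx
      rw [hx]; simp
    exact h1.trans (by rw [← neg_zero]; exact congrArg Neg.neg h2.symm)
  add_mem' := by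
    intro v w hv hw φ hφ e
    have hd : Continuous fun x => fderiv ℝ φ x e :=
      (hφ.1.continuous_fderiv (by simp)).clm_apply continuous_const
    have hdc : HasCompactSupport fun x => fderiv ℝ φ x e := hφ.2.1.fderiv_apply ℝ e
    have hu : ∀ f : VarLp p ℝ, Integrable
        (fun x => fderiv ℝ φ x e * f.toAE x) (volume.restrict Ω) :=
      fun f => (VarLp.locallyIntegrable f).integrable_smul_left_of_hasCompactSupport hd hdc
    have hg : ∀ f : VarLp p (EuclideanSpace ℝ (Fin n)), Integrable
        (fun x => φ x * inner ℝ e (f.toAE x))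
        (volume.restrict Ω) := by
      intro f
      have h := ((VarLp.locallyIntegrable f).integrable_smul_left_of_hasCompactSupport
        hφ.1.continuous hφ.2.1).const_inner (𝕜 := ℝ) e
      simpa only [inner_smul_right] using h
    have e1 : ∫ x in Ω, fderiv ℝ φ x e *
          (v + w).fst.toAE x =
        (∫ x in Ω, fderiv ℝ φ x e * v.fst.toAE x) +
          ∫ x in Ω, fderiv ℝ φ x e * w.fst.toAE x := by
      rw [← integral_add (hu _) (hu _)]
      refine integral_congr_ae ?_
      filter_upwards [AEEqFun.coeFn_add v.fst.toAE
        w.fst.toAE] with x hx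
      rw [WithLp.add_fst, VarLp.toAE_add, hx, Pi.add_apply, mul_add]
    have e2 : ∫ x in Ω, φ x * inner ℝ e
          ((v + w).snd.toAE x) =
        (∫ x in Ω, φ x * inner ℝ e
          (v.snd.toAE x)) +
          ∫ x in Ω, φ x * inner ℝ e
            (w.snd.toAE x) := by
      rw [← integral_add (hg _) (hg _)]
      refine integral_congr_ae ?_
      filter_upwards [AEEqFun.coeFn_add
        v.snd.toAE
        w.snd.toAE] with x hx
      rw [WithLp.add_snd, VarLp.toAE_add, hx, Pi.add_apply, inner_add_right, mul_add]
    rw [e1, e2, hv φ hφ e, hw φ hφ e, neg_add]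
  smul_mem' := by
    intro c w hw φ hφ e
    have e1 : ∫ x in Ω, fderiv ℝ φ x e * (c • w).fst.toAE x =
        c * ∫ x in Ω, fderiv ℝ φ x e * w.fst.toAE x := by
      rw [← integral_const_mul]
      refine integral_congr_ae ?_
      filter_upwards [AEEqFun.coeFn_smul c w.fst.toAE] with x hx
      rw [WithLp.smul_fst, VarLp.toAE_smul, hx, Pi.smul_apply, smul_eq_mul]
      ring
    have e2 : ∫ x in Ω, φ x * inner ℝ e
          ((c • w).snd.toAE x) =
        c * ∫ x in Ω, φ x * inner ℝ e
          (w.snd.toAE x) := by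
      rw [← integral_const_mul]
      refine integral_congr_ae ?_
      filter_upwards [AEEqFun.coeFn_smul c
        w.snd.toAE] with x hx
      rw [WithLp.smul_snd, VarLp.toAE_smul, hx, Pi.smul_apply, inner_smul_right]
      ring
    rw [e1, e2, hw φ hφ e, mul_neg]

variable {Ω : Set (EuclideanSpace ℝ (Fin n))} {p : VarExponent (volume.restrict Ω)}

variable (p) in
/-- The space `W^{1,p(·)}(Ω)` as a type, with norm `‖u‖_{p(·)} + ‖∇u‖_{p(·)}`. -/
def VarSobolev : Type := varSobolevSubmodule p

noncomputable instance VarSobolev.instNormedAddCommGroup : NormedAddCommGroup (VarSobolev p) :=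
  inferInstanceAs (NormedAddCommGroup (varSobolevSubmodule p))

noncomputable instance VarSobolev.instNormedSpace : NormedSpace ℝ (VarSobolev p) :=
  inferInstanceAs (NormedSpace ℝ (varSobolevSubmodule p))

/-- The pair `(u, ∇u)` of an element `u` of `W^{1,p(·)}(Ω)`. -/
def VarSobolev.toPair (w : VarSobolev p) :
    WithLp 1 (VarLp p ℝ × VarLp p (EuclideanSpace ℝ (Fin n))) :=
  Subtype.val w

theorem VarSobolev.norm_eq (w : VarSobolev p) : ‖w‖ = ‖w.toPair.fst‖ + ‖w.toPair.snd‖ :=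
  WithLp.prod_norm_eq_of_L1 w.toPair

/-- The underlying function of an element of `W^{1,p(·)}(Ω)`. -/
noncomputable def VarSobolev.val (w : VarSobolev p) : EuclideanSpace ℝ (Fin n) → ℝ :=
  w.toPair.fst.toAE

/-- The weak gradient of an element of `W^{1,p(·)}(Ω)`. -/
noncomputable def VarSobolev.grad (w : VarSobolev p) :
    EuclideanSpace ℝ (Fin n) → EuclideanSpace ℝ (Fin n) :=
  w.toPair.snd.toAE

theorem VarSobolev.val_zero : VarSobolev.val (0 : VarSobolev p) =ᵐ[volume.restrict Ω] 0 :=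
  AEEqFun.coeFn_zero

theorem VarSobolev.val_add (v w : VarSobolev p) :
    VarSobolev.val (v + w) =ᵐ[volume.restrict Ω] VarSobolev.val v + VarSobolev.val w :=
  AEEqFun.coeFn_add _ _

theorem VarSobolev.val_smul (c : ℝ) (w : VarSobolev p) :
    VarSobolev.val (c • w) =ᵐ[volume.restrict Ω] c • VarSobolev.val w :=
  AEEqFun.coeFn_smul _ _

variable (p) in
/-- The subspace `C_c^∞(Ω)` of `W^{1,p(·)}(Ω)`. -/
noncomputable def VarSobolev.testFunctions : Submodule ℝ (VarSobolev p) where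
  carrier := {w | ∃ φ, IsTestFunction Ω φ ∧ VarSobolev.val w =ᵐ[volume.restrict Ω] φ}
  zero_mem' := ⟨0, ⟨contDiff_const, HasCompactSupport.zero, by
    rw [tsupport_eq_empty_iff.2 rfl]; exact empty_subset _⟩, VarSobolev.val_zero⟩
  add_mem' := by
    rintro v w ⟨φ, hφ, hvφ⟩ ⟨ψ, hψ, hwψ⟩
    exact ⟨φ + ψ, ⟨hφ.1.add hψ.1, hφ.2.1.add hψ.2.1,
      (tsupport_add φ ψ).trans (union_subset hφ.2.2 hψ.2.2)⟩,
      (VarSobolev.val_add v w).trans (hvφ.add hwψ)⟩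
  smul_mem' := by
    rintro c w ⟨φ, hφ, hwφ⟩
    refine ⟨c • φ, ⟨hφ.1.const_smul c, hφ.2.1.smul_left, ?_⟩,
      (VarSobolev.val_smul c w).trans (hwφ.const_smul c)⟩
    exact (tsupport_smul_subset_right (fun _ => c) φ).trans hφ.2.2

variable (p) in
/-- `W_0^{1,p(·)}(Ω)`: the closure of `C_c^∞(Ω)` in `W^{1,p(·)}(Ω)`. -/
noncomputable def VarSobolev.W0 : Submodule ℝ (VarSobolev p) :=
  (VarSobolev.testFunctions p).topologicalClosure

variable (p) in
/-- The elements of `W^{1,p(·)}(Ω)` that are constant on each of the sets `Ω₀ i`. -/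
noncomputable def VarSobolev.constOn {m : ℕ} (Ω₀ : Fin m → Set (EuclideanSpace ℝ (Fin n))) :
    Submodule ℝ (VarSobolev p) where
  carrier := {w | ∀ i, ∃ c : ℝ, ∀ᵐ x ∂(volume.restrict Ω), x ∈ Ω₀ i → VarSobolev.val w x = c}
  zero_mem' := fun i => ⟨0, by
    filter_upwards [VarSobolev.val_zero (p := p)] with x hx _
    rw [hx]; rfl⟩
  add_mem' := by
    intro v w hv hw i
    obtain ⟨a, ha⟩ := hv i
    obtain ⟨b, hb⟩ := hw i
    refine ⟨a + b, ?_⟩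
    filter_upwards [ha, hb, VarSobolev.val_add v w] with x h1 h2 h3 hx
    rw [h3, Pi.add_apply, h1 hx, h2 hx]
  smul_mem' := by
    intro c w hw i
    obtain ⟨a, ha⟩ := hw i
    refine ⟨c * a, ?_⟩
    filter_upwards [ha, VarSobolev.val_smul c w] with x h1 h2 hx
    rw [h2, Pi.smul_apply, h1 hx, smul_eq_mul]

/-- The elements of `L²(Ω)` that are constant on each of the sets `Ω₀ i`. -/
noncomputable def L2ConstOn (Ω : Set (EuclideanSpace ℝ (Fin n))) {m : ℕ}
    (Ω₀ : Fin m → Set (EuclideanSpace ℝ (Fin n))) :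
    Submodule ℝ (Lp ℝ 2 (volume.restrict Ω)) where
  carrier := {f | ∀ i, ∃ c : ℝ, ∀ᵐ x ∂(volume.restrict Ω), x ∈ Ω₀ i → f x = c}
  zero_mem' := fun i => ⟨0, by
    filter_upwards [Lp.coeFn_zero ℝ 2 (volume.restrict Ω)] with x hx _
    rw [hx]; rfl⟩
  add_mem' := by
    intro v w hv hw i
    obtain ⟨a, ha⟩ := hv i
    obtain ⟨b, hb⟩ := hw i
    refine ⟨a + b, ?_⟩
    filter_upwards [ha, hb, Lp.coeFn_add v w] with x h1 h2 h3 hx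
    rw [h3, Pi.add_apply, h1 hx, h2 hx]
  smul_mem' := by
    intro c w hw i
    obtain ⟨a, ha⟩ := hw i
    refine ⟨c * a, ?_⟩
    filter_upwards [ha, Lp.coeFn_smul c w] with x h1 h2 hx
    rw [h2, Pi.smul_apply, h1 hx, smul_eq_mul]

/-- The inclusion `W^{1,p(·)}(Ω) → L²(Ω)`. -/
noncomputable def VarSobolev.toL2 [IsFiniteMeasure (volume.restrict Ω)]
    (h2 : ∀ᵐ x ∂(volume.restrict Ω), 2 ≤ p.toFun x) :
    VarSobolev p →ₗ[ℝ] Lp ℝ 2 (volume.restrict Ω) where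
  toFun w := VarLp.toL2 h2 w.toPair.fst
  map_add' v w := (VarLp.toL2 h2).map_add v.toPair.fst w.toPair.fst
  map_smul' c w := (VarLp.toL2 h2).map_smul c w.toPair.fst

theorem VarSobolev.coeFn_toL2 [IsFiniteMeasure (volume.restrict Ω)]
    (h2 : ∀ᵐ x ∂(volume.restrict Ω), 2 ≤ p.toFun x) (w : VarSobolev p) :
    VarSobolev.toL2 h2 w =ᵐ[volume.restrict Ω] VarSobolev.val w :=
  MemLp.coeFn_toLp (VarLp.memLp_two h2 _)

end VariableSobolev

/-! ## Operators from a Banach space to its dual, and realizations in a Hilbert space -/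

section Operators

variable {V : Type*} [NormedAddCommGroup V] [NormedSpace ℝ V]

/-- `⟨A u - A v, u - v⟩ ≥ 0` for all `u, v`. -/
def IsMonotoneOperator (A : V → StrongDual ℝ V) : Prop :=
  ∀ u v, 0 ≤ (A u - A v) (u - v)

/-- `t ↦ ⟨A (u + t v), w⟩` is continuous on `ℝ` for all `u, v, w`. -/
def IsHemicontinuousOperator (A : V → StrongDual ℝ V) : Prop :=
  ∀ u v w, Continuous fun t : ℝ => A (u + t • v) w

/-- `⟨A u, u⟩ / ‖u‖ → ∞` as `‖u‖ → ∞`. -/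
def IsCoerciveOperator (A : V → StrongDual ℝ V) : Prop :=
  Tendsto (fun u => A u u / ‖u‖) (comap norm atTop) atTop

variable {H : Type*} [NormedAddCommGroup H] [InnerProductSpace ℝ H]

/-- The graph of the `H`-realization of `A : V → V'`, for an inclusion `ι : V → H`: its domain
is `{u ∈ V : A u ∈ H}`, where `A u ∈ H` means that `⟨A u, v⟩ = (f, v)_H` on `V` for an
`f ∈ H`, and its value at `u` is this `f`. -/
def realizationGraph (ι : V →ₗ[ℝ] H) (A : V → StrongDual ℝ V) : Set (H × H) :=
  {z | ∃ u, ι u = z.1 ∧ ∀ v, A u v = inner ℝ z.2 (ι v)}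

/-- The graph of a single-valued operator. -/
def IsOperatorGraph (G : Set (H × H)) : Prop :=
  ∀ h f f', (h, f) ∈ G → (h, f') ∈ G → f = f'

/-- Monotone graph in a Hilbert space. -/
def IsMonotoneGraph (G : Set (H × H)) : Prop :=
  ∀ z ∈ G, ∀ w ∈ G, 0 ≤ inner ℝ (z.2 - w.2) (z.1 - w.1)

/-- Maximal monotone graph: monotone, and not properly contained in a monotone graph. -/
def IsMaximalMonotoneGraph (G : Set (H × H)) : Prop :=
  IsMonotoneGraph G ∧ ∀ G', IsMonotoneGraph G' → G ⊆ G' → G' = G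

/-- `u ∈ C([0,T];H)` is a strong solution of `u' + A u = B u`, `u(0) = u₀`, where `G` is the
graph of `A`. -/
def IsStrongSolution (G : Set (H × H)) (B : H → H) (u₀ : H) (T : ℝ) (u : ℝ → H) : Prop :=
  ContinuousOn u (Icc 0 T) ∧ u 0 = u₀ ∧
  (∀ a b, 0 < a → a ≤ b → b < T → AbsolutelyContinuousOnInterval u a b) ∧
  ∀ᵐ t ∂(volume.restrict (Ioo 0 T)), ∃ f du : H,
    (u t, f) ∈ G ∧ HasDerivAt u du t ∧ du + f = B (u t)

/-- `u ∈ C([0,T];H)` is a weak solution of `u' + A u = B u`, `u(0) = u₀`: a limit in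
`C([0,T];H)` of strong solutions of the equation. -/
def IsWeakSolution (G : Set (H × H)) (B : H → H) (u₀ : H) (T : ℝ) (u : ℝ → H) : Prop :=
  ContinuousOn u (Icc 0 T) ∧ u 0 = u₀ ∧
  ∃ (y : ℕ → H) (w : ℕ → ℝ → H), (∀ k, IsStrongSolution G B (y k) T (w k)) ∧
    TendstoUniformlyOn w u atTop (Icc 0 T)

/-- Global well-posedness of `u' + A u = B u`, `u(0) = u₀`, for all globally Lipschitz `B`. -/
def IsWellPosed (G : Set (H × H)) : Prop :=
  ∀ (B : H → H) (L : ℝ≥0), LipschitzWith L B →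
    (∀ u₀, ∃ u : ℝ → H, ∀ T, 0 < T → IsWeakSolution G B u₀ T u) ∧
    (∀ u₀ f, (u₀, f) ∈ G → ∃ u : ℝ → H, ∀ T, 0 < T →
      IsStrongSolution G B u₀ T u ∧ ∃ K : ℝ≥0, LipschitzOnWith K u (Icc 0 T)) ∧
    (∀ T, 0 < T → ∀ u₀ v₀ u v, IsWeakSolution G B u₀ T u → IsWeakSolution G B v₀ T v →
      ∀ t ∈ Icc 0 T, ‖u t - v t‖ ≤ Real.exp (L * t) * ‖u₀ - v₀‖)

end Operators

/-! ## The diffusion problem -/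

/-- An open set `D` has smooth boundary: near each boundary point there is a smooth
diffeomorphism that maps `D` to a half space. -/
def HasSmoothBoundary {n : ℕ} (D : Set (EuclideanSpace ℝ (Fin n))) : Prop :=
  ∀ x ∈ frontier D, ∃ Φ : OpenPartialHomeomorph (EuclideanSpace ℝ (Fin n))
      (EuclideanSpace ℝ (Fin n)), x ∈ Φ.source ∧
    ContDiffOn ℝ ∞ Φ Φ.source ∧ ContDiffOn ℝ ∞ Φ.symm Φ.target ∧
    ∃ i : Fin n, ∀ y ∈ Φ.source, (y ∈ D ↔ 0 < Φ y i)

/-- The data of the problem: the domain `Ω`, the subsets `Ω₀ i` where the diffusion blows up, the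
diffusion coefficients `d l` for `l ∈ (0,1]` and their limit `d 0` outside the closure of
`⋃ i, Ω₀ i`, the exponent `p` and the constant `η`. -/
structure LargeDiffusionData (n : ℕ) where
  Ω : Set (EuclideanSpace ℝ (Fin n))
  isOpen_Ω : IsOpen Ω
  bounded_Ω : Bornology.IsBounded Ω
  connected_Ω : IsConnected Ω
  smooth_Ω : HasSmoothBoundary Ω
  m : ℕ
  m_pos : 0 < m
  Ω₀ : Fin m → Set (EuclideanSpace ℝ (Fin n))
  isOpen_Ω₀ : ∀ i, IsOpen (Ω₀ i)
  smooth_Ω₀ : ∀ i, HasSmoothBoundary (Ω₀ i)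
  closure_Ω₀_subset : ∀ i, closure (Ω₀ i) ⊆ Ω
  disjoint_Ω₀ : ∀ i j, i ≠ j → Disjoint (closure (Ω₀ i)) (closure (Ω₀ j))
  d : ℝ → EuclideanSpace ℝ (Fin n) → ℝ
  smooth_d : ∀ l ∈ Ioc (0 : ℝ) 1, ContDiffOn ℝ ∞ (d l) Ω
  smooth_d_zero : ContDiffOn ℝ ∞ (d 0) (Ω \ closure (⋃ i, Ω₀ i))
  m₀ : ℝ
  m₀_pos : 0 < m₀
  M : ℝ → ℝ
  d_bounds : ∀ l ∈ Ioc (0 : ℝ) 1, ∀ x ∈ Ω, m₀ ≤ d l x ∧ d l x ≤ M l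
  d_zero_bounds : ∀ x ∈ Ω \ closure (⋃ i, Ω₀ i), m₀ ≤ d 0 x ∧ d 0 x ≤ M 0
  d_tendsto : TendstoUniformlyOn d (d 0) (𝓝[>] 0) (Ω \ closure (⋃ i, Ω₀ i))
  d_tendsto_top : ∀ K, IsCompact K → K ⊆ ⋃ i, Ω₀ i →
    ∀ R : ℝ, ∀ᶠ l in 𝓝[>] (0 : ℝ), ∀ x ∈ K, R ≤ d l x
  p : EuclideanSpace ℝ (Fin n) → ℝ
  continuousOn_p : ContinuousOn p Ω
  pMin : ℝ
  pMax : ℝ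
  two_lt_pMin : 2 < pMin
  p_bounds : ∀ x ∈ Ω, pMin ≤ p x ∧ p x ≤ pMax
  η : ℝ
  η_pos : 0 < η

namespace LargeDiffusionData

variable {n : ℕ} (S : LargeDiffusionData n)

/-- The part `Ω₁` of the domain where the diffusion stays bounded. -/
def Ω₁ : Set (EuclideanSpace ℝ (Fin n)) := S.Ω \ closure (⋃ i, S.Ω₀ i)

instance : IsFiniteMeasure (volume.restrict S.Ω) :=
  ⟨by rw [Measure.restrict_apply_univ]; exact S.bounded_Ω.measure_lt_top⟩

/-- The exponent `p(·)` on `Ω`. -/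
def exponent : VarExponent (volume.restrict S.Ω) where
  toFun := S.p
  aemeasurable := S.continuousOn_p.aemeasurable S.isOpen_Ω.measurableSet
  one_le := by
    filter_upwards [ae_restrict_mem S.isOpen_Ω.measurableSet] with x hx
    linarith [S.p_bounds x hx, S.two_lt_pMin]
  bounded := ⟨S.pMax, by
    filter_upwards [ae_restrict_mem S.isOpen_Ω.measurableSet] with x hx
    exact (S.p_bounds x hx).2⟩

theorem two_le_exponent : ∀ᵐ x ∂(volume.restrict S.Ω), 2 ≤ S.exponent.toFun x := by
  filter_upwards [ae_restrict_mem S.isOpen_Ω.measurableSet] with x hx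
  exact S.two_lt_pMin.le.trans (S.p_bounds x hx).1

/-- `V = W_0^{1,p(·)}(Ω)`. -/
noncomputable def V : Submodule ℝ (VarSobolev S.exponent) := VarSobolev.W0 S.exponent

/-- `V₀ = {u ∈ W_0^{1,p(·)}(Ω) : u is constant on each Ω₀ i}`, with the norm of `V`. -/
noncomputable def V₀ : Submodule ℝ (VarSobolev S.exponent) :=
  VarSobolev.W0 S.exponent ⊓ VarSobolev.constOn S.exponent S.Ω₀

/-- `H = L²(Ω)`. -/
abbrev H : Type := Lp ℝ 2 (volume.restrict S.Ω)

/-- `H₀ = {u ∈ L²(Ω) : u is constant on each Ω₀ i}`. -/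
noncomputable def H₀ : Submodule ℝ S.H := L2ConstOn S.Ω S.Ω₀

/-- The inclusion of `V` into `H`. -/
noncomputable def incl : S.V →ₗ[ℝ] S.H :=
  (VarSobolev.toL2 S.two_le_exponent).comp S.V.subtype

/-- The inclusion of `V₀` into `H₀`. -/
noncomputable def incl₀ : S.V₀ →ₗ[ℝ] S.H₀ :=
  LinearMap.codRestrict S.H₀ ((VarSobolev.toL2 S.two_le_exponent).comp S.V₀.subtype) (by
    intro u i
    obtain ⟨c, hc⟩ := u.2.2 i
    refine ⟨c, ?_⟩
    filter_upwards [hc, VarSobolev.coeFn_toL2 S.two_le_exponent (u : VarSobolev S.exponent)]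
      with x h1 h2 hx
    rw [LinearMap.comp_apply, Submodule.subtype_apply, h2, h1 hx])

/-- The operator `A : W → W'` on a subspace `W` of `W^{1,p(·)}(Ω)` is given by
`⟨A u, v⟩ = ∫_D a (|∇u|^{p(x)-2} + η) ∇u·∇v dx + ∫_Ω |u|^{p(x)-2} u v dx` for all `u, v ∈ W`,
with absolutely convergent integrals. -/
def IsDiffusionOperator (D : Set (EuclideanSpace ℝ (Fin n))) (a : EuclideanSpace ℝ (Fin n) → ℝ)
    (W : Submodule ℝ (VarSobolev S.exponent)) (A : W → StrongDual ℝ W) : Prop :=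
  ∀ u v : W,
    IntegrableOn (fun x => a x * (‖VarSobolev.grad u.1 x‖ ^ (S.p x - 2) + S.η) *
      inner ℝ (VarSobolev.grad u.1 x) (VarSobolev.grad v.1 x)) D ∧
    IntegrableOn (fun x => |VarSobolev.val u.1 x| ^ (S.p x - 2) * VarSobolev.val u.1 x * VarSobolev.val v.1 x) S.Ω ∧
    A u v = (∫ x in D, a x * (‖VarSobolev.grad u.1 x‖ ^ (S.p x - 2) + S.η) *
        inner ℝ (VarSobolev.grad u.1 x) (VarSobolev.grad v.1 x)) +
      ∫ x in S.Ω, |VarSobolev.val u.1 x| ^ (S.p x - 2) * VarSobolev.val u.1 x * VarSobolev.val v.1 x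

end LargeDiffusionData

/-! ## Absolutely continuous functions and differential inequalities -/

section DifferentialInequalities

/-! Every operator in the family is the subgradient of one nonnegative functional, `Φ u = ∫ a
(|∇u|^p / p + η |∇u|² / 2) + ∫ |u|^p / p`, with weight `a = d_λ` on `Ω`, or `a = d_0` on `Ω₁`
extended by zero when `λ = 0`. The extension costs no coercivity: an element of `V₀` has zero
gradient a.e. on each `Ω₀ i`, and the boundaries of these sets are null, so `a ≥ m₀` wherever the
gradient is nonzero.

Because `p ≥ 2`, Clarkson's inequality holds pointwise in `x` and integrates to uniform convexity of
`Φ` (`isUniformlyConvexFunctional_weightedEnergy`). This replaces reflexivity and weak compactness: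
minimizing sequences of `μ Φ + ½ ‖ι u - f‖²` are Cauchy in the Banach space `V`, and the minimizer
solves `ι u + μ A u = f`. The realization thus has all resolvents (`hasResolvents_realizationGraph`)
and, being monotone, is maximal monotone. The same resolvents, with `μ → 0` and the bound `‖ι v -
x‖² ≤ μ Φ v`, show that the domain is dense.

Well-posedness is then a Hilbert space fact (`HasResolvents.isWellPosed`). The graph is replaced by
its Lipschitz Yosida approximations and the resulting ordinary differential equations are solved
globally, with the Lipschitz term `B` carried along. Monotonicity bounds the velocities uniformly
and makes the approximate solutions Cauchy. The limit equation is identified by demiclosedness of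
the graph (`exists_weak_limit`, `exists_lipschitz_solution`). Weak solutions come from density of
the domain and the estimate `‖u - v‖ ≤ e^{Lt} ‖u₀ - v₀‖`.

What remains is specific to the spaces: modular against norm in `L^{p(·)}`, completeness, closedness
of the constancy constraints, and density of `V` in `H` and of `V₀` in `H₀`. -/

theorem AbsolutelyContinuousOnInterval.of_dist_le {X Y : Type*} [PseudoMetricSpace X]
    [PseudoMetricSpace Y] {f : ℝ → X} {g : ℝ → Y} {a b : ℝ}
    (hf : AbsolutelyContinuousOnInterval f a b) (h : ∀ s t, dist (g s) (g t) ≤ dist (f s) (f t)) :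
    AbsolutelyContinuousOnInterval g a b := by
  rw [absolutelyContinuousOnInterval_iff] at hf ⊢
  intro ε hε
  obtain ⟨δ, hδ, H⟩ := hf ε hε
  exact ⟨δ, hδ, fun E hE hE' => (Finset.sum_le_sum fun i _ => h _ _).trans_lt (H E hE hE')⟩

/-- The increment is the integral of the derivative. Absolute continuity is what lets an almost
everywhere sign condition suffice. -/
theorem AbsolutelyContinuousOnInterval.le_of_ae_hasDerivAt_nonpos {f : ℝ → ℝ} {a b : ℝ}
    (hab : a ≤ b) (hf : AbsolutelyContinuousOnInterval f a b)
    (h : ∀ᵐ t, t ∈ Ioo a b → ∃ d ≤ 0, HasDerivAt f d t) : f b ≤ f a := by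
  have h0 : 0 ≤ ∫ t in a..b, -deriv f t := by
    refine intervalIntegral.integral_nonneg_of_ae_restrict hab ?_
    have : ∀ᵐ t ∂(volume.restrict (Icc a b)), t ∈ Ioo a b := by
      rw [← Measure.restrict_congr_set Ioo_ae_eq_Icc]
      exact ae_restrict_mem measurableSet_Ioo
    filter_upwards [this, ae_restrict_of_ae h] with t ht ht'
    obtain ⟨d, hd, hfd⟩ := ht' ht
    rw [hfd.deriv]
    simpa using hd
  rw [intervalIntegral.integral_neg, hf.integral_deriv_eq_sub] at h0
  linarith

variable {H : Type*} [NormedAddCommGroup H] [InnerProductSpace ℝ H]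

/-- Gronwall: the derivative of `e^{-2Lt} ‖w‖²` is at most `2ε e^{-2Lt} ≤ 2ε`, so subtracting `2εt`
leaves a nonincreasing function. The slack `ε` will hold the mismatch between two Yosida parameters.
-/
theorem norm_sq_le_of_inner_deriv_le {w w' : ℝ → H} {L ε T : ℝ} (hL : 0 ≤ L) (hε : 0 ≤ ε)
    (hw : ∀ t ∈ Icc 0 T, HasDerivAt w (w' t) t)
    (h : ∀ t ∈ Icc 0 T, inner ℝ (w' t) (w t) ≤ L * ‖w t‖ ^ 2 + ε) {t : ℝ} (ht : t ∈ Icc 0 T) :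
    ‖w t‖ ^ 2 ≤ Real.exp (2 * L * t) * (‖w 0‖ ^ 2 + 2 * ε * t) := by
  set f : ℝ → ℝ := fun t => Real.exp (-(2 * L * t)) * ‖w t‖ ^ 2 - 2 * ε * t with hf
  have hd : ∀ t ∈ Icc 0 T, HasDerivAt f (Real.exp (-(2 * L * t)) * (-(2 * L)) * ‖w t‖ ^ 2 +
      Real.exp (-(2 * L * t)) * (2 * inner ℝ (w t) (w' t)) - 2 * ε) t := by
    intro t ht
    have h1 : HasDerivAt (fun t : ℝ => -(2 * L * t)) (-(2 * L)) t := by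
      simpa using ((hasDerivAt_id t).const_mul (2 * L)).fun_neg
    have h2 : HasDerivAt (fun t : ℝ => 2 * ε * t) (2 * ε) t := by
      simpa using (hasDerivAt_id t).const_mul (2 * ε)
    exact (h1.exp.mul (hw t ht).norm_sq).sub h2
  have hanti : AntitoneOn f (Icc 0 T) := by
    refine antitoneOn_of_hasDerivWithinAt_nonpos (convex_Icc 0 T)
      (fun t ht => (hd t ht).continuousAt.continuousWithinAt)
      (fun t ht => (hd t (interior_subset ht)).hasDerivWithinAt) fun t ht => ?_
    have ht' := interior_subset ht
    have h1 := h t ht'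
    rw [real_inner_comm] at h1
    have h2 : Real.exp (-(2 * L * t)) ≤ 1 := by
      rw [Real.exp_le_one_iff, neg_nonpos]
      exact mul_nonneg (by positivity) ht'.1
    have h3 := mul_le_mul_of_nonneg_left h1 (Real.exp_pos (-(2 * L * t))).le
    have h4 := mul_le_mul_of_nonneg_right h2 hε
    linarith
  have hT : (0 : ℝ) ∈ Icc 0 T := ⟨le_rfl, ht.1.trans ht.2⟩
  have h1 := hanti hT ht ht.1
  simp only [hf, mul_zero, Real.exp_neg, Real.exp_zero, inv_one, one_mul, sub_zero] at h1
  have h2 : (Real.exp (2 * L * t))⁻¹ * ‖w t‖ ^ 2 ≤ ‖w 0‖ ^ 2 + 2 * ε * t := by linarith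
  rwa [inv_mul_le_iff₀ (Real.exp_pos _)] at h2

end DifferentialInequalities

/-! ## Ordinary differential equations with a globally Lipschitz right hand side -/

section GlobalODE

variable {H : Type*} [NormedAddCommGroup H] [NormedSpace ℝ H]

theorem mul_exp_neg_le_inv {c t : ℝ} (hc : 0 < c) : t * Real.exp (-(c * t)) ≤ c⁻¹ := by
  have h := Real.add_one_le_exp (c * t)
  rw [Real.exp_neg, ← div_eq_mul_inv, div_le_iff₀ (Real.exp_pos _), inv_mul_eq_div, le_div_iff₀ hc]
  linarith

open scoped BoundedContinuousFunction in
/-- The global Picard–Lindelöf theorem, by contraction in a weighted norm. -/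
theorem LipschitzWith.exists_forall_hasDerivAt [CompleteSpace H] {F : H → H} {K : ℝ≥0}
    (hF : LipschitzWith K F) (x : H) :
    ∃ u : ℝ → H, u 0 = x ∧ ∀ t, 0 ≤ t → HasDerivAt u (F (u t)) t := by
  -- The weight `e^{-ct}` gives the contraction constant `K / c ≤ 1 / 2`.
  set c : ℝ := 2 * (K + 1) with hc
  have hc0 : 0 < c := by positivity
  have hcont : ∀ v : ℝ →ᵇ H, Continuous fun s => F (x + Real.exp (c * s) • v s) := fun v =>
    hF.continuous.comp (by fun_prop)
  -- The unknown is `v t = e^{-ct} (u t - x)`, which stays bounded. Freezing the time at `max t 0`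
  -- makes `I v` a bounded continuous function on all of `ℝ`.
  set I : (ℝ →ᵇ H) → ℝ → H := fun v t =>
    Real.exp (-(c * max t 0)) • ∫ s in (0 : ℝ)..max t 0, F (x + Real.exp (c * s) • v s) with hI
  have hIc : ∀ v, Continuous (I v) := by
    intro v
    have h1 : Continuous fun t => ∫ s in (0 : ℝ)..t, F (x + Real.exp (c * s) • v s) :=
      intervalIntegral.continuous_primitive (fun a b => (hcont v).intervalIntegrable a b) 0
    have h2 : Continuous fun t : ℝ => max t 0 := continuous_id.max continuous_const
    exact (Real.continuous_exp.comp (by fun_prop)).smul (h1.comp h2)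
  have hdiff : ∀ v w : ℝ →ᵇ H, ∀ t, ‖I v t - I w t‖ ≤ 1 / 2 * dist v w := by
    intro v w t
    set r := max t 0 with hr
    have hr0 : 0 ≤ r := le_max_right _ _
    have h1 : I v t - I w t = Real.exp (-(c * r)) • ∫ s in (0 : ℝ)..r,
        (F (x + Real.exp (c * s) • v s) - F (x + Real.exp (c * s) • w s)) := by
      rw [intervalIntegral.integral_sub ((hcont v).intervalIntegrable _ _)
        ((hcont w).intervalIntegrable _ _), smul_sub]
    have h2 : ‖∫ s in (0 : ℝ)..r,
        (F (x + Real.exp (c * s) • v s) - F (x + Real.exp (c * s) • w s))‖ ≤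
        ∫ s in (0 : ℝ)..r, K * dist v w * Real.exp (c * s) := by
      refine intervalIntegral.norm_integral_le_of_norm_le hr0 ?_
        (Continuous.intervalIntegrable (by fun_prop) _ _)
      refine Eventually.of_forall fun s _ => ?_
      rw [← dist_eq_norm]
      refine (hF.dist_le_mul _ _).trans ?_
      rw [dist_add_left, dist_eq_norm, ← smul_sub, norm_smul, Real.norm_of_nonneg (Real.exp_pos _).le,
        ← dist_eq_norm]
      have := v.dist_coe_le_dist (g := w) s
      calc (K : ℝ) * (Real.exp (c * s) * dist (v s) (w s))
          ≤ K * (Real.exp (c * s) * dist v w) := by gcongr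
        _ = _ := by ring
    have h3 : ∫ s in (0 : ℝ)..r, K * dist v w * Real.exp (c * s) =
        K * dist v w * (c⁻¹ * (Real.exp (c * r) - 1)) := by
      rw [intervalIntegral.integral_const_mul, intervalIntegral.integral_comp_mul_left _ hc0.ne',
        integral_exp]
      simp
    rw [h1, norm_smul, Real.norm_of_nonneg (Real.exp_pos _).le]
    calc Real.exp (-(c * r)) * _ ≤ Real.exp (-(c * r)) *
          (K * dist v w * (c⁻¹ * (Real.exp (c * r) - 1))) := by
          gcongr; exact h2.trans h3.le
      _ ≤ Real.exp (-(c * r)) * (K * dist v w * (c⁻¹ * Real.exp (c * r))) := by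
          gcongr; linarith
      _ = K * c⁻¹ * dist v w := by
          rw [Real.exp_neg]
          field_simp
      _ ≤ 1 / 2 * dist v w := by
          gcongr
          rw [← div_eq_mul_inv, div_le_iff₀ hc0, hc]
          linarith
  have hI0 : ∀ t, ‖I 0 t‖ ≤ c⁻¹ * ‖F x‖ := by
    intro t
    have h : I 0 t = (max t 0 * Real.exp (-(c * max t 0))) • F x := by
      simp [hI, smul_smul, mul_comm]
    rw [h, norm_smul, Real.norm_of_nonneg (mul_nonneg (le_max_right _ _) (Real.exp_pos _).le)]
    gcongr
    exact mul_exp_neg_le_inv hc0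
  let Φ : (ℝ →ᵇ H) → (ℝ →ᵇ H) := fun v =>
    BoundedContinuousFunction.ofNormedAddCommGroup (I v) (hIc v)
      (1 / 2 * dist v 0 + c⁻¹ * ‖F x‖) fun t => by
        calc ‖I v t‖ = ‖(I v t - I 0 t) + I 0 t‖ := by rw [sub_add_cancel]
          _ ≤ _ := (norm_add_le _ _).trans (add_le_add (hdiff v 0 t) (hI0 t))
  have hΦ : ContractingWith (1 / 2) Φ := by
    refine ⟨by norm_num, LipschitzWith.of_dist_le_mul fun v w => ?_⟩
    refine (BoundedContinuousFunction.dist_le (by positivity)).2 fun t => ?_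
    rw [dist_eq_norm]
    exact (hdiff v w t).trans (by simp)
  set v := hΦ.fixedPoint Φ with hv
  have hfix : ∀ t, I v t = v t := fun t =>
    congrArg (fun f : ℝ →ᵇ H => f t) hΦ.fixedPoint_isFixedPt.eq
  -- Here the time is not frozen, so `u` has a two-sided derivative at `t = 0` as well.
  set u : ℝ → H := fun t => x + ∫ s in (0 : ℝ)..t, F (x + Real.exp (c * s) • v s) with hu
  have hut : ∀ t, 0 ≤ t → u t = x + Real.exp (c * t) • v t := by
    intro t ht
    rw [← hfix t]
    simp only [hI, hu, max_eq_left ht, smul_smul, ← Real.exp_add, add_neg_cancel, Real.exp_zero,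
      one_smul]
  refine ⟨u, by simp [hu], fun t ht => ?_⟩
  rw [hut t ht]
  exact ((hcont v).integral_hasStrictDerivAt 0 t).hasDerivAt.const_add x

end GlobalODE

/-! ## Maximal monotone graphs and their Yosida approximations -/

section MaximalMonotone

variable {H : Type*} [NormedAddCommGroup H] [InnerProductSpace ℝ H] {G : Set (H × H)}

/-- The range condition of Minty: `I + μ A` is surjective for all `μ > 0`. -/
def HasResolvents (G : Set (H × H)) : Prop :=
  ∀ μ : ℝ, 0 < μ → ∀ h : H, ∃ z ∈ G, z.1 + μ • z.2 = h

/-- Choose `w ∈ G` with `w.1 + w.2 = z.1 + z.2`. Then `z.2 - w.2 = -(z.1 - w.1)`, so the hypothesis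
at `w` reads `-‖z.1 - w.1‖² ≥ 0` and `z = w`. -/
theorem HasResolvents.mem_of_forall_inner_nonneg (hG : HasResolvents G) {z : H × H}
    (hz : ∀ w ∈ G, 0 ≤ inner ℝ (z.2 - w.2) (z.1 - w.1)) : z ∈ G := by
  obtain ⟨w, hw, h⟩ := hG 1 one_pos (z.1 + z.2)
  rw [one_smul] at h
  have h1 : z.2 - w.2 = -(z.1 - w.1) := by
    rw [sub_eq_iff_eq_add, neg_sub, sub_add_eq_add_sub, h, add_sub_cancel_left]
  have h2 := hz w hw
  rw [h1, inner_neg_left, real_inner_self_eq_norm_sq] at h2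
  have h3 : z.1 - w.1 = 0 := by
    rw [← norm_eq_zero]
    nlinarith [norm_nonneg (z.1 - w.1)]
  rw [h3, neg_zero] at h1
  rw [show z = w from Prod.ext (sub_eq_zero.1 h3) (sub_eq_zero.1 h1)]
  exact hw

theorem HasResolvents.isMaximalMonotoneGraph (hG : HasResolvents G) (hm : IsMonotoneGraph G) :
    IsMaximalMonotoneGraph G :=
  ⟨hm, fun _ hG' hsub => Subset.antisymm
    (fun _ hz => hG.mem_of_forall_inner_nonneg fun w hw => hG' _ hz w (hsub hw)) hsub⟩

/-- `R` is the Yosida approximation of `G` with parameter `μ`. -/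
def IsYosida (G : Set (H × H)) (μ : ℝ) (R : H → H) : Prop :=
  ∀ x, (x - μ • R x, R x) ∈ G

theorem HasResolvents.exists_isYosida (hG : HasResolvents G) {μ : ℝ} (hμ : 0 < μ) :
    ∃ R, IsYosida G μ R := by
  choose z hz h using hG μ hμ
  refine ⟨fun x => (z x).2, fun x => ?_⟩
  have : x - μ • (z x).2 = (z x).1 := by rw [sub_eq_iff_eq_add]; exact (h x).symm
  rw [this]
  exact hz x

/-! ### Estimates for Yosida approximations. -/

variable {μ ν : ℝ} {R R' : H → H}

/-- Monotonicity of `G` between `x - μ R x` and `y - ν R' y`. Two independent parameters are allowed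
so that different approximations can be compared. -/
theorem IsYosida.inner_ge (hm : IsMonotoneGraph G) (hR : IsYosida G μ R) (hR' : IsYosida G ν R')
    (x y : H) : inner ℝ (R x - R' y) (μ • R x - ν • R' y) ≤ inner ℝ (R x - R' y) (x - y) := by
  have h := hm _ (hR x) _ (hR' y)
  have h1 : (x - μ • R x) - (y - ν • R' y) = (x - y) - (μ • R x - ν • R' y) := by abel
  simp only [h1, inner_sub_right] at h
  simp only [inner_sub_right]
  linarith

theorem IsYosida.mul_norm_sq_le_inner (hm : IsMonotoneGraph G) (hR : IsYosida G μ R)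
    (x y : H) : μ * ‖R x - R y‖ ^ 2 ≤ inner ℝ (R x - R y) (x - y) := by
  have h := hR.inner_ge hm hR x y
  rwa [← smul_sub, inner_smul_right, real_inner_self_eq_norm_sq] at h

theorem IsYosida.lipschitz (hm : IsMonotoneGraph G) (hμ : 0 < μ) (hR : IsYosida G μ R) :
    LipschitzWith (Real.toNNReal μ⁻¹) R := by
  refine LipschitzWith.of_dist_le_mul fun x y => ?_
  rw [Real.coe_toNNReal _ (inv_nonneg.2 hμ.le), dist_eq_norm, dist_eq_norm]
  have h := (hR.mul_norm_sq_le_inner hm x y).trans (real_inner_le_norm _ _)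
  rw [inv_mul_eq_div, le_div_iff₀' hμ]
  rcases (norm_nonneg (R x - R y)).eq_or_lt with h0 | h0
  · rw [← h0, mul_zero]
    positivity
  · refine le_of_mul_le_mul_left ?_ h0
    linarith

/-- Monotonicity between `(x, y)` and `(x - μ R x, R x)` gives `μ ⟨y - R x, R x⟩ ≥ 0`. The bound is
uniform in `μ`, unlike the Lipschitz constant `μ⁻¹`. -/
theorem IsYosida.norm_le (hm : IsMonotoneGraph G) (hμ : 0 < μ) (hR : IsYosida G μ R) {x y : H}
    (hxy : (x, y) ∈ G) : ‖R x‖ ≤ ‖y‖ := by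
  have h := hm _ hxy _ (hR x)
  simp only [sub_sub_cancel, inner_smul_right, inner_sub_left, real_inner_self_eq_norm_sq] at h
  have h1 : ‖R x‖ ^ 2 ≤ ‖y‖ * ‖R x‖ := by
    have h2 := nonneg_of_mul_nonneg_right h hμ
    have := real_inner_le_norm y (R x)
    linarith
  rcases (norm_nonneg (R x)).eq_or_lt with h0 | h0
  · rw [← h0]; positivity
  · exact le_of_mul_le_mul_right (by linarith) h0

/-- `IsYosida.inner_ge` at `y = x` rearranges to `ν ‖R' x - R x‖² ≤ (μ - ν) (⟨R x, R' x⟩ - ‖R x‖²)`.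
Hence `⟨R x, R' x⟩ ≥ ‖R x‖²` for `ν < μ`, and expanding the square gives the claim. For `ν = μ` the
right side vanishes and `R' x = R x`. -/
theorem IsYosida.norm_sub_sq_le (hm : IsMonotoneGraph G) (hν : 0 < ν) (hνμ : ν ≤ μ)
    (hR : IsYosida G μ R) (hR' : IsYosida G ν R') (x : H) :
    ‖R' x - R x‖ ^ 2 ≤ ‖R' x‖ ^ 2 - ‖R x‖ ^ 2 := by
  have h := hR.inner_ge hm hR' x x
  rw [sub_self, inner_zero_right] at h
  simp only [inner_sub_left, inner_sub_right, inner_smul_right, real_inner_self_eq_norm_sq] at h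
  have hcomm := real_inner_comm (R x) (R' x)
  rw [hcomm] at h
  rw [norm_sub_sq_real, hcomm]
  rcases hνμ.eq_or_lt with rfl | hlt
  · have h1 : ν * ‖R' x - R x‖ ^ 2 ≤ 0 := by
      rw [norm_sub_sq_real, hcomm]; linarith
    have h2 : ‖R' x - R x‖ = 0 := by
      have := nonpos_of_mul_nonpos_right h1 hν
      nlinarith [norm_nonneg (R' x - R x)]
    rw [norm_eq_zero, sub_eq_zero] at h2
    rw [h2, real_inner_self_eq_norm_sq]
    linarith
  · have h1 : 0 ≤ ν * ‖R' x - R x‖ ^ 2 := by positivity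
    rw [norm_sub_sq_real, hcomm] at h1
    have h2 : 0 ≤ (μ - ν) * (inner ℝ (R x) (R' x) - ‖R x‖ ^ 2) := by linarith
    have h3 := nonneg_of_mul_nonneg_right h2 (sub_pos.2 hlt)
    linarith

/-- Demiclosedness of a single valued maximal monotone graph. -/
theorem HasResolvents.exists_weak_limit [CompleteSpace H] (hG : HasResolvents G)
    (hm : IsMonotoneGraph G) (hs : IsOperatorGraph G) {x ξ : ℕ → H} {a : H} {C : ℝ}
    (hx : Tendsto x atTop (𝓝 a)) (hξ : ∀ᶠ k in atTop, (x k, ξ k) ∈ G) (hC : ∀ᶠ k in atTop, ‖ξ k‖ ≤ C) :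
    ∃ b, (a, b) ∈ G ∧ ∀ h, Tendsto (fun k => inner ℝ (ξ k) h) atTop (𝓝 (inner ℝ b h)) := by
  -- Banach–Alaoglu is applied along ultrafilters instead of subsequences, so `H` need not be
  -- separable.
  have key : ∀ U : Ultrafilter ℕ, (U : Filter ℕ) ≤ atTop →
      ∃ b, (a, b) ∈ G ∧ ∀ h, Tendsto (fun k => inner ℝ (ξ k) h) U (𝓝 (inner ℝ b h)) := by
    intro U hU
    let Ψ : ℕ → WeakDual ℝ H := fun k => StrongDual.toWeakDual (InnerProductSpace.toDual ℝ H (ξ k))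
    have hK := WeakDual.isCompact_closedBall (𝕜 := ℝ) (E := H) 0 C
    obtain ⟨ψ, -, hψ⟩ := hK.ultrafilter_le_nhds (U.map Ψ) (by
      rw [le_principal_iff]
      have : {k | ‖ξ k‖ ≤ C} ∈ (U : Filter ℕ) := hU hC
      refine Filter.mem_map.2 (mem_of_superset this fun k hk => ?_)
      simpa [Ψ] using hk)
    set b := (InnerProductSpace.toDual ℝ H).symm (WeakDual.toStrongDual ψ) with hb
    have hlim : ∀ h, Tendsto (fun k => inner ℝ (ξ k) h) U (𝓝 (inner ℝ b h)) := by
      intro h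
      have h1 : Tendsto Ψ U (𝓝 ψ) := hψ
      have h2 := ((WeakDual.eval_continuous h).tendsto ψ).comp h1
      rw [hb, InnerProductSpace.toDual_symm_apply]
      exact h2
    refine ⟨b, hG.mem_of_forall_inner_nonneg fun w hw => ?_, hlim⟩
    have h1 : Tendsto (fun k => inner ℝ (ξ k - w.2) (x k - w.1)) U
        (𝓝 (inner ℝ (b - w.2) (a - w.1))) := by
      have h2 : ∀ k, inner ℝ (ξ k - w.2) (x k - w.1) =
          inner ℝ (ξ k) (x k - a) + inner ℝ (ξ k) (a - w.1) - inner ℝ w.2 (x k - w.1) := by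
        intro k
        rw [← inner_add_right, sub_add_sub_cancel, inner_sub_left]
      -- Bounded times strongly null: this is where the pairing of a weak limit with a strong limit
      -- passes through.
      have h3 : Tendsto (fun k => inner ℝ (ξ k) (x k - a)) U (𝓝 0) := by
        have h5 : Tendsto (fun k => C * ‖x k - a‖) U (𝓝 0) := by
          have := ((hx.sub_const a).norm.const_mul C).mono_left hU
          simpa using this
        refine squeeze_zero_norm' (hU ?_) h5
        filter_upwards [hC] with k hk
        exact (norm_inner_le_norm _ _).trans (by gcongr)
      have h4 : Tendsto (fun k => inner ℝ w.2 (x k - w.1)) U (𝓝 (inner ℝ w.2 (a - w.1))) :=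
        Tendsto.inner tendsto_const_nhds ((hx.mono_left hU).sub_const _)
      simp only [h2]
      convert (h3.add (hlim (a - w.1))).sub h4 using 2
      rw [zero_add, inner_sub_left]
    refine ge_of_tendsto h1 (hU ?_)
    filter_upwards [hξ] with k hk
    exact hm _ hk _ hw
  obtain ⟨b, hb, -⟩ := key (Ultrafilter.of atTop) (Ultrafilter.of_le _)
  -- Single-valuedness forces the same limit `b` along every ultrafilter, so the whole sequence
  -- converges weakly.
  refine ⟨b, hb, fun h => tendsto_iff_ultrafilter _ _ _ |>.2 fun U hU => ?_⟩
  obtain ⟨b', hb', hlim⟩ := key U hU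
  rw [hs a b b' hb hb']
  exact hlim h

/-- The norms `‖R k x‖` increase and are bounded by `‖y‖`, so `norm_sub_sq_le` makes `R k x` a
Cauchy sequence, and demiclosedness identifies its limit. This strong convergence is later the
source of measurability of the limiting velocity. -/
theorem IsYosida.tendsto [CompleteSpace H] (hG : HasResolvents G) (hm : IsMonotoneGraph G)
    (hs : IsOperatorGraph G) {μ : ℕ → ℝ} {R : ℕ → H → H} (hμ : ∀ k, 0 < μ k) (hanti : Antitone μ)
    (hμ0 : Tendsto μ atTop (𝓝 0)) (hR : ∀ k, IsYosida G (μ k) (R k)) {x y : H}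
    (hxy : (x, y) ∈ G) : Tendsto (fun k => R k x) atTop (𝓝 y) := by
  have hmono : Monotone fun k => ‖R k x‖ ^ 2 := by
    intro k l hkl
    have := (hR k).norm_sub_sq_le hm (hμ l) (hanti hkl) (hR l) x
    have := sq_nonneg ‖R l x - R k x‖
    simp only
    linarith
  have hle : ∀ k, ‖R k x‖ ≤ ‖y‖ := fun k => (hR k).norm_le hm (hμ k) hxy
  have hbdd : BddAbove (range fun k => ‖R k x‖ ^ 2) := by
    refine ⟨‖y‖ ^ 2, ?_⟩
    rintro _ ⟨k, rfl⟩
    have := hle k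
    simp only
    gcongr
  have hc := (tendsto_atTop_ciSup hmono hbdd).cauchySeq
  have hcauchy : CauchySeq fun k => R k x := by
    rw [Metric.cauchySeq_iff'] at hc ⊢
    intro ε hε
    obtain ⟨N, hN⟩ := hc (ε ^ 2) (by positivity)
    refine ⟨N, fun k hk => ?_⟩
    have h1 := hN k hk
    rw [Real.dist_eq, abs_of_nonneg (sub_nonneg.2 (hmono hk))] at h1
    rw [dist_eq_norm]
    have h2 := (hR N).norm_sub_sq_le hm (hμ k) (hanti hk) (hR k) x
    exact lt_of_pow_lt_pow_left₀ 2 hε.le (h2.trans_lt h1)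
  obtain ⟨b, hb⟩ := cauchySeq_tendsto_of_complete hcauchy
  have hxk : Tendsto (fun k => x - μ k • R k x) atTop (𝓝 x) := by
    simpa using tendsto_const_nhds.sub (hμ0.smul hb)
  obtain ⟨b', hb', hlim⟩ := hG.exists_weak_limit hm hs hxk (Eventually.of_forall fun k => hR k x)
    (Eventually.of_forall hle)
  rw [hs x y b' hxy hb']
  have : b = b' := by
    refine ext_inner_right ℝ fun h => ?_
    exact tendsto_nhds_unique (hb.inner tendsto_const_nhds) (hlim h)
  rwa [← this]

end MaximalMonotone

/-! ## Well-posedness of evolution equations governed by maximal monotone graphs -/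

section Evolution

variable {H : Type*} [NormedAddCommGroup H] [InnerProductSpace ℝ H] {G : Set (H × H)}
  {B : H → H} {L : ℝ≥0}

theorem LipschitzWith.inner_sub_le (hB : LipschitzWith L B) (x y : H) :
    inner ℝ (B x - B y) (x - y) ≤ L * ‖x - y‖ ^ 2 := by
  have h := hB.dist_le_mul x y
  rw [dist_eq_norm, dist_eq_norm] at h
  calc _ ≤ ‖B x - B y‖ * ‖x - y‖ := real_inner_le_norm _ _
    _ ≤ L * ‖x - y‖ * ‖x - y‖ := by gcongr
    _ = _ := by ring

theorem norm_le_exp_mul_of_sq_le {x y L t : ℝ} (hy : 0 ≤ y)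
    (h : x ^ 2 ≤ Real.exp (2 * L * t) * y ^ 2) : x ≤ Real.exp (L * t) * y := by
  refine le_of_sq_le_sq ?_ (by positivity)
  have h1 : Real.exp (L * t) ^ 2 = Real.exp (2 * L * t) := by
    rw [sq, ← Real.exp_add]
    ring_nf
  rwa [mul_pow, h1]

/-- By monotonicity `e^{-2Lt} ‖u - v‖²` has nonpositive derivative a.e., and it is absolutely
continuous on compact subintervals of `(0, T)`. Continuity on `[0, T]` carries the comparison to
both endpoints. -/
theorem IsStrongSolution.norm_sub_le (hm : IsMonotoneGraph G) (hB : LipschitzWith L B) {T : ℝ}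
    {u₀ v₀ : H} {u v : ℝ → H} (hu : IsStrongSolution G B u₀ T u)
    (hv : IsStrongSolution G B v₀ T v) {t : ℝ} (ht : t ∈ Icc 0 T) :
    ‖u t - v t‖ ≤ Real.exp (L * t) * ‖u₀ - v₀‖ := by
  obtain ⟨huc, hu0, huac, hue⟩ := hu
  obtain ⟨hvc, hv0, hvac, hve⟩ := hv
  set f : ℝ → ℝ := fun t => Real.exp (-(2 * L * t)) * (‖u t - v t‖ * ‖u t - v t‖) with hf
  have hfc : ContinuousOn f (Icc 0 T) :=
    (Continuous.continuousOn (by fun_prop)).mul ((huc.sub hvc).norm.mul (huc.sub hvc).norm)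
  have hmono : ∀ a b, 0 < a → a ≤ b → b < T → f b ≤ f a := by
    intro a b ha hab hb
    have hw := (huac a b ha hab hb).sub (hvac a b ha hab hb)
    have hn : AbsolutelyContinuousOnInterval (fun t => ‖u t - v t‖) a b :=
      hw.of_dist_le fun s t => (dist_norm_norm_le _ _).trans_eq (dist_eq_norm _ _).symm
    have he : AbsolutelyContinuousOnInterval (fun t : ℝ => Real.exp (-(2 * L * t))) a b :=
      ContDiffOn.absolutelyContinuousOnInterval (ContDiff.contDiffOn (by fun_prop))
    refine AbsolutelyContinuousOnInterval.le_of_ae_hasDerivAt_nonpos hab (he.mul (hn.mul hn)) ?_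
    rw [ae_restrict_iff' measurableSet_Ioo] at hue hve
    filter_upwards [hue, hve] with t htu htv ht
    have ht' : t ∈ Ioo 0 T := ⟨ha.trans ht.1, ht.2.trans hb⟩
    obtain ⟨f₁, du, hf₁, hdu, hue⟩ := htu ht'
    obtain ⟨f₂, dv, hf₂, hdv, hve⟩ := htv ht'
    have h1 : HasDerivAt (fun t : ℝ => -(2 * L * t)) (-(2 * L)) t := by
      simpa using ((hasDerivAt_id t).const_mul (2 * L : ℝ)).fun_neg
    have h2 := h1.exp.mul (hdu.sub hdv).norm_sq
    refine ⟨_, ?_, h2.congr_of_eventuallyEq (Eventually.of_forall fun s => ?_)⟩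
    · have h3 := hm _ hf₁ _ hf₂
      have h4 := hB.inner_sub_le (u t) (v t)
      have h5 : du - dv = (B (u t) - B (v t)) - (f₁ - f₂) := by
        rw [← hue, ← hve]; abel
      simp only [Pi.sub_apply]
      rw [h5, real_inner_comm, inner_sub_left]
      have h6 : 0 ≤ Real.exp (-(2 * L * t)) * (2 * (L * ‖u t - v t‖ ^ 2 -
          (inner ℝ (B (u t) - B (v t)) (u t - v t) - inner ℝ (f₁ - f₂) (u t - v t)))) :=
        mul_nonneg (Real.exp_pos _).le (by linarith)
      linarith
    · simp only [Pi.mul_apply, Pi.sub_apply]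
      ring
  have hT : 0 ≤ T := ht.1.trans ht.2
  have hIoo : ∀ t ∈ Ioo 0 T, f t ≤ f 0 := by
    intro t ht
    have h1 : Tendsto f (𝓝[>] 0) (𝓝 (f 0)) :=
      ((hfc 0 ⟨le_rfl, hT⟩).mono_of_mem_nhdsWithin (Icc_mem_nhdsGT (ht.1.trans ht.2))).tendsto
    refine ge_of_tendsto h1 ?_
    filter_upwards [Ioo_mem_nhdsGT ht.1] with a ha
    exact hmono a t ha.1 ha.2.le ht.2
  have hle : f t ≤ f 0 := by
    rcases ht.1.eq_or_lt with rfl | h0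
    · exact le_rfl
    rcases ht.2.lt_or_eq with h1 | rfl
    · exact hIoo t ⟨h0, h1⟩
    · have h1 : Tendsto f (𝓝[<] t) (𝓝 (f t)) :=
        ((hfc t ⟨hT, le_rfl⟩).mono_of_mem_nhdsWithin (Icc_mem_nhdsLT h0)).tendsto
      refine le_of_tendsto h1 ?_
      filter_upwards [Ioo_mem_nhdsLT h0] with a ha
      exact hIoo a ha
  refine norm_le_exp_mul_of_sq_le (norm_nonneg _) ?_
  simp only [hf, mul_zero, Real.exp_neg, Real.exp_zero, inv_one, one_mul, hu0, hv0,
    inv_mul_le_iff₀ (Real.exp_pos _)] at hle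
  rwa [sq, sq]

theorem IsWeakSolution.norm_sub_le (hm : IsMonotoneGraph G) (hB : LipschitzWith L B) {T : ℝ}
    {u₀ v₀ : H} {u v : ℝ → H} (hu : IsWeakSolution G B u₀ T u)
    (hv : IsWeakSolution G B v₀ T v) {t : ℝ} (ht : t ∈ Icc 0 T) :
    ‖u t - v t‖ ≤ Real.exp (L * t) * ‖u₀ - v₀‖ := by
  obtain ⟨-, rfl, y, w, hw, hwu⟩ := hu
  obtain ⟨-, rfl, z, s, hs, hsv⟩ := hv
  have h0 : (0 : ℝ) ∈ Icc 0 T := ⟨le_rfl, ht.1.trans ht.2⟩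
  refine le_of_tendsto_of_tendsto' ((hwu.tendsto_at ht).sub (hsv.tendsto_at ht)).norm
    ((((hwu.tendsto_at h0).sub (hsv.tendsto_at h0)).norm).const_mul _) fun k => ?_
  have := (hw k).norm_sub_le hm hB (hs k) ht
  rwa [← (hw k).2.1, ← (hs k).2.1] at this

/-- An a priori bound for the velocity. -/
theorem norm_velocity_le {F : H → H} (hF : ∀ x y, inner ℝ (F x - F y) (x - y) ≤ L * ‖x - y‖ ^ 2)
    {u : ℝ → H} (hu : ∀ t, 0 ≤ t → HasDerivAt u (F (u t)) t) {t : ℝ} (ht : 0 ≤ t) :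
    ‖F (u t)‖ ≤ Real.exp (L * t) * ‖F (u 0)‖ := by
  refine le_of_tendsto_of_tendsto (hu t ht).tendsto_slope_zero_right.norm
    (((hu 0 le_rfl).tendsto_slope_zero_right.norm).const_mul _) ?_
  filter_upwards [self_mem_nhdsWithin] with h hh
  have hh : 0 < h := hh
  rw [norm_smul, norm_smul, mul_left_comm]
  gcongr
  refine norm_le_exp_mul_of_sq_le (norm_nonneg _) ?_
  -- A time translate solves the same equation, so Gronwall with `ε = 0` compares the difference
  -- quotients at `t` and at `0`.
  have := norm_sq_le_of_inner_deriv_le (w := fun s => u (s + h) - u s)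
    (w' := fun s => F (u (s + h)) - F (u s)) (L := L) (ε := 0) (T := t) L.2 le_rfl
    (fun s hs => ((hu (s + h) (add_nonneg hs.1 hh.le)).comp_add_const s h).sub (hu s hs.1))
    (fun s _ => by simpa using hF (u (s + h)) (u s)) ⟨ht, le_rfl⟩
  simpa using this

/-- Solve `w_k' = B w_k - R_k w_k`. Since `u₀` lies in the domain, the velocities and then `R_k w_k`
are bounded uniformly in `k` on bounded time intervals. Monotonicity gives `‖w_k - w_l‖² = O(μ_k +
μ_l)`, so `w_k` converges strongly to `u`, while `R_k w_k` converges weakly to the value of the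
operator at `u`. -/
theorem HasResolvents.exists_lipschitz_solution [CompleteSpace H] (hG : HasResolvents G)
    (hm : IsMonotoneGraph G) (hs : IsOperatorGraph G) (hB : LipschitzWith L B) {u₀ y₀ : H}
    (hy : (u₀, y₀) ∈ G) :
    ∃ u : ℝ → H, u 0 = u₀ ∧ ∀ T, 0 < T → (∃ K : ℝ≥0, LipschitzOnWith K u (Icc 0 T)) ∧
      ∀ᵐ t, t ∈ Ioo 0 T → ∃ f du : H, (u t, f) ∈ G ∧ HasDerivAt u du t ∧ du + f = B (u t) := by
  set μ : ℕ → ℝ := fun k => 1 / ((k : ℝ) + 1) with hμdef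
  have hμ : ∀ k, 0 < μ k := fun k => Nat.one_div_pos_of_nat
  have hanti : Antitone μ := fun k l hkl => Nat.one_div_le_one_div hkl
  have hμ0 : Tendsto μ atTop (𝓝 0) := tendsto_one_div_add_atTop_nhds_zero_nat
  choose R hR using fun k => hG.exists_isYosida (hμ k)
  set F : ℕ → H → H := fun k x => B x - R k x with hFdef
  have hFl : ∀ k, LipschitzWith (L + Real.toNNReal (μ k)⁻¹) (F k) := fun k =>
    hB.sub ((hR k).lipschitz hm (hμ k))
  choose w hw0 hw using fun k => (hFl k).exists_forall_hasDerivAt u₀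
  -- The one-sided Lipschitz constant is `L` for every `k`, although the Lipschitz constants of `F
  -- k` blow up.
  have hFinner : ∀ k x y, inner ℝ (F k x - F k y) (x - y) ≤ L * ‖x - y‖ ^ 2 := by
    intro k x y
    have h1 := hB.inner_sub_le x y
    have h2 := (hR k).mul_norm_sq_le_inner hm x y
    have h3 : 0 ≤ μ k * ‖R k x - R k y‖ ^ 2 := mul_nonneg (hμ k).le (by positivity)
    rw [show F k x - F k y = (B x - B y) - (R k x - R k y) by simp only [hFdef]; abel,
      inner_sub_left]
    linarith
  set C : ℝ → ℝ := fun T => Real.exp (L * T) * (‖B u₀‖ + ‖y₀‖) with hC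
  have hvel : ∀ T, ∀ t ∈ Icc 0 T, ∀ k, ‖F k (w k t)‖ ≤ C T := by
    intro T t ht k
    refine (norm_velocity_le (hFinner k) (hw k) ht.1).trans ?_
    rw [hw0 k]
    have h1 : ‖F k u₀‖ ≤ ‖B u₀‖ + ‖y₀‖ :=
      (norm_sub_le _ _).trans (add_le_add le_rfl ((hR k).norm_le hm (hμ k) hy))
    have h2 := ht.2
    simp only [hC]
    gcongr
  have hwlip : ∀ T, ∀ s ∈ Icc 0 T, ∀ t ∈ Icc 0 T, ∀ k, ‖w k t - w k s‖ ≤ C T * ‖t - s‖ := by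
    intro T s hs t ht k
    exact (convex_Icc 0 T).norm_image_sub_le_of_norm_hasDerivWithin_le
      (fun r hr => (hw k r hr.1).hasDerivWithinAt) (fun r hr => hvel T r hr k) hs ht
  have hC0 : ∀ T, 0 ≤ C T := fun T => by positivity
  set M : ℝ → ℝ := fun T => ‖B u₀‖ + L * (C T * T) + C T with hMdef
  have hYos : ∀ T, ∀ t ∈ Icc 0 T, ∀ k, ‖R k (w k t)‖ ≤ M T := by
    intro T t ht k
    have hT : 0 ≤ T := ht.1.trans ht.2
    have h1 : R k (w k t) = B u₀ + (B (w k t) - B u₀) - F k (w k t) := by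
      simp only [hFdef]; abel
    have h2 : ‖B (w k t) - B u₀‖ ≤ L * (C T * T) := by
      have h3 := hwlip T 0 ⟨le_rfl, hT⟩ t ht k
      rw [hw0 k, sub_zero, Real.norm_of_nonneg ht.1] at h3
      rw [← dist_eq_norm]
      refine (hB.dist_le_mul _ _).trans ?_
      rw [dist_eq_norm]
      have := ht.2
      have := hC0 T
      gcongr
      exact h3.trans (by gcongr)
    rw [h1]
    exact (norm_sub_le _ _).trans (add_le_add ((norm_add_le _ _).trans (add_le_add le_rfl h2))
      (hvel T t ht k))
  have hM0 : ∀ T, 0 ≤ T → 0 ≤ M T := fun T hT => by positivity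
  have hdist : ∀ T, ∀ t ∈ Icc 0 T, ∀ k l, ‖w k t - w l t‖ ^ 2 ≤
      Real.exp (2 * L * t) * (2 * (2 * M T * (M T * (μ k + μ l))) * t) := by
    intro T t ht k l
    have hT : 0 ≤ T := ht.1.trans ht.2
    have := norm_sq_le_of_inner_deriv_le (w := fun s => w k s - w l s)
      (w' := fun s => F k (w k s) - F l (w l s)) (L := L) (ε := 2 * M T * (M T * (μ k + μ l)))
      (T := T) L.2 (by have := hM0 T hT; have := hμ k; have := hμ l; positivity)
      (fun s hs => (hw k s hs.1).sub (hw l s hs.1)) (fun s hs => by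
        have h1 := hB.inner_sub_le (w k s) (w l s)
        have h2 := (hR k).inner_ge hm (hR l) (w k s) (w l s)
        -- The indefinite cross term is small because both Yosida values are bounded by `M T`. It
        -- plays the role of `ε` in Gronwall.
        have h3 : |inner ℝ (R k (w k s) - R l (w l s)) (μ k • R k (w k s) - μ l • R l (w l s))| ≤
            2 * M T * (M T * (μ k + μ l)) := by
          refine (abs_real_inner_le_norm _ _).trans ?_
          have hk := hYos T s hs k
          have hl := hYos T s hs l
          have hMT := hM0 T hT
          refine mul_le_mul ((norm_sub_le _ _).trans (by linarith)) ?_ (norm_nonneg _)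
            (by positivity)
          refine (norm_sub_le _ _).trans ?_
          rw [norm_smul, norm_smul, Real.norm_of_nonneg (hμ k).le, Real.norm_of_nonneg (hμ l).le]
          have h4 := mul_le_mul_of_nonneg_left hk (hμ k).le
          have h5 := mul_le_mul_of_nonneg_left hl (hμ l).le
          linarith
        rw [show F k (w k s) - F l (w l s) =
          (B (w k s) - B (w l s)) - (R k (w k s) - R l (w l s)) by simp only [hFdef]; abel,
          inner_sub_left]
        have := (abs_le.1 h3).1
        linarith) ht
    simpa [hw0] using this
  have hcauchy : ∀ t, 0 ≤ t → CauchySeq fun k => w k t := by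
    intro t ht
    rw [Metric.cauchySeq_iff']
    intro ε hε
    have hlim : Tendsto (fun N => Real.exp (2 * L * t) *
        (2 * (2 * M t * (M t * (μ N + μ N))) * t)) atTop (𝓝 0) := by
      have : Tendsto (fun N => Real.exp (2 * L * t) *
        (2 * (2 * M t * (M t * (μ N + μ N))) * t)) atTop (𝓝 (Real.exp (2 * L * t) *
        (2 * (2 * M t * (M t * (0 + 0))) * t))) :=
        (((((hμ0.add hμ0).const_mul _).const_mul _).const_mul _).mul_const _).const_mul _
      simpa using this
    obtain ⟨N, hN⟩ := (hlim.eventually (gt_mem_nhds (show (0 : ℝ) < ε ^ 2 by positivity))).exists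
    refine ⟨N, fun k hk => ?_⟩
    rw [dist_eq_norm]
    refine lt_of_pow_lt_pow_left₀ 2 hε.le (lt_of_le_of_lt ?_ hN)
    refine (hdist t t ⟨ht, le_rfl⟩ k N).trans ?_
    have h1 := hM0 t ht
    have h2 := hanti hk
    gcongr
  have hex : ∀ t, ∃ a b, 0 ≤ t → Tendsto (fun k => w k t) atTop (𝓝 a) ∧ (a, b) ∈ G ∧
      ∀ h, Tendsto (fun k => inner ℝ (R k (w k t)) h) atTop (𝓝 (inner ℝ b h)) := by
    intro t
    by_cases ht : 0 ≤ t
    · obtain ⟨a, ha⟩ := cauchySeq_tendsto_of_complete (hcauchy t ht)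
      have hb := hYos t t ⟨ht, le_rfl⟩
      -- The graph contains `R k (w k t)` over this shifted point, not over `w k t`; the shift tends
      -- to zero.
      have h1 : Tendsto (fun k => w k t - μ k • R k (w k t)) atTop (𝓝 a) := by
        have h2 : Tendsto (fun k => μ k • R k (w k t)) atTop (𝓝 0) := by
          refine squeeze_zero_norm (fun k => ?_) (by simpa using hμ0.mul_const (M t))
          rw [norm_smul, Real.norm_of_nonneg (hμ k).le]
          exact mul_le_mul_of_nonneg_left (hb k) (hμ k).le
        simpa using ha.sub h2
      obtain ⟨b, hab, hlim⟩ := hG.exists_weak_limit hm hs h1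
        (Eventually.of_forall fun k => hR k (w k t)) (Eventually.of_forall hb)
      exact ⟨a, b, fun _ => ⟨ha, hab, hlim⟩⟩
    · exact ⟨0, 0, fun h => absurd h ht⟩
  choose u b hub using hex
  have hu0 : u 0 = u₀ := by
    refine tendsto_nhds_unique (hub 0 le_rfl).1 ?_
    simp only [hw0]
    exact tendsto_const_nhds
  have hulip : ∀ T, LipschitzOnWith (Real.toNNReal (C T)) u (Icc 0 T) := by
    intro T
    refine LipschitzOnWith.of_dist_le_mul fun t ht s hs => ?_
    rw [Real.coe_toNNReal _ (hC0 T), dist_eq_norm, dist_eq_norm]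
    exact le_of_tendsto ((hub t ht.1).1.sub (hub s hs.1).1).norm
      (Eventually.of_forall fun k => hwlip T s hs t ht k)
  set g : ℝ → H := fun t => B (u t) - b t with hg
  have hbM : ∀ T, ∀ t ∈ Icc 0 T, ‖b t‖ ≤ M T := by
    intro T t ht
    have h1 : ‖b t‖ * ‖b t‖ ≤ M T * ‖b t‖ := by
      rw [← sq, ← real_inner_self_eq_norm_sq]
      refine le_of_tendsto ((hub t ht.1).2.2 (b t)) (Eventually.of_forall fun k => ?_)
      exact (real_inner_le_norm _ _).trans (by gcongr; exact hYos T t ht k)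
    rcases (norm_nonneg (b t)).eq_or_lt with h0 | h0
    · rw [← h0]; exact hM0 T (ht.1.trans ht.2)
    · exact le_of_mul_le_mul_right h1 h0
  -- `b` was only obtained as a pointwise weak limit. Since `b t` is also the strong limit of `R k
  -- (u t)` at fixed `u t`, and `R k ∘ u` is continuous on `[0, T]`, `g` is strongly measurable.
  have hgint : ∀ T, IntegrableOn g (Icc 0 T) := by
    intro T
    have hBu : ContinuousOn (fun t => B (u t)) (Icc 0 T) :=
      hB.continuous.comp_continuousOn (hulip T).continuousOn
    have hmeas : AEStronglyMeasurable g (volume.restrict (Icc 0 T)) := by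
      refine aestronglyMeasurable_of_tendsto_ae atTop (f := fun k t => B (u t) - R k (u t))
        (fun k => ?_) ?_
      · exact (hBu.sub (((hR k).lipschitz hm (hμ k)).continuous.comp_continuousOn
          (hulip T).continuousOn)).aestronglyMeasurable measurableSet_Icc
      · filter_upwards [ae_restrict_mem measurableSet_Icc] with t ht
        exact tendsto_const_nhds.sub
          (IsYosida.tendsto hG hm hs hμ hanti hμ0 hR (hub t ht.1).2.1)
    obtain ⟨D, hD⟩ := isCompact_Icc.exists_bound_of_continuousOn hBu
    refine Integrable.of_bound hmeas (D + M T) ?_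
    filter_upwards [ae_restrict_mem measurableSet_Icc] with t ht
    exact (norm_sub_le _ _).trans (add_le_add (hD t ht) (hbM T t ht))
  have hgii : ∀ t, 0 ≤ t → IntervalIntegrable g volume 0 t := fun t ht => by
    rw [intervalIntegrable_iff_integrableOn_Icc_of_le ht]
    exact hgint t
  -- The integral equation is passed to the limit after pairing with a fixed vector, where weak
  -- convergence of the velocities and dominated convergence suffice. Lebesgue differentiation then
  -- recovers the equation a.e.
  have hrep : ∀ t, 0 ≤ t → u t = u₀ + ∫ s in (0 : ℝ)..t, g s := by
    intro t ht
    rw [← sub_eq_iff_eq_add']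
    refine ext_inner_left ℝ fun h => ?_
    have h1 : Tendsto (fun k => inner ℝ h (w k t - u₀)) atTop (𝓝 (inner ℝ h (u t - u₀))) :=
      tendsto_const_nhds.inner ((hub t ht).1.sub_const _)
    have hFc : ∀ k, ContinuousOn (fun s => F k (w k s)) (uIcc 0 t) := by
      intro k s hs
      rw [uIcc_of_le ht] at hs
      exact ((hFl k).continuous.continuousAt.comp
        (hw k s hs.1).continuousAt).continuousWithinAt
    have h2 : ∀ k, inner ℝ h (w k t - u₀) = ∫ s in (0 : ℝ)..t, inner ℝ h (F k (w k s)) := by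
      intro k
      have h3 := intervalIntegral.integral_eq_sub_of_hasDerivAt (f := w k)
        (fun s hs => hw k s (by rw [uIcc_of_le ht] at hs; exact hs.1)) (hFc k).intervalIntegrable
      rw [← hw0 k, ← h3]
      exact ((innerSL ℝ h).intervalIntegral_comp_comm (hFc k).intervalIntegrable).symm
    have h4 : inner ℝ h (∫ s in (0 : ℝ)..t, g s) = ∫ s in (0 : ℝ)..t, inner ℝ h (g s) :=
      ((innerSL ℝ h).intervalIntegral_comp_comm (hgii t ht)).symm
    rw [h4]
    simp only [h2] at h1
    refine tendsto_nhds_unique h1 ?_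
    refine intervalIntegral.tendsto_integral_filter_of_dominated_convergence
      (fun _ => ‖h‖ * C t) (Eventually.of_forall fun k => ?_) (Eventually.of_forall fun k => ?_)
      intervalIntegrable_const ?_
    · exact (((innerSL ℝ h).continuous.comp_continuousOn (hFc k)).mono
        uIoc_subset_uIcc).aestronglyMeasurable measurableSet_uIoc
    · refine Eventually.of_forall fun s hs => ?_
      rw [uIoc_of_le ht] at hs
      exact (norm_inner_le_norm _ _).trans
        (by gcongr; exact hvel t s ⟨hs.1.le, hs.2⟩ k)
    · refine Eventually.of_forall fun s hs => ?_
      rw [uIoc_of_le ht] at hs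
      have h5 := hub s hs.1.le
      simp only [hFdef, hg, inner_sub_right]
      refine Tendsto.sub (tendsto_const_nhds.inner ((hB.continuous.tendsto _).comp h5.1)) ?_
      simpa only [real_inner_comm] using h5.2.2 h
  refine ⟨u, hu0, fun T hT => ⟨⟨_, hulip T⟩, ?_⟩⟩
  filter_upwards [(hgii T hT.le).ae_hasDerivAt_integral] with t ht htT
  rw [uIcc_of_le hT.le] at ht
  have h1 := (ht (Ioo_subset_Icc_self htT) 0 ⟨le_rfl, hT.le⟩).const_add u₀
  refine ⟨b t, g t, (hub t htT.1.le).2.1, h1.congr_of_eventuallyEq ?_, sub_add_cancel _ _⟩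
  filter_upwards [Ioi_mem_nhds htT.1] with s hs
  exact hrep s hs.le

/-- A densely defined single valued maximal monotone operator generates a globally well-posed
evolution equation. -/
theorem HasResolvents.isWellPosed [CompleteSpace H] (hG : HasResolvents G)
    (hm : IsMonotoneGraph G) (hs : IsOperatorGraph G) (hd : Dense (Prod.fst '' G)) :
    IsWellPosed G := by
  intro B L hB
  have hstrong : ∀ u₀ f, (u₀, f) ∈ G → ∃ u : ℝ → H, ∀ T, 0 < T →
      IsStrongSolution G B u₀ T u ∧ ∃ K : ℝ≥0, LipschitzOnWith K u (Icc 0 T) := by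
    intro u₀ f hf
    obtain ⟨u, hu0, hu⟩ := hG.exists_lipschitz_solution hm hs hB hf
    refine ⟨u, fun T hT => ?_⟩
    obtain ⟨⟨K, hK⟩, hae⟩ := hu T hT
    refine ⟨⟨hK.continuousOn, hu0, fun a b ha hab hb => ?_, ?_⟩, K, hK⟩
    · refine (hK.mono ?_).absolutelyContinuousOnInterval
      rw [uIcc_of_le hab]
      exact Icc_subset_Icc ha.le hb.le
    · rwa [ae_restrict_iff' measurableSet_Ioo]
  refine ⟨fun u₀ => ?_, hstrong, fun T _ u₀ v₀ u v hu hv t ht => hu.norm_sub_le hm hB hv ht⟩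
  obtain ⟨y, hyG, hy⟩ := mem_closure_iff_seq_limit.1 (hd u₀)
  have hyf : ∀ k, ∃ f, (y k, f) ∈ G := fun k => by
    obtain ⟨z, hz, h⟩ := hyG k
    exact ⟨z.2, by rw [← h]; exact hz⟩
  choose f hf using hyf
  choose w hw using fun k => hstrong (y k) (f k) (hf k)
  have hdist : ∀ T, 0 < T → ∀ t ∈ Icc 0 T, ∀ k l,
      dist (w k t) (w l t) ≤ Real.exp (L * T) * dist (y k) (y l) := by
    intro T hT t ht k l
    rw [dist_eq_norm, dist_eq_norm]
    refine ((hw k T hT).1.norm_sub_le hm hB (hw l T hT).1 ht).trans ?_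
    have := ht.2
    gcongr
  have hunif : ∀ T, 0 < T → UniformCauchySeqOn w atTop (Icc 0 T) := by
    intro T hT
    rw [Metric.uniformCauchySeqOn_iff]
    intro ε hε
    obtain ⟨N, hN⟩ := Metric.cauchySeq_iff.1 hy.cauchySeq (ε / Real.exp (L * T)) (by positivity)
    refine ⟨N, fun k hk l hl t ht => (hdist T hT t ht k l).trans_lt ?_⟩
    have := hN k hk l hl
    rwa [lt_div_iff₀' (Real.exp_pos _)] at this
  -- The limit is taken pointwise in time, so that one function serves all horizons `T`.
  have hex : ∀ t, ∃ a, 0 ≤ t → Tendsto (fun k => w k t) atTop (𝓝 a) := by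
    intro t
    by_cases ht : 0 ≤ t
    · obtain ⟨a, ha⟩ := cauchySeq_tendsto_of_complete
        -- The horizon `t + 1` is positive even for `t = 0`.
        ((hunif (t + 1) (by linarith)).cauchySeq (x := t) ⟨ht, by linarith⟩)
      exact ⟨a, fun _ => ha⟩
    · exact ⟨0, fun h => absurd h ht⟩
  choose u hu using hex
  refine ⟨u, fun T hT => ?_⟩
  have hlim : TendstoUniformlyOn w u atTop (Icc 0 T) :=
    (hunif T hT).tendstoUniformlyOn_of_tendsto fun t ht => hu t ht.1
  refine ⟨hlim.continuousOn (Frequently.of_forall fun k => (hw k T hT).1.1), ?_,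
    y, w, fun k => (hw k T hT).1, hlim⟩
  refine tendsto_nhds_unique (hu 0 le_rfl) ?_
  have : ∀ k, w k 0 = y k := fun k => (hw k 1 one_pos).1.2.1
  simpa only [this] using hy

end Evolution

/-! ## Realizations of operators with a uniformly convex potential -/

section Potential

variable {V : Type*} [NormedAddCommGroup V] [NormedSpace ℝ V]
  {H : Type*} [NormedAddCommGroup H] [InnerProductSpace ℝ H]

/-- `A u` is a subgradient of `Φ` at `u`. -/
def IsSubgradientOperator (Φ : V → ℝ) (A : V → StrongDual ℝ V) : Prop :=
  ∀ u v, Φ u + A u (v - u) ≤ Φ v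

/-- Uniform convexity of a functional. -/
def IsUniformlyConvexFunctional (Φ : V → ℝ) : Prop :=
  ∀ ε : ℝ, 0 < ε → ∃ δ : ℝ, 0 < δ ∧
    ∀ u v, (Φ u + Φ v) / 2 - Φ ((1 / 2 : ℝ) • (u + v)) < δ → ‖u - v‖ < ε

variable {Φ : V → ℝ} {A : V → StrongDual ℝ V} {ι : V →ₗ[ℝ] H}

theorem IsSubgradientOperator.isMonotoneOperator (hA : IsSubgradientOperator Φ A) :
    IsMonotoneOperator A := by
  intro u v
  have h1 := hA u v
  have h2 := hA v u
  have h3 : A u (v - u) = -A u (u - v) := by rw [← map_neg, neg_sub]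
  rw [sub_apply]
  linarith

theorem IsMonotoneOperator.isMonotoneGraph_realizationGraph (hA : IsMonotoneOperator A) :
    IsMonotoneGraph (realizationGraph ι A) := by
  rintro ⟨x, f⟩ ⟨u, hu, hf⟩ ⟨y, g⟩ ⟨v, hv, hg⟩
  simp only at hu hv hf hg ⊢
  have h := hA u v
  rw [sub_apply, hf, hg, ← inner_sub_left, map_sub, hu, hv] at h
  exact h

/-- Injectivity of `ι` fixes the element of `V` behind a point of `H`; density of its range then
fixes the representing vector. -/
theorem isOperatorGraph_realizationGraph (hinj : Function.Injective ι) (hd : DenseRange ι) :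
    IsOperatorGraph (realizationGraph ι A) := by
  rintro h f g ⟨u, hu, hf⟩ ⟨v, hv, hg⟩
  simp only at hu hv hf hg
  rw [hinj (hv.trans hu.symm)] at hg
  exact hd.eq_of_inner_left ℝ fun w => by rw [← hf, ← hg]

/-- The direct method for `J = μ Φ + ½ ‖ι · - f‖²`, whose Euler equation is the resolvent equation.
Uniform convexity gives a strongly convergent minimizing sequence. -/
theorem IsSubgradientOperator.hasResolvents_realizationGraph [CompleteSpace V]
    (hA : IsSubgradientOperator Φ A) (hhem : IsHemicontinuousOperator A)
    (hconv : IsUniformlyConvexFunctional Φ) (hΦ : ∀ u, 0 ≤ Φ u) (hι : Continuous ι) :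
    HasResolvents (realizationGraph ι A) := by
  intro μ hμ f
  set J : V → ℝ := fun u => μ * Φ u + 1 / 2 * ‖ι u - f‖ ^ 2 with hJ
  have hJ0 : ∀ u, 0 ≤ J u := fun u => by have := hΦ u; positivity
  have hbdd : BddBelow (range J) := ⟨0, by rintro _ ⟨u, rfl⟩; exact hJ0 u⟩
  set m := sInf (range J) with hm
  have hmle : ∀ u, m ≤ J u := fun u => csInf_le hbdd ⟨u, rfl⟩
  have hJsub : ∀ u v, J u + (μ * A u (v - u) + inner ℝ (ι u - f) (ι v - ι u)) ≤ J v := by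
    intro u v
    have h1 := mul_le_mul_of_nonneg_left (hA u v) hμ.le
    have h2 : ‖ι v - f‖ ^ 2 = ‖ι u - f‖ ^ 2 + 2 * inner ℝ (ι u - f) (ι v - ι u) +
        ‖ι v - ι u‖ ^ 2 := by
      rw [← norm_add_sq_real]; congr 2; abel
    have h3 := sq_nonneg ‖ι v - ι u‖
    simp only [hJ, h2]
    linarith
  -- Two near-minimizers have a midpoint that cannot beat `m`, so their convexity gap for `Φ` is
  -- small; this is what makes the sequence Cauchy.
  have hJmid : ∀ u v, J ((1 / 2 : ℝ) • (u + v)) +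
      μ * ((Φ u + Φ v) / 2 - Φ ((1 / 2 : ℝ) • (u + v))) ≤ (J u + J v) / 2 := by
    intro u v
    have h1 : ι ((1 / 2 : ℝ) • (u + v)) - f = (1 / 2 : ℝ) • ((ι u - f) + (ι v - f)) := by
      rw [map_smul, map_add]
      module
    have h2 : ‖ι ((1 / 2 : ℝ) • (u + v)) - f‖ ^ 2 ≤ (‖ι u - f‖ ^ 2 + ‖ι v - f‖ ^ 2) / 2 := by
      have h3 := parallelogram_law_with_norm ℝ (ι u - f) (ι v - f)
      rw [h1, norm_smul, mul_pow, Real.norm_of_nonneg (by norm_num)]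
      nlinarith [norm_nonneg ((ι u - f) - (ι v - f))]
    simp only [hJ]
    linarith
  choose w hw using fun k : ℕ => exists_lt_of_csInf_lt (range_nonempty J)
    (show m < m + 1 / ((k : ℝ) + 1) from lt_add_of_pos_right _ Nat.one_div_pos_of_nat)
  choose hwr hwlt using hw
  choose x hx using hwr
  have hxlt : ∀ k, J (x k) < m + 1 / ((k : ℝ) + 1) := fun k => by rw [hx k]; exact hwlt k
  have hlim0 : Tendsto (fun k : ℕ => 1 / ((k : ℝ) + 1)) atTop (𝓝 0) :=
    tendsto_one_div_add_atTop_nhds_zero_nat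
  have hcauchy : CauchySeq x := by
    rw [Metric.cauchySeq_iff']
    intro ε hε
    obtain ⟨δ, hδ, hδ'⟩ := hconv ε hε
    obtain ⟨N, hN⟩ := (hlim0.eventually (gt_mem_nhds (mul_pos hμ hδ))).exists
    refine ⟨N, fun k hk => ?_⟩
    rw [dist_eq_norm]
    refine hδ' _ _ (lt_of_mul_lt_mul_left ?_ hμ.le)
    have h1 := hJmid (x k) (x N)
    have h2 := hmle ((1 / 2 : ℝ) • (x k + x N))
    have h3 := hxlt k
    have h4 := hxlt N
    have h5 : 1 / ((k : ℝ) + 1) ≤ 1 / ((N : ℝ) + 1) := Nat.one_div_le_one_div hk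
    linarith
  obtain ⟨u, hu⟩ := cauchySeq_tendsto_of_complete hcauchy
  -- No continuity of `Φ` is needed: the subgradient inequality at the limit `u` gives a continuous
  -- affine minorant for `Φ`, hence lower semicontinuity of `J` along the sequence.
  have hmin : J u ≤ m := by
    have h1 : Tendsto (fun k => J u + (μ * A u (x k - u) + inner ℝ (ι u - f) (ι (x k) - ι u)))
        atTop (𝓝 (J u + (μ * A u (u - u) + inner ℝ (ι u - f) (ι u - ι u)))) :=
      tendsto_const_nhds.add (((((A u).continuous.tendsto _).comp (hu.sub_const u)).const_mul μ).add
        (tendsto_const_nhds.inner (((hι.tendsto _).comp hu).sub_const _)))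
    have h2 : Tendsto (fun k : ℕ => m + 1 / ((k : ℝ) + 1)) atTop (𝓝 (m + 0)) :=
      tendsto_const_nhds.add hlim0
    simp only [sub_self, map_zero, inner_zero_right, mul_zero, add_zero] at h1 h2
    exact le_of_tendsto_of_tendsto' h1 h2 fun k => (hJsub u (x k)).trans (hxlt k).le
  -- Minty's trick avoids differentiating `Φ`: compare `J u` with the subgradient inequality at `u +
  -- t v`, divide by `t > 0`, and let `t → 0` by hemicontinuity.
  have hvar : ∀ v, 0 ≤ μ * A u v + inner ℝ (ι u - f) (ι v) := by
    intro v
    have h1 : Tendsto (fun t : ℝ => μ * A (u + t • v) v + inner ℝ (ι (u + t • v) - f) (ι v))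
        (𝓝[>] 0) (𝓝 (μ * A (u + (0 : ℝ) • v) v + inner ℝ (ι (u + (0 : ℝ) • v) - f) (ι v))) := by
      refine (((hhem u v v).tendsto 0).const_mul μ |>.add ?_).mono_left nhdsWithin_le_nhds
      have h2 : Continuous fun t : ℝ => inner ℝ (ι (u + t • v) - f) (ι v) :=
        ((hι.comp (by fun_prop)).sub continuous_const).inner continuous_const
      exact h2.tendsto 0
    rw [zero_smul, add_zero] at h1
    refine ge_of_tendsto h1 ?_
    filter_upwards [self_mem_nhdsWithin] with t ht
    have ht : 0 < t := ht
    have h2 := hJsub (u + t • v) u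
    have h3 := hmin.trans (hmle (u + t • v))
    have h4 : A (u + t • v) (u - (u + t • v)) = -(t * A (u + t • v) v) := by
      rw [sub_add_cancel_left, map_neg, map_smul, smul_eq_mul]
    have h5 : inner ℝ (ι (u + t • v) - f) (ι u - ι (u + t • v)) =
        -(t * inner ℝ (ι (u + t • v) - f) (ι v)) := by
      rw [← map_sub, sub_add_cancel_left, map_neg, map_smul, inner_neg_right, inner_smul_right]
    rw [h4, h5] at h2
    refine nonneg_of_mul_nonneg_right (a := t) ?_ ht
    linarith
  refine ⟨(ι u, μ⁻¹ • (f - ι u)), ⟨u, rfl, fun v => ?_⟩, ?_⟩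
  · have h1 := hvar v
    have h2 := hvar (-v)
    rw [map_neg, map_neg, inner_neg_right] at h2
    have h3 : μ * A u v = -inner ℝ (ι u - f) (ι v) := by linarith
    rw [inner_smul_left, ← neg_sub, inner_neg_left, ← h3]
    simp [hμ.ne']
  · simp only [smul_smul, mul_inv_cancel₀ hμ.ne', one_smul, add_sub_cancel]

/-- If `x = ι u` solves the resolvent equation with datum `ι v`, then `‖ι v - x‖² = μ ⟨A u, v - u⟩ ≤
μ (Φ v - Φ u) ≤ μ Φ v`, which a small `μ` brings below `ε²`. -/
theorem IsSubgradientOperator.dense_fst_realizationGraph (hA : IsSubgradientOperator Φ A)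
    (hΦ : ∀ u, 0 ≤ Φ u) (hres : HasResolvents (realizationGraph ι A)) (hd : DenseRange ι) :
    Dense (Prod.fst '' realizationGraph ι A) := by
  suffices h : range ι ⊆ closure (Prod.fst '' realizationGraph ι A) by
    exact dense_closure.1 (hd.mono h)
  rintro _ ⟨v, rfl⟩
  rw [Metric.mem_closure_iff]
  intro ε hε
  have hv := hΦ v
  set μ : ℝ := ε ^ 2 / (Φ v + 1) with hμdef
  have hμ : 0 < μ := by positivity
  obtain ⟨⟨x, g⟩, ⟨u, hu, hg⟩, h⟩ := hres μ hμ (ι v)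
  simp only at hu hg h
  refine ⟨x, ⟨(x, g), ⟨u, hu, hg⟩, rfl⟩, ?_⟩
  rw [dist_eq_norm]
  refine lt_of_pow_lt_pow_left₀ 2 hε.le ?_
  have h1 : ι v - x = μ • g := by rw [← h, add_sub_cancel_left]
  have h2 : ‖ι v - x‖ ^ 2 = μ * A u (v - u) := by
    rw [hg, map_sub, hu, ← real_inner_self_eq_norm_sq]
    nth_rewrite 1 [h1]
    rw [inner_smul_left]
    simp
  have h3 := hA u v
  have h4 := hΦ u
  calc ‖ι v - x‖ ^ 2 ≤ μ * Φ v := by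
        rw [h2]; exact mul_le_mul_of_nonneg_left (by linarith) hμ.le
    _ < μ * (Φ v + 1) := by gcongr; linarith
    _ = ε ^ 2 := by rw [hμdef]; field_simp

/-- The realization of the subgradient of a uniformly convex functional is a maximal monotone
operator that generates a well-posed evolution equation. -/
theorem IsSubgradientOperator.realizationGraph_wellPosed [CompleteSpace V] [CompleteSpace H]
    (hA : IsSubgradientOperator Φ A) (hhem : IsHemicontinuousOperator A)
    (hconv : IsUniformlyConvexFunctional Φ) (hΦ : ∀ u, 0 ≤ Φ u) (hι : Continuous ι)
    (hinj : Function.Injective ι) (hd : DenseRange ι) :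
    IsOperatorGraph (realizationGraph ι A) ∧ IsMaximalMonotoneGraph (realizationGraph ι A) ∧
      IsWellPosed (realizationGraph ι A) := by
  have hres := hA.hasResolvents_realizationGraph hhem hconv hΦ hι
  have hmono := hA.isMonotoneOperator.isMonotoneGraph_realizationGraph (ι := ι)
  have hop := isOperatorGraph_realizationGraph (A := A) hinj hd
  exact ⟨hop, hres.isMaximalMonotoneGraph hmono,
    hres.isWellPosed hmono hop (hA.dense_fst_realizationGraph hΦ hres hd)⟩

end Potential

/-! ## Inequalities for powers of the norm -/

section PowerInequalities

theorem rpow_sub_two_mul_sq {s p : ℝ} (hs : 0 ≤ s) (hp : 2 ≤ p) : s ^ (p - 2) * s ^ 2 = s ^ p := by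
  rw [← Real.rpow_natCast s 2, ← Real.rpow_add_of_nonneg hs (by linarith) (by norm_num)]
  norm_num

/-- With `r = max(1, s, t)`, both terms are at most multiples of `r ^ p`, since `r ≥ 1` absorbs the
lower power. This growth bound dominates all the integrands below. -/
theorem rpow_sub_two_mul_le {s t η p : ℝ} (hs : 0 ≤ s) (ht : 0 ≤ t) (hη : 0 ≤ η) (hp : 2 ≤ p) :
    (s ^ (p - 2) + η) * (s * t) ≤ (1 + η) * (1 + s ^ p + t ^ p) := by
  set r := max 1 (max s t) with hr
  have h1 : 1 ≤ r := le_max_left _ _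
  have hsr : s ≤ r := (le_max_left _ _).trans (le_max_right _ _)
  have htr : t ≤ r := (le_max_right _ _).trans (le_max_right _ _)
  have h0 : 0 ≤ r := by linarith
  have hrp : r ^ p ≤ 1 + s ^ p + t ^ p := by
    have hsp := Real.rpow_nonneg hs p
    have htp := Real.rpow_nonneg ht p
    rcases max_choice 1 (max s t) with h | h
    · rw [hr, h, Real.one_rpow]; linarith
    · rcases max_choice s t with h' | h' <;> rw [hr, h, h'] <;> linarith
  have h2 : r ^ (p - 2) * r ^ 2 = r ^ p := rpow_sub_two_mul_sq h0 hp
  have h3 : r ^ 2 ≤ r ^ p := by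
    rw [← Real.rpow_natCast r 2]
    exact Real.rpow_le_rpow_of_exponent_le h1 (by exact_mod_cast hp)
  calc (s ^ (p - 2) + η) * (s * t) ≤ (r ^ (p - 2) + η) * (r * r) := by
        have := Real.rpow_le_rpow hs hsr (show 0 ≤ p - 2 by linarith)
        gcongr
    _ = r ^ p + η * r ^ 2 := by rw [← h2]; ring
    _ ≤ r ^ p + η * r ^ p := by gcongr
    _ = (1 + η) * r ^ p := by ring
    _ ≤ _ := by gcongr

variable {F : Type*} [NormedAddCommGroup F] [InnerProductSpace ℝ F]

/-- The subgradient inequality for `‖·‖ ^ p / p`. -/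
theorem norm_rpow_div_add_inner_le {p : ℝ} (hp : 2 ≤ p) (a b : F) :
    ‖a‖ ^ p / p + ‖a‖ ^ (p - 2) * inner ℝ a (b - a) ≤ ‖b‖ ^ p / p := by
  have hp0 : 0 < p := by linarith
  have ha := norm_nonneg a
  have hpq : p.HolderConjugate (p / (p - 1)) := Real.HolderConjugate.conjExponent (by linarith)
  -- Young's inequality for `‖b‖` and `‖a‖ ^ (p - 1)`, with exponents `p` and `p / (p - 1)`.
  have h1 := Real.young_inequality_of_nonneg (norm_nonneg b) (Real.rpow_nonneg ha (p - 1)) hpq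
  have h2 : (‖a‖ ^ (p - 1)) ^ (p / (p - 1)) = ‖a‖ ^ p := by
    rw [← Real.rpow_mul ha, mul_div_cancel₀ _ (by linarith)]
  have h3 : ‖a‖ ^ (p - 2) * ‖a‖ = ‖a‖ ^ (p - 1) := by
    rcases ha.eq_or_lt with h | h
    · rw [← h, mul_zero, Real.zero_rpow (by linarith)]
    · rw [← Real.rpow_add_one h.ne']; ring_nf
  have h4 : ‖a‖ ^ (p - 2) * inner ℝ a b ≤ ‖b‖ * ‖a‖ ^ (p - 1) := by
    rw [← h3]
    calc _ ≤ ‖a‖ ^ (p - 2) * (‖a‖ * ‖b‖) := by gcongr; exact real_inner_le_norm a b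
      _ = _ := by ring
  have h5 := rpow_sub_two_mul_sq ha hp
  rw [h2] at h1
  rw [inner_sub_right, real_inner_self_eq_norm_sq, mul_sub, h5]
  have h6 : ‖a‖ ^ p / (p / (p - 1)) = ‖a‖ ^ p - ‖a‖ ^ p / p := by
    field_simp
  rw [h6] at h1
  linarith

/-- Clarkson's inequality for exponents `p ≥ 2`. -/
theorem norm_rpow_half_add_le {p : ℝ} (hp : 2 ≤ p) (a b : F) :
    ‖(1 / 2 : ℝ) • (a + b)‖ ^ p + ‖(1 / 2 : ℝ) • (a - b)‖ ^ p ≤ (‖a‖ ^ p + ‖b‖ ^ p) / 2 := by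
  -- In an inner product space everything reduces to the parallelogram law: `t ^ (p / 2)` is
  -- superadditive, which joins the two left terms, and convex, which splits the right one.
  have hp1 : 1 ≤ p / 2 := by linarith
  have hsq : ∀ s : ℝ, 0 ≤ s → (s ^ 2) ^ (p / 2) = s ^ p := by
    intro s hs
    rw [← Real.rpow_natCast, ← Real.rpow_mul hs]
    congr 1
    push_cast
    ring
  have h1 := parallelogram_law_with_norm ℝ ((1 / 2 : ℝ) • (a + b)) ((1 / 2 : ℝ) • (a - b))
  have h2 : (1 / 2 : ℝ) • (a + b) + (1 / 2 : ℝ) • (a - b) = a := by module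
  have h3 : (1 / 2 : ℝ) • (a + b) - (1 / 2 : ℝ) • (a - b) = b := by module
  rw [h2, h3] at h1
  set x := ‖(1 / 2 : ℝ) • (a + b)‖
  set y := ‖(1 / 2 : ℝ) • (a - b)‖
  have hx : 0 ≤ x := norm_nonneg _
  have hy : 0 ≤ y := norm_nonneg _
  have h4 : (x ^ 2) ^ (p / 2) + (y ^ 2) ^ (p / 2) ≤ (x ^ 2 + y ^ 2) ^ (p / 2) := by
    have := NNReal.add_rpow_le_rpow_add ⟨x ^ 2, by positivity⟩ ⟨y ^ 2, by positivity⟩ hp1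
    exact_mod_cast this
  have h5 : x ^ 2 + y ^ 2 = (1 / 2) * ‖a‖ ^ 2 + (1 / 2) * ‖b‖ ^ 2 := by linarith
  have h6 := (convexOn_rpow hp1).2 (mem_Ici.2 (sq_nonneg ‖a‖)) (mem_Ici.2 (sq_nonneg ‖b‖))
    (show (0 : ℝ) ≤ 1 / 2 by norm_num) (show (0 : ℝ) ≤ 1 / 2 by norm_num) (by norm_num)
  simp only [smul_eq_mul] at h6
  rw [← h5, hsq _ (norm_nonneg a), hsq _ (norm_nonneg b)] at h6
  rw [hsq _ hx, hsq _ hy] at h4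
  linarith

end PowerInequalities

/-! ## Modular and norm -/

section Modular

variable {α : Type*} [MeasurableSpace α] {μ : Measure α} {p : VarExponent μ}
  {F : Type*} [NormedAddCommGroup F] [NormedSpace ℝ F]

theorem VarExponent.modular_smul_le_of_one_le {b c : ℝ} (hc : 1 ≤ c)
    (hb : ∀ᵐ x ∂μ, p.toFun x ≤ b) (f : α → F) :
    p.modular (fun x => c • f x) ≤ ENNReal.ofReal (c ^ b) * p.modular f := by
  unfold VarExponent.modular
  rw [← lintegral_const_mul' _ _ ENNReal.ofReal_ne_top]
  refine lintegral_mono_ae ?_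
  filter_upwards [p.one_le, hb] with x hx hxb
  rw [enorm_smul, ENNReal.mul_rpow_of_nonneg _ _ (by linarith), Real.enorm_of_nonneg (by linarith),
    ENNReal.ofReal_rpow_of_pos (by linarith)]
  gcongr

theorem VarExponent.modular_smul_le_of_le_one {b c : ℝ} (hc0 : 0 < c) (hc : c ≤ 1)
    (hb : ∀ᵐ x ∂μ, b ≤ p.toFun x) (f : α → F) :
    p.modular (fun x => c • f x) ≤ ENNReal.ofReal (c ^ b) * p.modular f := by
  unfold VarExponent.modular
  rw [← lintegral_const_mul' _ _ ENNReal.ofReal_ne_top]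
  refine lintegral_mono_ae ?_
  filter_upwards [p.one_le, hb] with x hx hxb
  rw [enorm_smul, ENNReal.mul_rpow_of_nonneg _ _ (by linarith), Real.enorm_of_nonneg hc0.le,
    ENNReal.ofReal_rpow_of_pos hc0]
  gcongr ENNReal.ofReal ?_ * _
  exact Real.rpow_le_rpow_of_exponent_ge hc0 hc hxb

namespace VarLp

theorem modular_le_one_of_norm_lt_one {f : VarLp p F} (h : ‖f‖ < 1) : p.modular f.toAE ≤ 1 := by
  obtain ⟨k, hk, hk1⟩ := exists_lt_of_csInf_lt (scalings_nonempty f) (by rwa [← norm_def])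
  have h1 := p.modular_smul_le (fun x => k⁻¹ • f.toAE x) hk.1.le hk1.le
  simp only [smul_smul, mul_inv_cancel₀ hk.1.ne', one_smul] at h1
  calc p.modular f.toAE ≤ ENNReal.ofReal k * 1 := h1.trans (by gcongr; exact hk.2)
    _ ≤ 1 := by rw [mul_one, ENNReal.ofReal_le_one]; exact hk1.le

theorem modular_smul_toAE (c : ℝ) (f : VarLp p F) :
    p.modular (c • f).toAE = p.modular (fun x => c • f.toAE x) :=
  p.modular_congr (AEEqFun.coeFn_smul c f.toAE)

theorem norm_le_of_modular_smul_le_one {f : VarLp p F} {ε : ℝ} (hε : 0 < ε)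
    (h : p.modular (fun x => ε⁻¹ • f.toAE x) ≤ 1) : ‖f‖ ≤ ε :=
  csInf_le (scalings_bddBelow f) ⟨hε, h⟩

/-- Convergence in modular implies convergence in norm. -/
theorem exists_norm_le_of_modular_le (p : VarExponent μ) {ε : ℝ} (hε : 0 < ε) :
    ∃ δ : ℝ, 0 < δ ∧ ∀ f : VarLp p F, (p.modular f.toAE).toReal ≤ δ → ‖f‖ ≤ ε := by
  obtain ⟨b, hb⟩ := p.bounded
  -- Capping at `1` makes `e⁻¹ ≥ 1`, so scaling by it multiplies the modular by at most `e⁻¹ ^ b`;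
  -- `δ` is the inverse of that factor.
  set e := min ε 1 with he
  have he0 : 0 < e := lt_min hε one_pos
  have he1 : 1 ≤ e⁻¹ := (one_le_inv₀ he0).2 (min_le_right _ _)
  refine ⟨((e⁻¹) ^ b)⁻¹, by positivity, fun f hf => ?_⟩
  refine (norm_le_of_modular_smul_le_one he0 ?_).trans (min_le_left _ _)
  refine (p.modular_smul_le_of_one_le he1 hb _).trans ?_
  rw [← ENNReal.ofReal_toReal f.modular_lt_top.ne, ← ENNReal.ofReal_mul (by positivity),
    ENNReal.ofReal_le_one]
  calc (e⁻¹) ^ b * (p.modular f.toAE).toReal ≤ (e⁻¹) ^ b * ((e⁻¹) ^ b)⁻¹ := by gcongr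
    _ = 1 := mul_inv_cancel₀ (by positivity)

/-- For `k ≥ 1`, dividing `f` by `k` shrinks the modular by at least `k²`. If `√(r + 1) < k < ‖f‖`,
with `r` the modular, then `f / k` has modular at most one, contradicting `k < ‖f‖`. This quadratic
growth is the source of coercivity. -/
theorem norm_sq_sub_one_le (h2 : ∀ᵐ x ∂μ, 2 ≤ p.toFun x) (f : VarLp p F) :
    ‖f‖ ^ 2 - 1 ≤ (p.modular f.toAE).toReal := by
  set r := (p.modular f.toAE).toReal with hr
  have hr0 : 0 ≤ r := ENNReal.toReal_nonneg
  by_contra! hlt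
  obtain ⟨k, hk, hkf⟩ := exists_between (show √(r + 1) < ‖f‖ by
    rw [Real.sqrt_lt' (by
      rcases (norm_nonneg f).eq_or_lt with h | h
      · rw [← h] at hlt; nlinarith
      · exact h)]
    linarith)
  have hk1 : 1 ≤ k := le_trans (by rw [Real.one_le_sqrt]; linarith) hk.le
  have hk0 : 0 < k := by linarith
  have hk2 : r + 1 < k ^ 2 := by rwa [Real.sqrt_lt' hk0] at hk
  refine absurd (norm_le_of_modular_smul_le_one (f := f) hk0 ?_) (not_le.2 hkf)
  refine (p.modular_smul_le_of_le_one (inv_pos.2 hk0) (inv_le_one_of_one_le₀ hk1) h2 _).trans ?_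
  rw [← ENNReal.ofReal_toReal f.modular_lt_top.ne, ← ENNReal.ofReal_mul (by positivity),
    ENNReal.ofReal_le_one, ← hr, Real.rpow_two, inv_pow, inv_mul_le_iff₀ (by positivity)]
  linarith

/-- Rescaling to norm `1/2`, rather than `1`, puts the modular below one; hence the factor `2`. -/
theorem continuous_of_bound_of_modular_le_one {E : Type*} [NormedAddCommGroup E]
    [NormedSpace ℝ E] (T : VarLp p F →ₗ[ℝ] E) (C : ℝ)
    (h : ∀ f : VarLp p F, p.modular f.toAE ≤ 1 → ‖T f‖ ≤ C) : Continuous T := by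
  refine AddMonoidHomClass.continuous_of_bound T (2 * C) fun f => ?_
  rcases eq_or_ne f 0 with rfl | hf
  · simp
  have hf0 : 0 < ‖f‖ := norm_pos_iff.2 hf
  have h1 : ‖(2 * ‖f‖)⁻¹ • f‖ < 1 := by
    rw [norm_smul, norm_inv, Real.norm_of_nonneg (by positivity)]
    field_simp
    norm_num
  have h2 := h _ (modular_le_one_of_norm_lt_one h1)
  rw [map_smul, norm_smul, norm_inv, Real.norm_of_nonneg (by positivity),
    inv_mul_le_iff₀ (by positivity)] at h2
  linarith

theorem aemeasurable_norm_rpow (f : VarLp p F) :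
    AEMeasurable (fun x => ‖f.toAE x‖ ^ p.toFun x) μ :=
  f.toAE.aestronglyMeasurable.norm.aemeasurable.pow p.aemeasurable

theorem modular_eq_lintegral_ofReal {E : Type*} [NormedAddCommGroup E] (p : VarExponent μ)
    (f : α → E) :
    p.modular f = ∫⁻ x, ENNReal.ofReal (‖f x‖ ^ p.toFun x) ∂μ := by
  refine lintegral_congr_ae ?_
  filter_upwards [p.one_le] with x hx
  rw [← ofReal_norm, ENNReal.ofReal_rpow_of_nonneg (norm_nonneg _) (by linarith)]

theorem integrable_norm_rpow (f : VarLp p F) :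
    Integrable (fun x => ‖f.toAE x‖ ^ p.toFun x) μ := by
  refine ⟨f.aemeasurable_norm_rpow.aestronglyMeasurable, ?_⟩
  rw [hasFiniteIntegral_iff_ofReal (Eventually.of_forall fun x => by positivity),
    ← modular_eq_lintegral_ofReal]
  exact f.modular_lt_top

theorem integral_norm_rpow (f : VarLp p F) :
    ∫ x, ‖f.toAE x‖ ^ p.toFun x ∂μ = (p.modular f.toAE).toReal := by
  rw [integral_eq_lintegral_of_nonneg_ae (Eventually.of_forall fun x => by positivity)
    f.aemeasurable_norm_rpow.aestronglyMeasurable, ← modular_eq_lintegral_ofReal]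

theorem integral_norm_rpow_le_one {f : VarLp p F} (h : p.modular f.toAE ≤ 1) :
    ∫ x, ‖f.toAE x‖ ^ p.toFun x ∂μ ≤ 1 := by
  rw [integral_norm_rpow]
  exact ENNReal.toReal_le_of_le_ofReal zero_le_one (by simpa using h)

variable [IsFiniteMeasure μ]

theorem toL2_norm_sq_le (h2 : ∀ᵐ x ∂μ, 2 ≤ p.toFun x) (f : VarLp p F) :
    ‖toL2 h2 f‖ ^ 2 ≤ μ.real univ + ∫ x, ‖f.toAE x‖ ^ p.toFun x ∂μ := by
  have h1 : ‖toL2 h2 f‖ ^ 2 = ∫ x, ‖f.toAE x‖ ^ 2 ∂μ := by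
    have h := Lp.norm_toLp f.toAE (memLp_two h2 f)
    have h' := (memLp_two h2 f).eLpNorm_eq_integral_rpow_norm (by norm_num) (by norm_num)
    change ‖(memLp_two h2 f).toLp _‖ ^ 2 = _
    have h0 : 0 ≤ ∫ x, ‖f.toAE x‖ ^ 2 ∂μ := integral_nonneg fun x => by positivity
    simp only [ENNReal.toReal_ofNat, Real.rpow_two] at h'
    rw [h, h', ENNReal.toReal_ofReal (by positivity), ← Real.rpow_natCast, ← Real.rpow_mul h0]
    norm_num
  rw [h1]
  have h3 : μ.real univ + ∫ x, ‖f.toAE x‖ ^ p.toFun x ∂μ =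
      ∫ x, (1 + ‖f.toAE x‖ ^ p.toFun x) ∂μ := by
    rw [integral_add (integrable_const _) f.integrable_norm_rpow]
    simp
  rw [h3]
  refine integral_mono_of_nonneg (Eventually.of_forall fun x => by positivity)
    ((integrable_const _).add f.integrable_norm_rpow) ?_
  filter_upwards [h2] with x hx
  rcases le_total ‖f.toAE x‖ 1 with h | h
  · have : ‖f.toAE x‖ ^ 2 ≤ 1 := pow_le_one₀ (norm_nonneg _) h
    have : 0 ≤ ‖f.toAE x‖ ^ p.toFun x := by positivity
    linarith
  · have : ‖f.toAE x‖ ^ (2 : ℝ) ≤ ‖f.toAE x‖ ^ p.toFun x :=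
      Real.rpow_le_rpow_of_exponent_le h hx
    rw [Real.rpow_two] at this
    linarith

theorem continuous_toL2 (h2 : ∀ᵐ x ∂μ, 2 ≤ p.toFun x) :
    Continuous (toL2 h2 : VarLp p F →ₗ[ℝ] Lp F 2 μ) := by
  refine continuous_of_bound_of_modular_le_one _ √(μ.real univ + 1) fun f hf => ?_
  refine Real.le_sqrt_of_sq_le ((toL2_norm_sq_le h2 f).trans ?_)
  gcongr
  exact integral_norm_rpow_le_one hf

theorem coeFn_toL2 (h2 : ∀ᵐ x ∂μ, 2 ≤ p.toFun x) (f : VarLp p F) :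
    toL2 h2 f =ᵐ[μ] f.toAE := MemLp.coeFn_toLp (memLp_two h2 f)

/-- The limit is found in `L²`, where a subsequence converges a.e.; Fatou's lemma for the modular
then upgrades the convergence to the Luxemburg norm. -/
theorem completeSpace [CompleteSpace F] (h2 : ∀ᵐ x ∂μ, 2 ≤ p.toFun x) :
    CompleteSpace (VarLp p F) := by
  refine Metric.complete_of_cauchySeq_tendsto fun f hf => ?_
  let T : VarLp p F →L[ℝ] Lp F 2 μ := ⟨toL2 h2, continuous_toL2 h2⟩
  obtain ⟨g, hg⟩ := cauchySeq_tendsto_of_complete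
    (T.uniformContinuous.comp_cauchySeq hf)
  obtain ⟨ns, hns, hae⟩ := (tendstoInMeasure_of_tendsto_Lp hg).exists_seq_tendsto_ae
  have hae' : ∀ᵐ x ∂μ, Tendsto (fun j => (f (ns j)).toAE x) atTop (𝓝 (g x)) := by
    have h1 : ∀ᵐ x ∂μ, ∀ j, (toL2 h2 (f (ns j)) : α → F) x = (f (ns j)).toAE x :=
      ae_all_iff.2 fun j => coeFn_toL2 h2 _
    filter_upwards [hae, h1] with x hx hx1
    simpa only [← hx1] using (show Tendsto (fun j => toL2 h2 (f (ns j)) x) atTop (𝓝 (g x)) from hx)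
  have key : ∀ ε : ℝ, 0 < ε → ∃ N, ∀ n ≥ N,
      p.modular (fun x => ε⁻¹ • ((f n).toAE - g.1 : α →ₘ[μ] F) x) ≤ 1 := by
    intro ε hε
    obtain ⟨N, hN⟩ := Metric.cauchySeq_iff.1 hf ε hε
    refine ⟨N, fun n hn => ?_⟩
    have h1 : ∀ m ≥ N, p.modular (fun x => ε⁻¹ • ((f n).toAE x - (f m).toAE x)) ≤ 1 := by
      intro m hm
      have h3 := hN n hn m hm
      rw [dist_eq_norm] at h3
      have h4 : ‖ε⁻¹ • (f n - f m)‖ < 1 := by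
        rw [norm_smul, norm_inv, Real.norm_of_nonneg hε.le, inv_mul_lt_iff₀ hε, mul_one]
        exact h3
      refine le_trans (le_of_eq ?_) (modular_le_one_of_norm_lt_one h4)
      rw [modular_smul_toAE]
      refine p.modular_congr ?_
      filter_upwards [AEEqFun.coeFn_sub (f n).toAE (f m).toAE] with x hx
      have h5 : (f n - f m).toAE x = (f n).toAE x - (f m).toAE x := hx
      rw [h5]
    have h2 : p.modular (fun x => ε⁻¹ • ((f n).toAE - g.1 : α →ₘ[μ] F) x) ≤
        liminf (fun j => p.modular (fun x => ε⁻¹ • ((f n).toAE x - (f (ns j)).toAE x))) atTop := by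
      refine le_trans (lintegral_mono_ae ?_) (lintegral_liminf_le' fun j =>
        p.aemeasurable_integrand (((f n).toAE.aestronglyMeasurable.sub
          (f (ns j)).toAE.aestronglyMeasurable).const_smul ε⁻¹))
      filter_upwards [AEEqFun.coeFn_sub (f n).toAE g.1, hae', p.one_le] with x hx hx' hp
      refine le_of_eq (Tendsto.liminf_eq ?_).symm
      rw [hx]
      exact ((ENNReal.continuous_rpow_const (y := p.toFun x)).tendsto _).comp
        ((continuous_enorm.tendsto _).comp ((tendsto_const_nhds.sub hx').const_smul ε⁻¹))
    refine h2.trans ?_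
    refine liminf_le_of_le (by isBoundedDefault) fun b hb => ?_
    obtain ⟨j, hj, hj'⟩ := (hb.and (hns.tendsto_atTop.eventually_ge_atTop N)).exists
    exact hj.trans (h1 _ hj')
  have hmem : ∀ n, ∀ ε : ℝ, 0 < ε → p.modular (fun x => ε⁻¹ • ((f n).toAE - g.1 : α →ₘ[μ] F) x) ≤ 1 →
      (f n).toAE - g.1 ∈ varLpSubmodule p F := by
    intro n ε hε h
    have h1 := p.modular_smul_lt_top ε (h.trans_lt ENNReal.one_lt_top)
    change p.modular ((f n).toAE - g.1 : α →ₘ[μ] F) < ⊤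
    simpa only [smul_smul, mul_inv_cancel₀ hε.ne', one_smul] using h1
  obtain ⟨N₀, hN₀⟩ := key 1 one_pos
  -- The Fatou bound first shows that `f N₀ - g` lies in the space, and hence so does `g`.
  have hg0 : g.1 ∈ varLpSubmodule p F := by
    have h := (varLpSubmodule p F).sub_mem (f N₀).2 (hmem N₀ 1 one_pos (hN₀ N₀ le_rfl))
    have h' : (f N₀).1 - ((f N₀).toAE - g.1) = g.1 := sub_sub_cancel _ _
    rwa [h'] at h
  let g' : VarLp p F := (⟨g.1, hg0⟩ : varLpSubmodule p F)
  refine ⟨g', Metric.tendsto_atTop.2 fun ε hε => ?_⟩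
  obtain ⟨N, hN⟩ := key (ε / 2) (by positivity)
  refine ⟨N, fun n hn => ?_⟩
  rw [dist_eq_norm]
  refine lt_of_le_of_lt (norm_le_of_modular_smul_le_one (f := f n - g') (half_pos hε) (hN n hn)) (by linarith)

end VarLp

end Modular

/-! ## Weighted duality maps and energies on variable exponent spaces -/

section Duality

variable {α : Type*} [MeasurableSpace α] {μ : Measure α} {p : VarExponent μ}

/-- A measurable weight with values in `[0, M]`. -/
structure IsBoundedWeight (μ : Measure α) (a : α → ℝ) (M : ℝ) : Prop where
  aemeasurable : AEMeasurable a μ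
  nonneg : ∀ᵐ x ∂μ, 0 ≤ a x
  le : ∀ᵐ x ∂μ, a x ≤ M

namespace VarLp

section Coe

variable {F : Type*} [NormedAddCommGroup F] [NormedSpace ℝ F]

theorem coeFn_add (f g : VarLp p F) : (f + g).toAE =ᵐ[μ] fun x => f.toAE x + g.toAE x :=
  AEEqFun.coeFn_add f.toAE g.toAE

theorem coeFn_sub (f g : VarLp p F) : (f - g).toAE =ᵐ[μ] fun x => f.toAE x - g.toAE x :=
  AEEqFun.coeFn_sub f.toAE g.toAE

theorem coeFn_smul (c : ℝ) (f : VarLp p F) : (c • f).toAE =ᵐ[μ] fun x => c • f.toAE x :=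
  AEEqFun.coeFn_smul c f.toAE

end Coe

variable {F : Type*} [NormedAddCommGroup F] [InnerProductSpace ℝ F] {a : α → ℝ} {M η : ℝ}

/-- The integrand of `⟨T u, v⟩ = ∫ a (|u|^{p(x)-2} + η) u·v`. -/
noncomputable def dualityIntegrand (a : α → ℝ) (η : ℝ) (u v : VarLp p F) (x : α) : ℝ :=
  a x * (‖u.toAE x‖ ^ (p.toFun x - 2) + η) * inner ℝ (u.toAE x) (v.toAE x)

/-- The integrand of the potential of the weighted duality map. -/
noncomputable def energyIntegrand (a : α → ℝ) (η : ℝ) (u : VarLp p F) (x : α) : ℝ :=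
  a x * (‖u.toAE x‖ ^ p.toFun x / p.toFun x + η / 2 * ‖u.toAE x‖ ^ 2)

/-- The potential `∫ a (|u|^{p(x)} / p(x) + η |u|² / 2)` of the weighted duality map. -/
noncomputable def energy (a : α → ℝ) (η : ℝ) (u : VarLp p F) : ℝ :=
  ∫ x, energyIntegrand a η u x ∂μ

theorem abs_dualityIntegrand_le (ha : IsBoundedWeight μ a M) (hη : 0 ≤ η)
    (h2 : ∀ᵐ x ∂μ, 2 ≤ p.toFun x) (u v : VarLp p F) :
    ∀ᵐ x ∂μ, |dualityIntegrand a η u v x| ≤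
      M * ((1 + η) * (1 + ‖u.toAE x‖ ^ p.toFun x + ‖v.toAE x‖ ^ p.toFun x)) := by
  filter_upwards [ha.nonneg, ha.le, h2] with x h0 hM hp
  rw [dualityIntegrand, abs_mul, abs_mul, abs_of_nonneg h0, abs_of_nonneg (by positivity), mul_assoc]
  refine mul_le_mul hM ?_ (by positivity) (h0.trans hM)
  refine le_trans ?_ (rpow_sub_two_mul_le (norm_nonneg _) (norm_nonneg _) hη hp)
  gcongr
  exact abs_real_inner_le_norm _ _

theorem aestronglyMeasurable_dualityIntegrand (ha : AEMeasurable a μ) (u v : VarLp p F) :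
    AEStronglyMeasurable (dualityIntegrand a η u v) μ :=
  ((ha.mul ((u.toAE.aestronglyMeasurable.norm.aemeasurable.pow
    (p.aemeasurable.sub_const 2)).add_const η)).aestronglyMeasurable).mul
    (u.toAE.aestronglyMeasurable.inner v.toAE.aestronglyMeasurable)

theorem energy_nonneg (ha : IsBoundedWeight μ a M) (hη : 0 ≤ η)
    (h2 : ∀ᵐ x ∂μ, 2 ≤ p.toFun x) (u : VarLp p F) : 0 ≤ energy a η u := by
  refine integral_nonneg_of_ae ?_
  filter_upwards [ha.nonneg, h2] with x h0 hp
  have h3 : 0 ≤ ‖u.toAE x‖ ^ p.toFun x / p.toFun x :=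
    div_nonneg (by positivity) (by linarith)
  exact mul_nonneg h0 (by positivity)

variable [IsFiniteMeasure μ]

theorem integrable_growth (u v : VarLp p F) (C : ℝ) :
    Integrable (fun x => C * ((1 + η) *
      (1 + ‖u.toAE x‖ ^ p.toFun x + ‖v.toAE x‖ ^ p.toFun x))) μ :=
  ((((integrable_const 1).add u.integrable_norm_rpow).add
    v.integrable_norm_rpow).const_mul (1 + η)).const_mul C

theorem integrable_dualityIntegrand (ha : IsBoundedWeight μ a M) (hη : 0 ≤ η)
    (h2 : ∀ᵐ x ∂μ, 2 ≤ p.toFun x) (u v : VarLp p F) :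
    Integrable (dualityIntegrand a η u v) μ :=
  (integrable_growth u v M).mono' (aestronglyMeasurable_dualityIntegrand ha.aemeasurable u v)
    (abs_dualityIntegrand_le ha hη h2 u v)

theorem integrable_energyIntegrand (ha : IsBoundedWeight μ a M) (hη : 0 ≤ η)
    (h2 : ∀ᵐ x ∂μ, 2 ≤ p.toFun x) (u : VarLp p F) :
    Integrable (energyIntegrand a η u) μ := by
  refine (integrable_growth (η := η) u u M).mono' ?_ ?_
  · exact (ha.aemeasurable.mul ((u.aemeasurable_norm_rpow.div p.aemeasurable).add
      ((u.toAE.aestronglyMeasurable.norm.aemeasurable.pow_const 2).const_mul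
        (η / 2)))).aestronglyMeasurable
  · filter_upwards [ha.nonneg, ha.le, h2] with x h0 hM hp
    have h1 := rpow_sub_two_mul_le (norm_nonneg (u.toAE x)) (norm_nonneg (u.toAE x)) hη hp
    rw [← sq, add_mul, rpow_sub_two_mul_sq (norm_nonneg _) hp] at h1
    have h3 : 0 ≤ ‖u.toAE x‖ ^ p.toFun x := by positivity
    have h4 : ‖u.toAE x‖ ^ p.toFun x / p.toFun x ≤ ‖u.toAE x‖ ^ p.toFun x :=
      div_le_self h3 (by linarith)
    have h5 : 0 ≤ η * ‖u.toAE x‖ ^ 2 := by positivity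
    have h6 : 0 ≤ ‖u.toAE x‖ ^ p.toFun x / p.toFun x := div_nonneg h3 (by linarith)
    rw [energyIntegrand, Real.norm_of_nonneg (mul_nonneg h0 (by positivity))]
    exact mul_le_mul hM (by linarith) (by positivity) (h0.trans hM)

/-- The weighted duality map, as a linear functional, `⟨T u, v⟩ = ∫ a (|u|^{p(x)-2} + η) u·v`. -/
noncomputable def dualityLinear (ha : IsBoundedWeight μ a M) (hη : 0 ≤ η)
    (h2 : ∀ᵐ x ∂μ, 2 ≤ p.toFun x) (u : VarLp p F) : VarLp p F →ₗ[ℝ] ℝ where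
  toFun v := ∫ x, dualityIntegrand a η u v x ∂μ
  map_add' v w := by
    rw [← integral_add (integrable_dualityIntegrand ha hη h2 u v)
      (integrable_dualityIntegrand ha hη h2 u w)]
    refine integral_congr_ae ?_
    filter_upwards [coeFn_add v w] with x hx
    simp only [dualityIntegrand, hx, inner_add_right, mul_add]
  map_smul' c v := by
    rw [RingHom.id_apply, smul_eq_mul, ← integral_const_mul]
    refine integral_congr_ae ?_
    filter_upwards [coeFn_smul c v] with x hx
    simp only [dualityIntegrand, hx, inner_smul_right]
    ring

theorem continuous_dualityLinear (ha : IsBoundedWeight μ a M) (hη : 0 ≤ η)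
    (h2 : ∀ᵐ x ∂μ, 2 ≤ p.toFun x) (u : VarLp p F) : Continuous (dualityLinear ha hη h2 u) := by
  refine continuous_of_bound_of_modular_le_one _
    (∫ x, |M| * ((1 + η) * (1 + ‖u.toAE x‖ ^ p.toFun x)) ∂μ + |M| * (1 + η)) fun v hv => ?_
  have h1 := integrable_growth (η := η) u v |M|
  have h3 : Integrable (fun x => |M| * ((1 + η) * (1 + ‖u.toAE x‖ ^ p.toFun x))) μ :=
    (((integrable_const 1).add u.integrable_norm_rpow).const_mul (1 + η)).const_mul |M|
  have h4 : Integrable (fun x => |M| * ((1 + η) * ‖v.toAE x‖ ^ p.toFun x)) μ :=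
    (v.integrable_norm_rpow.const_mul (1 + η)).const_mul |M|
  refine (norm_integral_le_of_norm_le h1 ?_).trans ?_
  · filter_upwards [abs_dualityIntegrand_le ha hη h2 u v] with x hx
    refine hx.trans ?_
    gcongr
    exact le_abs_self M
  · have h5 : ∫ x, |M| * ((1 + η) * (1 + ‖u.toAE x‖ ^ p.toFun x + ‖v.toAE x‖ ^ p.toFun x)) ∂μ =
        ∫ x, |M| * ((1 + η) * (1 + ‖u.toAE x‖ ^ p.toFun x)) ∂μ +
          |M| * ((1 + η) * ∫ x, ‖v.toAE x‖ ^ p.toFun x ∂μ) := by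
      rw [← integral_const_mul, ← integral_const_mul, ← integral_add h3 h4]
      congr 1
      funext x
      ring
    rw [h5]
    gcongr
    have := integral_norm_rpow_le_one hv
    calc (1 + η) * ∫ x, ‖v.toAE x‖ ^ p.toFun x ∂μ ≤ (1 + η) * 1 := by gcongr
      _ = _ := mul_one _

/-- The weighted duality map `⟨T u, v⟩ = ∫ a (|u|^{p(x)-2} + η) u·v`. -/
noncomputable def duality (ha : IsBoundedWeight μ a M) (hη : 0 ≤ η)
    (h2 : ∀ᵐ x ∂μ, 2 ≤ p.toFun x) (u : VarLp p F) : StrongDual ℝ (VarLp p F) :=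
  ⟨dualityLinear ha hη h2 u, continuous_dualityLinear ha hη h2 u⟩

theorem duality_apply (ha : IsBoundedWeight μ a M) (hη : 0 ≤ η)
    (h2 : ∀ᵐ x ∂μ, 2 ≤ p.toFun x) (u v : VarLp p F) :
    duality ha hη h2 u v = ∫ x, dualityIntegrand a η u v x ∂μ := rfl

/-- The inequality holds pointwise: the power part is `norm_rpow_div_add_inner_le`, the quadratic
part expands with a nonnegative remainder, and the weight is nonnegative. -/
theorem isSubgradientOperator_duality (ha : IsBoundedWeight μ a M) (hη : 0 ≤ η)
    (h2 : ∀ᵐ x ∂μ, 2 ≤ p.toFun x) :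
    IsSubgradientOperator (energy a η) (duality ha hη h2 : VarLp p F → _) := by
  intro u v
  rw [duality_apply, energy, energy, ← integral_add (integrable_energyIntegrand ha hη h2 u)
    (integrable_dualityIntegrand ha hη h2 u (v - u))]
  refine integral_mono_ae ((integrable_energyIntegrand ha hη h2 u).add
    (integrable_dualityIntegrand ha hη h2 u (v - u))) (integrable_energyIntegrand ha hη h2 v) ?_
  filter_upwards [ha.nonneg, h2, coeFn_sub v u] with x h0 hp hx
  simp only [energyIntegrand, dualityIntegrand, hx]
  have h1 := norm_rpow_div_add_inner_le hp (u.toAE x) (v.toAE x)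
  have h3 : ‖v.toAE x‖ ^ 2 = ‖u.toAE x‖ ^ 2 +
      2 * inner ℝ (u.toAE x) (v.toAE x - u.toAE x) + ‖v.toAE x - u.toAE x‖ ^ 2 := by
    rw [← norm_add_sq_real]; congr 2; abel
  have h4 := mul_nonneg (mul_nonneg h0 hη) (sq_nonneg ‖v.toAE x - u.toAE x‖)
  have h5 := mul_le_mul_of_nonneg_left h1 h0
  rw [h3]
  linarith

/-- Dominated convergence on the line `u + t v`. The dominating function must not depend on `t`;
convexity of the norm supplies it from the two points `u ± r v`. -/
theorem isHemicontinuousOperator_duality (ha : IsBoundedWeight μ a M) (hη : 0 ≤ η)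
    (h2 : ∀ᵐ x ∂μ, 2 ≤ p.toFun x) :
    IsHemicontinuousOperator (duality ha hη h2 : VarLp p F → _) := by
  intro u v w
  simp only [duality_apply]
  refine continuous_iff_continuousAt.2 fun t₀ => ?_
  -- `t₀` is interior to `[-r, r]`, so the bound holds in a neighbourhood of `t₀`.
  set r := |t₀| + 1 with hr
  have hr0 : 0 < r := by positivity
  set y₁ := u + r • v
  set y₂ := u + (-r) • v
  have hadd : ∀ t : ℝ, (u + t • v).toAE =ᵐ[μ] fun x => u.toAE x + t • v.toAE x := by
    intro t
    filter_upwards [coeFn_add u (t • v), coeFn_smul t v] with x h1 h3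
    rw [h1, h3]
  have hint : ∀ t : ℝ, ∫ x, dualityIntegrand a η (u + t • v) w x ∂μ =
      ∫ x, a x * (‖u.toAE x + t • v.toAE x‖ ^ (p.toFun x - 2) + η) *
        inner ℝ (u.toAE x + t • v.toAE x) (w.toAE x) ∂μ := by
    intro t
    refine integral_congr_ae ?_
    filter_upwards [hadd t] with x hx
    rw [dualityIntegrand, hx]
  simp only [hint]
  refine continuousAt_of_dominated
    (bound := fun x => M * ((1 + η) * (1 + ‖y₁.toAE x‖ ^ p.toFun x + ‖w.toAE x‖ ^ p.toFun x)) +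
      M * ((1 + η) * (1 + ‖y₂.toAE x‖ ^ p.toFun x + ‖w.toAE x‖ ^ p.toFun x)))
    (Eventually.of_forall fun t => ?_) ?_
    ((integrable_growth y₁ w M).add (integrable_growth y₂ w M)) ?_
  · refine (aestronglyMeasurable_dualityIntegrand (η := η) ha.aemeasurable (u + t • v) w).congr ?_
    filter_upwards [hadd t] with x hx
    rw [dualityIntegrand, hx]
  · filter_upwards [Icc_mem_nhds (show -r < t₀ by have := neg_abs_le t₀; linarith)
      (show t₀ < r by have := le_abs_self t₀; linarith)] with t ht
    filter_upwards [abs_dualityIntegrand_le ha hη h2 (u + t • v) w, hadd t, hadd r, hadd (-r), h2,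
      ha.nonneg, ha.le] with x hx ht' h1 h3 hp ha0 haM
    rw [dualityIntegrand, ht'] at hx
    refine hx.trans ?_
    have hM : 0 ≤ M := ha0.trans haM
    have hle : ‖u.toAE x + t • v.toAE x‖ ≤ max ‖y₁.toAE x‖ ‖y₂.toAE x‖ := by
      rw [h1, h3]
      have hconv : ConvexOn ℝ univ fun s : ℝ => ‖u.toAE x + s • v.toAE x‖ := by
        have h4 : ConvexOn ℝ univ (norm : F → ℝ) := convexOn_univ_norm
        have h5 := h4.comp_affineMap (AffineMap.lineMap (u.toAE x) (u.toAE x + v.toAE x))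
        simpa [Function.comp_def, AffineMap.lineMap_apply, add_comm] using h5
      rw [max_comm]
      exact hconv.le_max_of_mem_Icc (mem_univ _) (mem_univ _) ht
    have hp0 : 0 ≤ p.toFun x := by linarith
    have hpow : ‖u.toAE x + t • v.toAE x‖ ^ p.toFun x ≤
        ‖y₁.toAE x‖ ^ p.toFun x + ‖y₂.toAE x‖ ^ p.toFun x := by
      refine (Real.rpow_le_rpow (norm_nonneg _) hle hp0).trans ?_
      have h6 : 0 ≤ ‖y₁.toAE x‖ ^ p.toFun x := by positivity
      have h7 : 0 ≤ ‖y₂.toAE x‖ ^ p.toFun x := by positivity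
      rcases max_choice ‖y₁.toAE x‖ ‖y₂.toAE x‖ with h | h <;> rw [h] <;> linarith
    have h8 : 0 ≤ ‖w.toAE x‖ ^ p.toFun x := by positivity
    rw [← mul_add, ← mul_add]
    exact mul_le_mul_of_nonneg_left
      (mul_le_mul_of_nonneg_left (by linarith) (by linarith)) hM
  · filter_upwards [h2] with x hp
    have h1 : Continuous fun t : ℝ => ‖u.toAE x + t • v.toAE x‖ := by fun_prop
    have h3 : Continuous fun t : ℝ => ‖u.toAE x + t • v.toAE x‖ ^ (p.toFun x - 2) :=
      h1.rpow_const fun t => Or.inr (by linarith)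
    have h4 : Continuous fun t : ℝ => inner ℝ (u.toAE x + t • v.toAE x) (w.toAE x) := by fun_prop
    exact ((continuous_const.mul (h3.add continuous_const)).mul h4).continuousAt

/-- The alternative in `hc` admits a weight that vanishes where `u` vanishes, as needed for `λ = 0`.
-/
theorem mul_modular_le_duality_self (ha : IsBoundedWeight μ a M) (hη : 0 ≤ η)
    (h2 : ∀ᵐ x ∂μ, 2 ≤ p.toFun x) {c : ℝ} (u : VarLp p F)
    (hc : ∀ᵐ x ∂μ, c ≤ a x ∨ u.toAE x = 0) :
    c * (p.modular u.toAE).toReal ≤ duality ha hη h2 u u := by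
  rw [duality_apply, ← integral_norm_rpow, ← integral_const_mul]
  refine integral_mono_ae (u.integrable_norm_rpow.const_mul c)
    (integrable_dualityIntegrand ha hη h2 u u) ?_
  filter_upwards [hc, h2, ha.nonneg] with x hx hp h0
  simp only [dualityIntegrand, real_inner_self_eq_norm_sq]
  rcases hx with hx | hx
  · have h1 := rpow_sub_two_mul_sq (norm_nonneg (u.toAE x)) hp
    have h3 : 0 ≤ a x * (η * ‖u.toAE x‖ ^ 2) := by positivity
    have h4 : c * ‖u.toAE x‖ ^ p.toFun x ≤ a x * ‖u.toAE x‖ ^ p.toFun x := by gcongr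
    rw [mul_assoc, add_mul, h1, mul_add]
    linarith
  · rw [hx, norm_zero, Real.zero_rpow (by linarith)]
    simp

/-- Clarkson's inequality, multiplied by `a / p(x)` and integrated; `p(x) ≤ b` turns the coefficient
into `c / b`. The quadratic part enters only through its convexity. -/
theorem mul_modular_le_energy_gap (ha : IsBoundedWeight μ a M) (hη : 0 ≤ η)
    (h2 : ∀ᵐ x ∂μ, 2 ≤ p.toFun x) {b c : ℝ} (hb : ∀ᵐ x ∂μ, p.toFun x ≤ b)
    (u v : VarLp p F) (hc : ∀ᵐ x ∂μ, c ≤ a x ∨ (u - v).toAE x = 0) :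
    c / b * (p.modular ((1 / 2 : ℝ) • (u - v)).toAE).toReal ≤
      (energy a η u + energy a η v) / 2 - energy a η ((1 / 2 : ℝ) • (u + v)) := by
  set w := (1 / 2 : ℝ) • (u + v)
  set z := (1 / 2 : ℝ) • (u - v)
  have hiu := integrable_energyIntegrand ha hη h2 u
  have hiv := integrable_energyIntegrand ha hη h2 v
  have hiw := integrable_energyIntegrand ha hη h2 w
  have hgap : (energy a η u + energy a η v) / 2 - energy a η w =
      ∫ x, ((energyIntegrand a η u x + energyIntegrand a η v x) / 2 -
        energyIntegrand a η w x) ∂μ := by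
    have hs : Integrable (fun x => (energyIntegrand a η u x + energyIntegrand a η v x) / 2) μ :=
      (hiu.add hiv).div_const 2
    rw [integral_sub hs hiw, integral_div, integral_add hiu hiv]
    rfl
  rw [hgap, ← integral_norm_rpow, ← integral_const_mul]
  refine integral_mono_ae (z.integrable_norm_rpow.const_mul _)
    (((hiu.add hiv).div_const 2).sub hiw) ?_
  filter_upwards [hc, h2, hb, ha.nonneg, coeFn_smul (1 / 2) (u + v), coeFn_add u v,
    coeFn_smul (1 / 2) (u - v), coeFn_sub u v] with x hx hp hpb h0 h3 h4 h5 h6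
  have hz : c / b * ‖z.toAE x‖ ^ p.toFun x ≤ a x * (‖z.toAE x‖ ^ p.toFun x / p.toFun x) := by
    rcases hx with hx | hx
    · rw [div_mul_eq_mul_div, mul_div_assoc]
      have : 0 ≤ ‖z.toAE x‖ ^ p.toFun x := by positivity
      have : 0 < p.toFun x := by linarith
      have : 0 < b := by linarith
      gcongr
    · have : z.toAE x = 0 := by rw [h5, hx, smul_zero]
      rw [this, norm_zero, Real.zero_rpow (by linarith)]
      simp
  refine hz.trans ?_
  have hw : w.toAE x = (1 / 2 : ℝ) • (u.toAE x + v.toAE x) := by rw [h3, h4]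
  have hz' : z.toAE x = (1 / 2 : ℝ) • (u.toAE x - v.toAE x) := by rw [h5, h6]
  simp only [energyIntegrand, hw, hz']
  have h7 := norm_rpow_half_add_le hp (u.toAE x) (v.toAE x)
  have hp0 : 0 < p.toFun x := by linarith
  have h8 : ‖(1 / 2 : ℝ) • (u.toAE x + v.toAE x)‖ ^ 2 ≤ (‖u.toAE x‖ ^ 2 + ‖v.toAE x‖ ^ 2) / 2 := by
    have h9 := parallelogram_law_with_norm ℝ (u.toAE x) (v.toAE x)
    rw [norm_smul, mul_pow, Real.norm_of_nonneg (by norm_num)]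
    nlinarith [norm_nonneg (u.toAE x - v.toAE x)]
  have h10 := mul_le_mul_of_nonneg_left h7 (mul_nonneg h0 (inv_nonneg.2 hp0.le))
  have h11 := mul_le_mul_of_nonneg_left h8 (mul_nonneg h0 (show 0 ≤ η / 2 by positivity))
  simp only [div_eq_mul_inv] at h10 h11 ⊢
  linarith

end VarLp

end Duality

/-! ## Completeness of variable exponent Sobolev spaces, weak gradients and test functions -/

namespace VarLp

variable {α : Type*} [MeasurableSpace α] {μ : Measure α} {p : VarExponent μ} [IsFiniteMeasure μ]

theorem inner_toLp_toL2 {F : Type*} [NormedAddCommGroup F] [InnerProductSpace ℝ F]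
    (h2 : ∀ᵐ x ∂μ, 2 ≤ p.toFun x) {c : α → F} (hc : MemLp c 2 μ) (f : VarLp p F) :
    inner ℝ (hc.toLp c) (toL2 h2 f) = ∫ x, inner ℝ (c x) (f.toAE x) ∂μ := by
  rw [L2.inner_def]
  refine integral_congr_ae ?_
  filter_upwards [hc.coeFn_toLp, coeFn_toL2 h2 f] with x h1 h3
  rw [h1, h3]

theorem mem_of_bounded {F : Type*} [NormedAddCommGroup F] [NormedSpace ℝ F] (p : VarExponent μ)
    {f : α → F} (hf : AEStronglyMeasurable f μ) {C : ℝ} (hC : ∀ x, ‖f x‖ ≤ C) :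
    AEEqFun.mk f hf ∈ varLpSubmodule p F := by
  change p.modular (AEEqFun.mk f hf) < ⊤
  rw [p.modular_congr (AEEqFun.coeFn_mk f hf)]
  set D := max C 1 with hD
  have hD0 : 0 < D := lt_max_of_lt_right one_pos
  have h1 : p.modular (fun x => D⁻¹ • f x) < ⊤ := by
    refine lt_of_le_of_lt (lintegral_mono_ae (g := fun _ => 1) ?_) (by simp)
    filter_upwards [p.one_le] with x hx
    refine ENNReal.rpow_le_one ?_ (by linarith)
    rw [← ofReal_norm, ENNReal.ofReal_le_one, norm_smul, norm_inv, Real.norm_of_nonneg hD0.le,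
      inv_mul_le_iff₀ hD0, mul_one]
    exact (hC x).trans (le_max_left _ _)
  have h3 := p.modular_smul_lt_top D h1
  simpa only [smul_smul, mul_inv_cancel₀ hD0.ne', one_smul] using h3

end VarLp

section Sobolev

variable {n : ℕ} {Ω : Set (EuclideanSpace ℝ (Fin n))} {p : VarExponent (volume.restrict Ω)}

theorem IsTestFunction.continuous_fderiv_apply {φ : EuclideanSpace ℝ (Fin n) → ℝ}
    (hφ : IsTestFunction Ω φ) (e : EuclideanSpace ℝ (Fin n)) :
    Continuous fun x => fderiv ℝ φ x e :=
  (hφ.1.continuous_fderiv (by simp)).clm_apply continuous_const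

theorem IsTestFunction.mono {U : Set (EuclideanSpace ℝ (Fin n))}
    {φ : EuclideanSpace ℝ (Fin n) → ℝ} (hφ : IsTestFunction U φ) (h : U ⊆ Ω) :
    IsTestFunction Ω φ :=
  ⟨hφ.1, hφ.2.1, hφ.2.2.trans h⟩

theorem IsTestFunction.fderiv_eq_zero {φ : EuclideanSpace ℝ (Fin n) → ℝ}
    (hφ : IsTestFunction Ω φ) {x : EuclideanSpace ℝ (Fin n)} (hx : x ∉ Ω) : fderiv ℝ φ x = 0 :=
  image_eq_zero_of_notMem_tsupport fun h => hx (hφ.2.2 (tsupport_fderiv_subset ℝ h))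

theorem IsTestFunction.eq_zero {φ : EuclideanSpace ℝ (Fin n) → ℝ}
    (hφ : IsTestFunction Ω φ) {x : EuclideanSpace ℝ (Fin n)} (hx : x ∉ Ω) : φ x = 0 :=
  image_eq_zero_of_notMem_tsupport fun h => hx (hφ.2.2 h)

/-- Integration by parts. -/
theorem IsTestFunction.integral_fderiv_mul {φ ψ : EuclideanSpace ℝ (Fin n) → ℝ}
    (hφ : IsTestFunction Ω φ) (hψ : ContDiff ℝ ∞ ψ) (e : EuclideanSpace ℝ (Fin n)) :
    ∫ x in Ω, fderiv ℝ φ x e * ψ x = -∫ x in Ω, φ x * fderiv ℝ ψ x e := by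
  have hψc : Continuous fun x => fderiv ℝ ψ x e :=
    (hψ.continuous_fderiv (by simp)).clm_apply continuous_const
  have h1 : Integrable fun x => fderiv ℝ φ x e * ψ x :=
    ((hφ.continuous_fderiv_apply e).mul hψ.continuous).integrable_of_hasCompactSupport
      ((hφ.2.1.fderiv_apply ℝ e).mul_right)
  have h2 : Integrable fun x => φ x * fderiv ℝ ψ x e :=
    (hφ.1.continuous.mul hψc).integrable_of_hasCompactSupport hφ.2.1.mul_right
  have h3 : Integrable fun x => φ x * ψ x :=
    (hφ.1.continuous.mul hψ.continuous).integrable_of_hasCompactSupport hφ.2.1.mul_right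
  have h := integral_mul_fderiv_eq_neg_fderiv_mul_of_integrable h1 h2 h3
    (fun x _ => hφ.1.differentiable (by simp) x) (fun x _ => hψ.differentiable (by simp) x)
  rw [setIntegral_eq_integral_of_forall_compl_eq_zero (fun x hx => by
      rw [hφ.fderiv_eq_zero hx, zero_apply, zero_mul]),
    setIntegral_eq_integral_of_forall_compl_eq_zero (fun x hx => by
      rw [hφ.eq_zero hx, zero_mul]), h, neg_neg]

namespace VarSobolev

theorem ext_ae {v w : VarSobolev p} (h1 : val v =ᵐ[volume.restrict Ω] val w)
    (h2 : grad v =ᵐ[volume.restrict Ω] grad w) : v = w :=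
  Subtype.ext (WithLp.ofLp_injective 1
    (Prod.ext (Subtype.ext (AEEqFun.ext h1)) (Subtype.ext (AEEqFun.ext h2))))

/-- The map `u ↦ u` from `W^{1,p(·)}` to `L^{p(·)}`. -/
noncomputable def valL : VarSobolev p →L[ℝ] VarLp p ℝ :=
  (WithLp.fstL 1 ℝ (VarLp p ℝ) (VarLp p (EuclideanSpace ℝ (Fin n)))).comp
    (varSobolevSubmodule p).subtypeL

/-- The map `u ↦ ∇u` from `W^{1,p(·)}` to `L^{p(·)}`. -/
noncomputable def gradL : VarSobolev p →L[ℝ] VarLp p (EuclideanSpace ℝ (Fin n)) :=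
  (WithLp.sndL 1 ℝ (VarLp p ℝ) (VarLp p (EuclideanSpace ℝ (Fin n)))).comp
    (varSobolevSubmodule p).subtypeL

theorem norm_eq_valL_add_gradL (w : VarSobolev p) : ‖w‖ = ‖valL w‖ + ‖gradL w‖ :=
  norm_eq w

/-- Testing with `φ` supported in `U` gives `∫ φ ∂_e w = -c ∫ ∂_e φ = 0`, and the fundamental lemma
of the calculus of variations applies. -/
theorem grad_ae_eq_zero_of_val_const {U : Set (EuclideanSpace ℝ (Fin n))} (hU : IsOpen U)
    (hUΩ : U ⊆ Ω) (w : VarSobolev p) {c : ℝ}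
    (hc : ∀ᵐ x ∂(volume.restrict Ω), x ∈ U → val w x = c) :
    ∀ᵐ x ∂(volume.restrict Ω), x ∈ U → grad w x = 0 := by
  have hloc : LocallyIntegrable (grad w) (volume.restrict Ω) := (gradL w).locallyIntegrable
  refine hU.ae_eq_zero_of_integral_contDiff_smul_eq_zero (hloc.locallyIntegrableOn U)
    fun φ hφ hφc hφU => ?_
  have hφt : IsTestFunction U φ := ⟨hφ, hφc, hφU⟩
  have hφΩ := hφt.mono hUΩ
  have hint : Integrable (fun x => φ x • grad w x) (volume.restrict Ω) :=
    hloc.integrable_smul_left_of_hasCompactSupport hφ.continuous hφc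
  refine ext_inner_left ℝ fun e => ?_
  rw [inner_zero_right, ← integral_inner hint]
  simp only [inner_smul_right]
  have h1 : ∫ x in Ω, fderiv ℝ φ x e * val w x = -∫ x in Ω, φ x * inner ℝ e (grad w x) :=
    w.2 φ hφΩ e
  have h3 : ∫ x in Ω, fderiv ℝ φ x e * val w x = ∫ x in Ω, fderiv ℝ φ x e * c := by
    refine integral_congr_ae ?_
    filter_upwards [hc] with x hx
    by_cases hxU : x ∈ U
    · rw [hx hxU]
    · rw [hφt.fderiv_eq_zero hxU, zero_apply, zero_mul, zero_mul]
  have h4 := hφΩ.integral_fderiv_mul (contDiff_const (c := c)) e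
  simp only [fderiv_fun_const, Pi.zero_apply, zero_apply, mul_zero, integral_zero, neg_zero] at h4
  linarith

variable [IsFiniteMeasure (volume.restrict Ω)]

/-- For fixed `φ` and `e`, both sides of the weak gradient identity are `L²` pairings with fixed
functions, hence continuous in the pair. -/
theorem isClosed_varSobolevSubmodule
    (h2 : ∀ᵐ x ∂(volume.restrict Ω), 2 ≤ p.toFun x) :
    IsClosed (varSobolevSubmodule p : Set (WithLp 1 (VarLp p ℝ × VarLp p (EuclideanSpace ℝ (Fin n))))) := by
  have hset : (varSobolevSubmodule p :
      Set (WithLp 1 (VarLp p ℝ × VarLp p (EuclideanSpace ℝ (Fin n))))) =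
      ⋂ (φ : EuclideanSpace ℝ (Fin n) → ℝ) (_ : IsTestFunction Ω φ) (e : EuclideanSpace ℝ (Fin n)),
        {w | ∫ x in Ω, fderiv ℝ φ x e * w.fst.toAE x =
          -∫ x in Ω, φ x * inner ℝ e (w.snd.toAE x)} := by
    ext w
    simp only [mem_iInter]
    rfl
  rw [hset]
  refine isClosed_iInter fun φ => isClosed_iInter fun hφ => isClosed_iInter fun e => ?_
  have hc1 : MemLp (fun x => fderiv ℝ φ x e) 2 (volume.restrict Ω) :=
    (hφ.continuous_fderiv_apply e).memLp_of_hasCompactSupport (hφ.2.1.fderiv_apply ℝ e)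
  have hc2 : MemLp (fun x => φ x • e) 2 (volume.restrict Ω) :=
    (hφ.1.continuous.smul continuous_const).memLp_of_hasCompactSupport hφ.2.1.smul_right
  have e1 : ∀ f : VarLp p ℝ, ∫ x in Ω, fderiv ℝ φ x e * f.toAE x =
      inner ℝ (hc1.toLp _) (VarLp.toL2 h2 f) := fun f => by
    rw [VarLp.inner_toLp_toL2]
    simp [mul_comm]
  have e2 : ∀ f : VarLp p (EuclideanSpace ℝ (Fin n)), ∫ x in Ω, φ x * inner ℝ e (f.toAE x) =
      inner ℝ (hc2.toLp _) (VarLp.toL2 h2 f) := fun f => by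
    rw [VarLp.inner_toLp_toL2]
    simp only [inner_smul_left]
    simp
  simp only [e1, e2]
  refine isClosed_eq ?_ ?_
  · exact continuous_const.inner ((VarLp.continuous_toL2 h2).comp (WithLp.fstL 1 ℝ _ _).continuous)
  · exact (continuous_const.inner
      ((VarLp.continuous_toL2 h2).comp (WithLp.sndL 1 ℝ _ _).continuous)).neg

theorem completeSpace (h2 : ∀ᵐ x ∂(volume.restrict Ω), 2 ≤ p.toFun x) :
    CompleteSpace (VarSobolev p) := by
  have := VarLp.completeSpace (F := ℝ) h2
  have := VarLp.completeSpace (F := EuclideanSpace ℝ (Fin n)) h2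
  exact (isClosed_varSobolevSubmodule h2).completeSpace_coe

theorem continuous_toL2 (h2 : ∀ᵐ x ∂(volume.restrict Ω), 2 ≤ p.toFun x) :
    Continuous (toL2 h2) :=
  (VarLp.continuous_toL2 h2).comp valL.continuous

/-- A function vanishing a.e. on `Ω` is the constant `0` there, so its weak gradient vanishes as
well. -/
theorem toL2_injective (h2 : ∀ᵐ x ∂(volume.restrict Ω), 2 ≤ p.toFun x)
    (hΩ : IsOpen Ω) : Function.Injective (toL2 h2) := by
  rw [← LinearMap.ker_eq_bot, LinearMap.ker_eq_bot']
  intro w hw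
  have h1 : val w =ᵐ[volume.restrict Ω] fun _ => 0 := by
    filter_upwards [coeFn_toL2 h2 w, Lp.coeFn_zero ℝ 2 (volume.restrict Ω)] with x h1 h3
    rw [← h1, hw, h3, Pi.zero_apply]
  have h3 := grad_ae_eq_zero_of_val_const hΩ Subset.rfl w (h1.mono fun x hx _ => hx)
  refine ext_ae (h1.trans val_zero.symm) ?_
  have h4 : grad (0 : VarSobolev p) =ᵐ[volume.restrict Ω] 0 := AEEqFun.coeFn_zero
  filter_upwards [h3, ae_restrict_mem hΩ.measurableSet, h4] with x hx hxΩ hx0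
  rw [hx hxΩ, hx0, Pi.zero_apply]

/-- The classical gradient is the weak one by integration by parts, and bounded functions lie in
`L^{p(·)}` of a finite measure. -/
theorem exists_mem_W0_val_eq {φ : EuclideanSpace ℝ (Fin n) → ℝ} (hφ : IsTestFunction Ω φ) :
    ∃ w ∈ W0 p, val w =ᵐ[volume.restrict Ω] φ := by
  have hg : Continuous (gradient φ) :=
    (InnerProductSpace.toDual ℝ (EuclideanSpace ℝ (Fin n))).symm.continuous.comp
      (hφ.1.continuous_fderiv (by simp))
  have hgc : HasCompactSupport (gradient φ) :=
    (hφ.2.1.fderiv ℝ).comp_left (g := (InnerProductSpace.toDual ℝ (EuclideanSpace ℝ (Fin n))).symm)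
      (map_zero _)
  obtain ⟨C, hC⟩ := hφ.1.continuous.bounded_above_of_compact_support hφ.2.1
  obtain ⟨D, hD⟩ := hg.bounded_above_of_compact_support hgc
  have hm1 : AEStronglyMeasurable φ (volume.restrict Ω) := hφ.1.continuous.aestronglyMeasurable
  have hm2 : AEStronglyMeasurable (gradient φ) (volume.restrict Ω) := hg.aestronglyMeasurable
  let u : VarLp p ℝ := (⟨_, VarLp.mem_of_bounded p hm1 hC⟩ : varLpSubmodule p ℝ)
  let g : VarLp p (EuclideanSpace ℝ (Fin n)) :=
    (⟨_, VarLp.mem_of_bounded p hm2 hD⟩ : varLpSubmodule p _)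
  have hu : u.toAE =ᵐ[volume.restrict Ω] φ := AEEqFun.coeFn_mk φ hm1
  have hgr : g.toAE =ᵐ[volume.restrict Ω] gradient φ := AEEqFun.coeFn_mk _ hm2
  have hmem : WithLp.toLp 1 (u, g) ∈ varSobolevSubmodule p := by
    intro ψ hψ e
    change ∫ x in Ω, fderiv ℝ ψ x e * u.toAE x = -∫ x in Ω, ψ x * inner ℝ e (g.toAE x)
    have e1 : ∫ x in Ω, fderiv ℝ ψ x e * u.toAE x = ∫ x in Ω, fderiv ℝ ψ x e * φ x := by
      refine integral_congr_ae ?_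
      filter_upwards [hu] with x hx
      rw [hx]
    have e2 : ∫ x in Ω, ψ x * inner ℝ e (g.toAE x) = ∫ x in Ω, ψ x * fderiv ℝ φ x e := by
      refine integral_congr_ae ?_
      filter_upwards [hgr] with x hx
      rw [hx, gradient, real_inner_comm, InnerProductSpace.toDual_symm_apply]
    rw [e1, e2, hψ.integral_fderiv_mul hφ.1 e]
  let w : VarSobolev p := (⟨_, hmem⟩ : varSobolevSubmodule p)
  have hw : val w =ᵐ[volume.restrict Ω] φ := hu
  exact ⟨w, (testFunctions p).le_topologicalClosure ⟨φ, hφ, hw⟩, hw⟩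

end VarSobolev

theorem isClosed_L2ConstOn {m : ℕ} (Ω₀ : Fin m → Set (EuclideanSpace ℝ (Fin n))) :
    IsClosed (L2ConstOn Ω Ω₀ : Set (Lp ℝ 2 (volume.restrict Ω))) := by
  refine IsSeqClosed.isClosed fun f g hf hg i => ?_
  choose c hc using fun k => hf k i
  obtain ⟨ns, hns, hae⟩ := (tendstoInMeasure_of_tendsto_Lp hg).exists_seq_tendsto_ae
  have hc' : ∀ᵐ x ∂(volume.restrict Ω), ∀ k, x ∈ Ω₀ i → f k x = c k := ae_all_iff.2 hc
  by_cases hlim : ∃ a, Tendsto (fun k => c (ns k)) atTop (𝓝 a)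
  · obtain ⟨a, ha⟩ := hlim
    refine ⟨a, ?_⟩
    filter_upwards [hae, hc'] with x h1 h3 hx
    refine tendsto_nhds_unique h1 ?_
    simpa only [h3 _ hx] using ha
  -- If the constants do not converge along the subsequence, no point of `Ω₀ i` can be a point of
  -- convergence, so `Ω₀ i` is null in `Ω` and any constant will do.
  · refine ⟨0, ?_⟩
    filter_upwards [hae, hc'] with x h1 h3 hx
    refine absurd ⟨g x, ?_⟩ hlim
    simpa only [h3 _ hx] using h1

theorem VarSobolev.isClosed_constOn [IsFiniteMeasure (volume.restrict Ω)]
    (h2 : ∀ᵐ x ∂(volume.restrict Ω), 2 ≤ p.toFun x) {m : ℕ}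
    (Ω₀ : Fin m → Set (EuclideanSpace ℝ (Fin n))) :
    IsClosed (VarSobolev.constOn p Ω₀ : Set (VarSobolev p)) := by
  have h : (VarSobolev.constOn p Ω₀ : Set (VarSobolev p)) =
      VarSobolev.toL2 h2 ⁻¹' (L2ConstOn Ω Ω₀) := by
    ext w
    refine forall_congr' fun i => exists_congr fun c => ?_
    refine eventually_congr ?_
    filter_upwards [VarSobolev.coeFn_toL2 h2 w] with x hx
    rw [hx]
  rw [h]
  exact (isClosed_L2ConstOn Ω₀).preimage (VarSobolev.continuous_toL2 h2)

end Sobolev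

/-- A smooth boundary is a null set. -/
theorem HasSmoothBoundary.volume_frontier {n : ℕ} {D : Set (EuclideanSpace ℝ (Fin n))}
    (hD : HasSmoothBoundary D) : volume (frontier D) = 0 := by
  refine measure_null_of_locally_null _ fun x hx => ?_
  obtain ⟨Φ, hxΦ, -, hΦ, i, hi⟩ := hD x hx
  refine ⟨frontier D ∩ Φ.source, inter_mem self_mem_nhdsWithin
    (mem_nhdsWithin_of_mem_nhds (Φ.open_source.mem_nhds hxΦ)), ?_⟩
  set Z : Set (EuclideanSpace ℝ (Fin n)) := {z | z i = 0} with hZ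
  have hsub : frontier D ∩ Φ.source ⊆ Φ.symm '' (Φ.target ∩ Z) := by
    rintro y ⟨hy, hys⟩
    refine ⟨Φ y, ⟨Φ.map_source hys, ?_⟩, Φ.left_inv hys⟩
    have hcont : ContinuousAt (fun z => Φ z i) y :=
      (EuclideanSpace.proj (𝕜 := ℝ) i).continuous.continuousAt.comp (Φ.continuousAt hys)
    have hsrc := Φ.open_source.mem_nhds hys
    -- A nonzero coordinate keeps its sign nearby, which places `y` either outside the closure of
    -- `D` or in its interior. Thus the boundary lies in the image of a hyperplane.
    rcases lt_trichotomy (Φ y i) 0 with h | h | h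
    · refine absurd (frontier_subset_closure hy) ?_
      rw [mem_closure_iff_frequently, not_frequently]
      filter_upwards [hcont.eventually_lt_const h, hsrc] with z hz hzs hzD
      exact lt_asymm hz ((hi z hzs).1 hzD)
    · exact h
    · refine absurd ?_ hy.2
      rw [mem_interior_iff_mem_nhds]
      filter_upwards [hcont.eventually_const_lt h, hsrc] with z hz hzs
      exact (hi z hzs).2 hz
  refine measure_mono_null hsub ?_
  refine addHaar_image_eq_zero_of_differentiableOn_of_addHaar_eq_zero volume
    ((hΦ.differentiableOn (by simp)).mono inter_subset_left) (measure_mono_null inter_subset_right ?_)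
  refine Measure.addHaar_submodule volume
    (LinearMap.ker (EuclideanSpace.proj (𝕜 := ℝ) i).toLinearMap) fun h => ?_
  have : EuclideanSpace.single i (1 : ℝ) ∈ LinearMap.ker (EuclideanSpace.proj (𝕜 := ℝ) i).toLinearMap := by
    rw [h]; trivial
  simp at this

/-- A smooth cutoff function that is `1` on a compact set. -/
theorem exists_isTestFunction_eq_one {n : ℕ} {K U : Set (EuclideanSpace ℝ (Fin n))}
    (hK : IsCompact K) (hU : IsOpen U) (hKU : K ⊆ U) :
    ∃ φ, IsTestFunction U φ ∧ ∀ x ∈ K, φ x = 1 := by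
  -- Making the support the interior of a compact set `L ⊆ U` keeps its closure compact and inside
  -- `U`.
  obtain ⟨L, hL, hKL, hLU⟩ := exists_compact_between hK hU hKU
  obtain ⟨f, hf, -, hfs, hf1⟩ := exists_contMDiff_support_eq_eq_one_iff (n := ⊤)
    (modelWithCornersSelf ℝ (EuclideanSpace ℝ (Fin n))) isOpen_interior hK.isClosed hKL
  have hts : tsupport f ⊆ L := by
    rw [tsupport, hfs]
    exact closure_minimal interior_subset hL.isClosed
  exact ⟨f, ⟨hf.contDiff, hL.of_isClosed_subset (isClosed_tsupport f) hts, hts.trans hLU⟩,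
    fun x hx => (hf1 x).1 hx⟩

/-! ## The diffusion operators -/

namespace LargeDiffusionData

variable {n : ℕ} (S : LargeDiffusionData n)

theorem exponent_le_pMax : ∀ᵐ x ∂(volume.restrict S.Ω), S.exponent.toFun x ≤ S.pMax := by
  filter_upwards [ae_restrict_mem S.isOpen_Ω.measurableSet] with x hx
  exact (S.p_bounds x hx).2

theorem pMax_pos : 0 < S.pMax := by
  obtain ⟨x, hx⟩ := S.connected_Ω.nonempty
  linarith [S.two_lt_pMin, (S.p_bounds x hx).1, (S.p_bounds x hx).2]

theorem isBoundedWeight_one : IsBoundedWeight (volume.restrict S.Ω) (fun _ => (1 : ℝ)) 1 :=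
  ⟨aemeasurable_const, Eventually.of_forall fun _ => zero_le_one, Eventually.of_forall fun _ => le_rfl⟩

variable {S} {a : EuclideanSpace ℝ (Fin n) → ℝ} {M : ℝ}
  (ha : IsBoundedWeight (volume.restrict S.Ω) a M)

/-- The operator `u ↦ -div(a(|∇u|^{p(x)-2} + η)∇u) + |u|^{p(x)-2}u` on a subspace. -/
noncomputable def weightedOperator (W : Submodule ℝ (VarSobolev S.exponent)) (u : W) :
    StrongDual ℝ W :=
  ((VarLp.duality ha S.η_pos.le S.two_le_exponent (VarSobolev.gradL u.1)).comp VarSobolev.gradL +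
    (VarLp.duality S.isBoundedWeight_one le_rfl S.two_le_exponent
      (VarSobolev.valL u.1)).comp VarSobolev.valL).comp W.subtypeL

/-- The potential of `weightedOperator`. -/
noncomputable def weightedEnergy (S : LargeDiffusionData n) (a : EuclideanSpace ℝ (Fin n) → ℝ)
    (W : Submodule ℝ (VarSobolev S.exponent)) (u : W) : ℝ :=
  VarLp.energy a S.η (VarSobolev.gradL u.1) +
    VarLp.energy (fun _ => (1 : ℝ)) 0 (VarSobolev.valL u.1)

variable {W : Submodule ℝ (VarSobolev S.exponent)}

/-! ### Convexity, continuity and coercivity of the weighted operator. -/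

theorem weightedOperator_apply (u v : W) : weightedOperator ha W u v =
    VarLp.duality ha S.η_pos.le S.two_le_exponent (VarSobolev.gradL u.1) (VarSobolev.gradL v.1) +
    VarLp.duality S.isBoundedWeight_one le_rfl S.two_le_exponent (VarSobolev.valL u.1)
      (VarSobolev.valL v.1) := rfl

theorem isSubgradientOperator_weightedOperator :
    IsSubgradientOperator (S.weightedEnergy a W) (weightedOperator ha W) := by
  intro u v
  have h1 := VarLp.isSubgradientOperator_duality ha S.η_pos.le S.two_le_exponent
    (VarSobolev.gradL u.1) (VarSobolev.gradL v.1)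
  have h2 := VarLp.isSubgradientOperator_duality S.isBoundedWeight_one le_rfl S.two_le_exponent
    (VarSobolev.valL u.1) (VarSobolev.valL v.1)
  rw [weightedOperator_apply, weightedEnergy, weightedEnergy, Submodule.coe_sub,
    map_sub VarSobolev.gradL, map_sub VarSobolev.valL]
  linarith

theorem isHemicontinuousOperator_weightedOperator :
    IsHemicontinuousOperator (weightedOperator ha W) := by
  intro u v w
  have h1 := VarLp.isHemicontinuousOperator_duality ha S.η_pos.le S.two_le_exponent
    (VarSobolev.gradL u.1) (VarSobolev.gradL v.1) (VarSobolev.gradL w.1)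
  have h2 := VarLp.isHemicontinuousOperator_duality S.isBoundedWeight_one le_rfl S.two_le_exponent
    (VarSobolev.valL u.1) (VarSobolev.valL v.1) (VarSobolev.valL w.1)
  simp only [weightedOperator_apply, Submodule.coe_add, Submodule.coe_smul, map_add, map_smul]
  exact h1.add h2

theorem weightedEnergy_nonneg (ha : IsBoundedWeight (volume.restrict S.Ω) a M) (u : W) : 0 ≤ S.weightedEnergy a W u :=
  add_nonneg (VarLp.energy_nonneg ha S.η_pos.le S.two_le_exponent _)
    (VarLp.energy_nonneg S.isBoundedWeight_one le_rfl S.two_le_exponent _)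

/-- `⟨A u, u⟩` dominates the modulars of `u` and `∇u`, and each modular dominates its squared norm
minus one. The resulting lower bound is quadratic in `‖u‖`. -/
theorem isCoerciveOperator_weightedOperator {c : ℝ} (hc0 : 0 < c)
    (hc : ∀ w : W, ∀ᵐ x ∂(volume.restrict S.Ω), c ≤ a x ∨ VarSobolev.grad w.1 x = 0) :
    IsCoerciveOperator (weightedOperator ha W) := by
  set k := min c 1 with hk
  have hk0 : 0 < k := lt_min hc0 one_pos
  have hlow : ∀ u : W, k * (‖u‖ ^ 2 / 2 - 2) ≤ weightedOperator ha W u u := by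
    intro u
    have h1 := VarLp.mul_modular_le_duality_self ha S.η_pos.le S.two_le_exponent
      (VarSobolev.gradL u.1) (c := k) ((hc u).mono fun x hx =>
        hx.imp (fun h => (min_le_left _ _).trans h) id)
    have h2 := VarLp.mul_modular_le_duality_self S.isBoundedWeight_one le_rfl S.two_le_exponent
      (VarSobolev.valL u.1) (c := k) (Eventually.of_forall fun x => Or.inl (min_le_right _ _))
    have h3 := mul_le_mul_of_nonneg_left
      (VarLp.norm_sq_sub_one_le S.two_le_exponent (VarSobolev.gradL u.1)) hk0.le
    have h4 := mul_le_mul_of_nonneg_left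
      (VarLp.norm_sq_sub_one_le S.two_le_exponent (VarSobolev.valL u.1)) hk0.le
    have h5 : ‖u‖ = ‖VarSobolev.valL u.1‖ + ‖VarSobolev.gradL u.1‖ :=
      VarSobolev.norm_eq_valL_add_gradL u.1
    have h6 : ‖u‖ ^ 2 / 2 ≤ ‖VarSobolev.gradL u.1‖ ^ 2 + ‖VarSobolev.valL u.1‖ ^ 2 := by
      rw [h5]
      nlinarith [sq_nonneg (‖VarSobolev.valL u.1‖ - ‖VarSobolev.gradL u.1‖)]
    have h7 := mul_le_mul_of_nonneg_left h6 hk0.le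
    rw [weightedOperator_apply]
    linarith
  have ht : Tendsto (fun u : W => k * (‖u‖ / 2 - 2)) (comap norm atTop) atTop :=
    Tendsto.const_mul_atTop hk0 (tendsto_atTop_add_const_right _ _
      (tendsto_comap.atTop_div_const two_pos))
  refine tendsto_atTop_mono' _ ?_ ht
  filter_upwards [tendsto_comap.eventually_ge_atTop (1 : ℝ)] with u hu
  rw [le_div_iff₀ (by linarith)]
  refine le_trans ?_ (hlow u)
  rw [mul_assoc]
  gcongr
  nlinarith

/-- The gaps of the two energies control the modulars of half the difference of the values and of
the gradients; a small modular forces a small norm. -/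
theorem isUniformlyConvexFunctional_weightedEnergy {c : ℝ} (hc0 : 0 < c)
    (ha : IsBoundedWeight (volume.restrict S.Ω) a M)
    (hc : ∀ w : W, ∀ᵐ x ∂(volume.restrict S.Ω), c ≤ a x ∨ VarSobolev.grad w.1 x = 0) :
    IsUniformlyConvexFunctional (S.weightedEnergy a W) := by
  intro ε hε
  set k := min c 1 / S.pMax with hk
  have hk0 : 0 < k := div_pos (lt_min hc0 one_pos) S.pMax_pos
  -- The half difference has norm at most `ε / 8` in each component, so the full Sobolev norm of `u
  -- - v` is at most `ε / 2 < ε`.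
  obtain ⟨δ₁, hδ₁, h₁⟩ := VarLp.exists_norm_le_of_modular_le (F := EuclideanSpace ℝ (Fin n))
    S.exponent (show 0 < ε / 8 by positivity)
  obtain ⟨δ₂, hδ₂, h₂⟩ := VarLp.exists_norm_le_of_modular_le (F := ℝ)
    S.exponent (show 0 < ε / 8 by positivity)
  refine ⟨k * min δ₁ δ₂, mul_pos hk0 (lt_min hδ₁ hδ₂), fun u v huv => ?_⟩
  have g1 := VarLp.mul_modular_le_energy_gap ha S.η_pos.le S.two_le_exponent S.exponent_le_pMax
    (c := min c 1) (VarSobolev.gradL u.1) (VarSobolev.gradL v.1) (by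
      have h := hc (u - v)
      rw [← map_sub]
      exact h.mono fun x hx => hx.imp (fun h => (min_le_left _ _).trans h) id)
  have g2 := VarLp.mul_modular_le_energy_gap S.isBoundedWeight_one le_rfl S.two_le_exponent
    S.exponent_le_pMax (c := min c 1) (VarSobolev.valL u.1) (VarSobolev.valL v.1)
    (Eventually.of_forall fun x => Or.inl (min_le_right _ _))
  simp only [weightedEnergy, Submodule.coe_add, Submodule.coe_smul, map_add, map_smul] at huv
  rw [← hk] at g1 g2
  set ρ₁ := (S.exponent.modular
    ((1 / 2 : ℝ) • (VarSobolev.gradL u.1 - VarSobolev.gradL v.1)).toAE).toReal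
  set ρ₂ := (S.exponent.modular
    ((1 / 2 : ℝ) • (VarSobolev.valL u.1 - VarSobolev.valL v.1)).toAE).toReal
  have hρ₁ : 0 ≤ ρ₁ := ENNReal.toReal_nonneg
  have hρ₂ : 0 ≤ ρ₂ := ENNReal.toReal_nonneg
  have hsum : ρ₁ + ρ₂ < min δ₁ δ₂ := by
    refine lt_of_mul_lt_mul_left ?_ hk0.le
    linarith
  have n1 := h₁ _ (show ρ₁ ≤ δ₁ by linarith [min_le_left δ₁ δ₂])
  have n2 := h₂ _ (show ρ₂ ≤ δ₂ by linarith [min_le_right δ₁ δ₂])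
  rw [norm_smul, Real.norm_of_nonneg (by norm_num), ← map_sub] at n1 n2
  have hn : ‖u - v‖ = ‖VarSobolev.valL (u.1 - v.1)‖ + ‖VarSobolev.gradL (u.1 - v.1)‖ :=
    VarSobolev.norm_eq_valL_add_gradL (u.1 - v.1)
  rw [hn]
  linarith

theorem isDiffusionOperator_weightedOperator {D : Set (EuclideanSpace ℝ (Fin n))}
    (hD : MeasurableSet D) (hDΩ : D ⊆ S.Ω) {b : EuclideanSpace ℝ (Fin n) → ℝ}
    (hb : IsBoundedWeight (volume.restrict S.Ω) (D.indicator b) M) :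
    S.IsDiffusionOperator D b W (weightedOperator hb W) := by
  intro u v
  have hi1 := VarLp.integrable_dualityIntegrand hb S.η_pos.le S.two_le_exponent
    (VarSobolev.gradL u.1) (VarSobolev.gradL v.1)
  have hi2 := VarLp.integrable_dualityIntegrand S.isBoundedWeight_one le_rfl S.two_le_exponent
    (VarSobolev.valL u.1) (VarSobolev.valL v.1)
  have e1 : VarLp.dualityIntegrand (D.indicator b) S.η (VarSobolev.gradL u.1)
      (VarSobolev.gradL v.1) = D.indicator fun x =>
        b x * (‖VarSobolev.grad u.1 x‖ ^ (S.p x - 2) + S.η) *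
          inner ℝ (VarSobolev.grad u.1 x) (VarSobolev.grad v.1 x) := by
    funext x
    by_cases hx : x ∈ D
    · simp only [VarLp.dualityIntegrand, indicator_of_mem hx]
      rfl
    · simp only [VarLp.dualityIntegrand, indicator_of_notMem hx, zero_mul]
  have e2 : VarLp.dualityIntegrand (fun _ => (1 : ℝ)) 0 (VarSobolev.valL u.1)
      (VarSobolev.valL v.1) = fun x => |VarSobolev.val u.1 x| ^ (S.p x - 2) *
        VarSobolev.val u.1 x * VarSobolev.val v.1 x := by
    funext x
    have h : inner ℝ (VarSobolev.val u.1 x) (VarSobolev.val v.1 x) =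
        VarSobolev.val u.1 x * VarSobolev.val v.1 x := by
      simp [mul_comm]
    simp only [VarLp.dualityIntegrand, one_mul, add_zero, Real.norm_eq_abs]
    change |VarSobolev.val u.1 x| ^ (S.p x - 2) *
      inner ℝ (VarSobolev.val u.1 x) (VarSobolev.val v.1 x) = _
    rw [h, mul_assoc]
  have hrestr : (volume.restrict S.Ω).restrict D = volume.restrict D := by
    rw [Measure.restrict_restrict hD, inter_eq_left.2 hDΩ]
  rw [e1, integrable_indicator_iff hD, IntegrableOn, hrestr] at hi1
  rw [e2] at hi2
  refine ⟨hi1, hi2, ?_⟩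
  rw [weightedOperator_apply, VarLp.duality_apply, VarLp.duality_apply, e1, e2,
    integral_indicator hD, hrestr]

/-- The common form of both regimes: `D = Ω` for `λ > 0` and `D = Ω₁` for `λ = 0`. Hypothesis
`hgrad` says that gradients live on `D`, where the coefficient is at least `m₀`. -/
theorem exists_isDiffusionOperator {D : Set (EuclideanSpace ℝ (Fin n))} (hD : IsOpen D)
    (hDΩ : D ⊆ S.Ω) {b : EuclideanSpace ℝ (Fin n) → ℝ} (hbc : ContinuousOn b D)
    (hb : ∀ x ∈ D, S.m₀ ≤ b x ∧ b x ≤ M) (hW : IsClosed (W : Set (VarSobolev S.exponent)))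
    (hgrad : ∀ w : W, ∀ᵐ x ∂(volume.restrict S.Ω), x ∈ D ∨ VarSobolev.grad w.1 x = 0)
    {K : Type*} [NormedAddCommGroup K] [InnerProductSpace ℝ K] [CompleteSpace K]
    {ι : W →ₗ[ℝ] K} (hι : Continuous ι) (hinj : Function.Injective ι) (hd : DenseRange ι) :
    ∃ A : W → StrongDual ℝ W, S.IsDiffusionOperator D b W A ∧
      IsMonotoneOperator A ∧ IsHemicontinuousOperator A ∧ IsCoerciveOperator A ∧
      IsOperatorGraph (realizationGraph ι A) ∧
      IsMaximalMonotoneGraph (realizationGraph ι A) ∧ IsWellPosed (realizationGraph ι A) := by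
  -- The bound `max M 0` also covers the value zero outside `D`, without assuming `M ≥ 0`.
  have ha : IsBoundedWeight (volume.restrict S.Ω) (D.indicator b) (max M 0) := by
    refine ⟨?_, Eventually.of_forall fun x => ?_, Eventually.of_forall fun x => ?_⟩
    · refine ((aemeasurable_indicator_iff hD.measurableSet).2 ?_)
      rw [Measure.restrict_restrict hD.measurableSet, inter_eq_left.2 hDΩ]
      exact hbc.aemeasurable hD.measurableSet
    · exact indicator_nonneg (fun y hy => S.m₀_pos.le.trans (hb y hy).1) x
    · by_cases hx : x ∈ D
      · rw [indicator_of_mem hx]; exact (hb x hx).2.trans (le_max_left _ _)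
      · rw [indicator_of_notMem hx]; exact le_max_right _ _
  have hc : ∀ w : W, ∀ᵐ x ∂(volume.restrict S.Ω),
      S.m₀ ≤ D.indicator b x ∨ VarSobolev.grad w.1 x = 0 := fun w =>
    (hgrad w).mono fun x hx => hx.imp (fun h => by rw [indicator_of_mem h]; exact (hb x h).1) id
  have := VarSobolev.completeSpace S.two_le_exponent
  have : CompleteSpace W := hW.completeSpace_coe
  have hsub := isSubgradientOperator_weightedOperator (W := W) ha
  have hhem := isHemicontinuousOperator_weightedOperator (W := W) ha
  exact ⟨weightedOperator ha W, isDiffusionOperator_weightedOperator hD.measurableSet hDΩ ha,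
    hsub.isMonotoneOperator, hhem, isCoerciveOperator_weightedOperator ha S.m₀_pos hc,
    hsub.realizationGraph_wellPosed hhem (isUniformlyConvexFunctional_weightedEnergy S.m₀_pos ha hc)
      (weightedEnergy_nonneg ha) hι hinj hd⟩

/-! ### Density of the form domains -/

theorem isOpen_Ω₁ : IsOpen S.Ω₁ := S.isOpen_Ω.sdiff isClosed_closure

theorem Ω₀_subset (i : Fin S.m) : S.Ω₀ i ⊆ S.Ω := subset_closure.trans (S.closure_Ω₀_subset i)

/-- Only the boundaries of the `Ω₀ i` are left out: the closure of the finite union is the union of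
the closures, and smooth boundaries are null. -/
theorem ae_mem_Ω₁_or : ∀ᵐ x ∂(volume.restrict S.Ω), x ∈ S.Ω₁ ∨ ∃ i, x ∈ S.Ω₀ i := by
  have h : ∀ᵐ x ∂(volume.restrict S.Ω), ∀ i, x ∉ frontier (S.Ω₀ i) :=
    ae_all_iff.2 fun i => ae_restrict_of_ae
      (measure_eq_zero_iff_ae_notMem.1 (S.smooth_Ω₀ i).volume_frontier)
  filter_upwards [h, ae_restrict_mem S.isOpen_Ω.measurableSet] with x hx hxΩ
  by_cases hcl : x ∈ closure (⋃ i, S.Ω₀ i)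
  · rw [closure_iUnion_of_finite, mem_iUnion] at hcl
    obtain ⟨i, hi⟩ := hcl
    refine Or.inr ⟨i, ?_⟩
    by_contra hn
    refine hx i ⟨hi, ?_⟩
    rwa [(S.isOpen_Ω₀ i).interior_eq]
  · exact Or.inl ⟨hxΩ, hcl⟩

theorem ae_mem_Ω₁_or_grad_eq_zero (w : S.V₀) :
    ∀ᵐ x ∂(volume.restrict S.Ω), x ∈ S.Ω₁ ∨ VarSobolev.grad w.1 x = 0 := by
  have h : ∀ i, ∀ᵐ x ∂(volume.restrict S.Ω), x ∈ S.Ω₀ i → VarSobolev.grad w.1 x = 0 := by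
    intro i
    obtain ⟨c, hc⟩ := w.2.2 i
    exact VarSobolev.grad_ae_eq_zero_of_val_const (S.isOpen_Ω₀ i) (Ω₀_subset i) w.1 hc
  filter_upwards [ae_all_iff.2 h, ae_mem_Ω₁_or] with x hx hx'
  exact hx'.imp id fun ⟨i, hi⟩ => hx i hi

theorem denseRange_of_forall_inner_eq_zero {V K : Type*} [AddCommGroup V] [Module ℝ V]
    [NormedAddCommGroup K] [InnerProductSpace ℝ K] [CompleteSpace K] (ι : V →ₗ[ℝ] K)
    (h : ∀ f, (∀ v, inner ℝ (ι v) f = 0) → f = 0) : DenseRange ι := by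
  have h1 : (LinearMap.range ι).topologicalClosure = ⊤ := by
    rw [Submodule.topologicalClosure_eq_top_iff, Submodule.eq_bot_iff]
    intro f hf
    exact h f fun v => (Submodule.mem_orthogonal _ _).1 hf _ ⟨v, rfl⟩
  have h2 := Submodule.dense_iff_topologicalClosure_eq_top.2 h1
  rwa [LinearMap.coe_range] at h2

theorem inner_toL2_eq {w : VarSobolev S.exponent} {φ : EuclideanSpace ℝ (Fin n) → ℝ}
    (hw : VarSobolev.val w =ᵐ[volume.restrict S.Ω] φ) (f : S.H) :
    inner ℝ (VarSobolev.toL2 S.two_le_exponent w) f = ∫ x in S.Ω, φ x * f x := by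
  rw [L2.inner_def]
  refine integral_congr_ae ?_
  filter_upwards [hw, VarSobolev.coeFn_toL2 S.two_le_exponent w] with x h1 h3
  rw [h3, h1]
  simp [mul_comm]

theorem locallyIntegrable_coeFn (f : S.H) : LocallyIntegrable f (volume.restrict S.Ω) :=
  ((Lp.memLp f).integrable (by norm_num)).locallyIntegrable

theorem denseRange_incl : DenseRange S.incl := by
  refine denseRange_of_forall_inner_eq_zero _ fun f hf => ?_
  have h1 : ∀ᵐ x ∂(volume.restrict S.Ω), x ∈ S.Ω → f x = 0 := by
    refine S.isOpen_Ω.ae_eq_zero_of_integral_contDiff_smul_eq_zero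
      ((locallyIntegrable_coeFn f).locallyIntegrableOn _) fun φ hφ hφc hφΩ => ?_
    obtain ⟨w, hwV, hw⟩ := VarSobolev.exists_mem_W0_val_eq (p := S.exponent)
      (⟨hφ, hφc, hφΩ⟩ : IsTestFunction S.Ω φ)
    have h := hf ⟨w, hwV⟩
    rw [← h]
    exact (inner_toL2_eq hw f).symm
  refine Lp.ext ?_
  filter_upwards [h1, ae_restrict_mem S.isOpen_Ω.measurableSet,
    Lp.coeFn_zero ℝ 2 (volume.restrict S.Ω)] with x hx hxΩ h0
  rw [hx hxΩ, h0, Pi.zero_apply]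

/-- Let `g ∈ H₀` be orthogonal to `V₀`. Test functions supported in `Ω₁` give `g = 0` there. A
cutoff equal to `1` on `Ω₀ i` and `0` on the other inclusions is then an admissible test that
isolates the constant of `g` on `Ω₀ i`. -/
theorem denseRange_incl₀ [CompleteSpace S.H₀] : DenseRange S.incl₀ := by
  refine denseRange_of_forall_inner_eq_zero _ fun f hf => ?_
  set g : S.H := f.1 with hg
  have htest : ∀ φ, IsTestFunction S.Ω φ → (∀ i, ∃ c : ℝ, ∀ x ∈ S.Ω₀ i, φ x = c) →
      ∫ x in S.Ω, φ x * g x = 0 := by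
    intro φ hφ hφc
    obtain ⟨w, hwV, hw⟩ := VarSobolev.exists_mem_W0_val_eq (p := S.exponent) hφ
    have hwc : w ∈ VarSobolev.constOn S.exponent S.Ω₀ := by
      intro i
      obtain ⟨c, hc⟩ := hφc i
      refine ⟨c, ?_⟩
      filter_upwards [hw] with x hx hxi
      rw [hx, hc x hxi]
    have h := hf ⟨w, hwV, hwc⟩
    rw [← inner_toL2_eq hw g]
    exact h
  have h1 : ∀ᵐ x ∂(volume.restrict S.Ω), x ∈ S.Ω₁ → g x = 0 := by
    refine isOpen_Ω₁.ae_eq_zero_of_integral_contDiff_smul_eq_zero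
      ((locallyIntegrable_coeFn g).locallyIntegrableOn _) fun φ hφ hφc hφΩ => ?_
    have hφt : IsTestFunction S.Ω₁ φ := ⟨hφ, hφc, hφΩ⟩
    refine htest φ (hφt.mono sdiff_subset) fun i => ⟨0, fun x hx => hφt.eq_zero fun hx' => ?_⟩
    exact hx'.2 (subset_closure (mem_iUnion_of_mem i hx))
  choose c hc using f.2
  have h3 : ∀ i, ∀ᵐ x ∂(volume.restrict S.Ω), x ∈ S.Ω₀ i → g x = 0 := by
    intro i
    -- Removing the other closures leaves an open set that still contains `closure (Ω₀ i)`, by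
    -- disjointness; the cutoff is supported there.
    set C : Set (EuclideanSpace ℝ (Fin n)) := ⋃ j : {j // j ≠ i}, closure (S.Ω₀ j) with hC
    have hCc : IsClosed C := isClosed_iUnion_of_finite fun _ => isClosed_closure
    have hK : IsCompact (closure (S.Ω₀ i)) :=
      (S.bounded_Ω.subset (Ω₀_subset i)).isCompact_closure
    obtain ⟨φ, hφ, hφ1⟩ := exists_isTestFunction_eq_one hK (S.isOpen_Ω.sdiff hCc)
      (fun x hx => ⟨S.closure_Ω₀_subset i hx, fun hxC => by
        obtain ⟨j, hj⟩ := mem_iUnion.1 hxC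
        exact (S.disjoint_Ω₀ j i j.2).le_bot ⟨hj, hx⟩⟩)
    have hφj : ∀ j, j ≠ i → ∀ x ∈ S.Ω₀ j, φ x = 0 := fun j hj x hx =>
      hφ.eq_zero fun hx' => hx'.2 (mem_iUnion.2 ⟨⟨j, hj⟩, subset_closure hx⟩)
    have hφi : ∀ x ∈ S.Ω₀ i, φ x = 1 := fun x hx => hφ1 x (subset_closure hx)
    -- The extra factor `c i` makes the integrand nonnegative. Its zero integral then gives `c i =
    -- 0` a.e. on `Ω₀ i` directly, with an empty `Ω₀ i` included.
    have h4 : ∀ᵐ x ∂(volume.restrict S.Ω), φ x * g x * c i = (S.Ω₀ i).indicator (fun _ => c i ^ 2) x := by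
      filter_upwards [h1, ae_all_iff.2 hc, ae_mem_Ω₁_or] with x hx1 hxc hx
      by_cases hxi : x ∈ S.Ω₀ i
      · rw [indicator_of_mem hxi, hφi x hxi, hxc i hxi]
        ring
      · rw [indicator_of_notMem hxi]
        rcases hx with hx | ⟨j, hj⟩
        · rw [hx1 hx, mul_zero, zero_mul]
        · rw [hφj j (fun h => hxi (h ▸ hj)) x hj, zero_mul, zero_mul]
    have h5 : ∫ x in S.Ω, φ x * g x * c i = 0 := by
      rw [integral_mul_const, htest φ (hφ.mono sdiff_subset) fun j => ?_, zero_mul]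
      by_cases hj : j = i
      · exact ⟨1, hj ▸ hφi⟩
      · exact ⟨0, hφj j hj⟩
    rw [integral_congr_ae h4, integral_eq_zero_iff_of_nonneg
      (indicator_nonneg fun _ _ => sq_nonneg _)
      ((integrable_const _).indicator (S.isOpen_Ω₀ i).measurableSet)] at h5
    filter_upwards [h5, hc i] with x hx hxc hxi
    rw [indicator_of_mem hxi] at hx
    rw [hxc hxi]
    exact pow_eq_zero_iff two_ne_zero |>.1 hx
  refine Subtype.ext (Lp.ext ?_)
  filter_upwards [h1, ae_all_iff.2 h3, ae_mem_Ω₁_or,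
    Lp.coeFn_zero ℝ 2 (volume.restrict S.Ω)] with x hx1 hx3 hx h0
  refine Eq.trans ?_ h0.symm
  rcases hx with hx | ⟨i, hi⟩
  · exact hx1 hx
  · exact hx3 i hi

end LargeDiffusionData

/-! ### The operators for `λ > 0` and for the limit `λ = 0`. -/

theorem mainTheorem7 {n : ℕ} (hn : 1 ≤ n) (S : LargeDiffusionData n) :
    (∀ l ∈ Set.Ioc (0 : ℝ) 1, ∃ A : S.V → StrongDual ℝ S.V,
      S.IsDiffusionOperator S.Ω (S.d l) S.V A ∧
      IsMonotoneOperator A ∧ IsHemicontinuousOperator A ∧ IsCoerciveOperator A ∧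
      IsOperatorGraph (realizationGraph S.incl A) ∧
      IsMaximalMonotoneGraph (realizationGraph S.incl A) ∧
      IsWellPosed (realizationGraph S.incl A)) ∧
    (∃ A : S.V₀ → StrongDual ℝ S.V₀,
      S.IsDiffusionOperator S.Ω₁ (S.d 0) S.V₀ A ∧
      IsMonotoneOperator A ∧ IsHemicontinuousOperator A ∧ IsCoerciveOperator A ∧
      IsOperatorGraph (realizationGraph S.incl₀ A) ∧
      IsMaximalMonotoneGraph (realizationGraph S.incl₀ A) ∧
      IsWellPosed (realizationGraph S.incl₀ A)) := by
  have hV : IsClosed (S.V : Set (VarSobolev S.exponent)) :=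
    Submodule.isClosed_topologicalClosure _
  have hV₀ : IsClosed (S.V₀ : Set (VarSobolev S.exponent)) :=
    hV.inter (VarSobolev.isClosed_constOn S.two_le_exponent S.Ω₀)
  have hcont := VarSobolev.continuous_toL2 S.two_le_exponent
  have hinj := VarSobolev.toL2_injective S.two_le_exponent S.isOpen_Ω
  have hH₀ : CompleteSpace S.H₀ := (isClosed_L2ConstOn S.Ω₀).completeSpace_coe
  refine ⟨fun l hl => ?_, ?_⟩
  · refine LargeDiffusionData.exists_isDiffusionOperator S.isOpen_Ω Subset.rfl
      (S.smooth_d l hl).continuousOn (S.d_bounds l hl) hV (fun w => ?_)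
      (hcont.comp continuous_subtype_val) (hinj.comp Subtype.val_injective)
      LargeDiffusionData.denseRange_incl
    filter_upwards [ae_restrict_mem S.isOpen_Ω.measurableSet] with x hx
    exact Or.inl hx
  · refine LargeDiffusionData.exists_isDiffusionOperator LargeDiffusionData.isOpen_Ω₁ sdiff_subset
      S.smooth_d_zero.continuousOn S.d_zero_bounds hV₀
      LargeDiffusionData.ae_mem_Ω₁_or_grad_eq_zero
      ((hcont.comp continuous_subtype_val).subtype_mk _) (fun u v huv => ?_)
      LargeDiffusionData.denseRange_incl₀
    exact Subtype.ext (hinj (congrArg Subtype.val huv))
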